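/- Let $(\Sigma,g)$ be a connected oriented smooth surface with a smooth Lorentzian metric $g$. Let $j$ be its paracomplex structure, i.e. the smooth field of endomorphisms of $T\Sigma$ with $j^2=\mathrm{Id}$, $g(j\cdot,j\cdot)=-g(\cdot,\cdot)$, and $je_1=e_2$ for every positively oriented frame $(e_1,e_2)$ with $g(e_1,e_1)=1=-g(e_2,e_2)$, $g(e_1,e_2)=0$; put $\omega(\cdot,\cdot)=g(j\cdot,\cdot)$. On $\Sigma\times\Sigma$, with projections $\pi_1,\pi_2$, consider $$G^-=\pi_1^*g-\pi_2^*g,\qquad \Omega^-=\pi_1^*\omega-\pi_2^*\omega .$$ Assume that $(\Sigma,g)$ is non-flat: its Gauss curvature $\kappa$ vanishes nowhere, or, more generally, $\{\kappa\neq0\}$ is dense in $\Sigma$ and $\kappa(x)\kappa(y)>0$ for all $x,y\in\Sigma$ with $\kappa(x)\neq0\neq\kappa(y)$. Let $S$ be a smooth surface and $\Phi=(\phi,\psi):S\to\Sigma\times\Sigma$ a smooth immersion which is Lagrangian ($\Phi^*\Omega^-=0$) and $G^-$-minimal (the induced metric $\Phi^*G^-$ is nondegenerate and the mean curvature vector of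 $\Phi$ with respect to $G^-$ vanishes). Then $\Phi$ is of projected rank one at every $p\in S$, that is, $d\phi_p$ or $d\psi_p$ has rank one. Moreover, $\Phi$ is locally a product of two geodesics of $(\Sigma,g)$: for every $p\in S$ there are $\delta>0$, a smooth local parametrisation $F$ (a diffeomorphism of $(-\delta,\delta)^2$ onto an open subset of $S$) with $F(0,0)=p$, and two geodesics $\gamma_1,\gamma_2:(-\delta,\delta)\to\Sigma$ of $g$ with $g(\gamma_i',\gamma_i')=\pm1$, such that $\Phi(F(s,t))=(\gamma_1(s),\gamma_2(t))$ for all $s,t\in(-\delta,\delta)$. -/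

import Mathlib

open Set Topology Manifold Bundle
open scoped ContDiff

noncomputable section

/-- The model plane of a surface. -/
abbrev Plane : Type := EuclideanSpace ℝ (Fin 2)

namespace PseudoRiemannian

section General

variable {E : Type*} [NormedAddCommGroup E] [NormedSpace ℝ E]
  {H : Type*} [TopologicalSpace H] (I : ModelWithCorners ℝ E H)
  {M : Type*} [TopologicalSpace M] [ChartedSpace H M]
  {E' : Type*} [NormedAddCommGroup E'] [NormedSpace ℝ E']
  {H' : Type*} [TopologicalSpace H'] (J : ModelWithCorners ℝ E' H')
  {N : Type*} [TopologicalSpace N] [ChartedSpace H' N]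

/-- A field of bilinear forms on the tangent spaces of a manifold (a covariant 2-tensor field,
with no regularity imposed). -/
abbrev BilinField (M : Type*) [TopologicalSpace M] [ChartedSpace H M] : Type _ :=
  ∀ x : M, TangentSpace I x →L[ℝ] TangentSpace I x →L[ℝ] ℝ

variable {I J}

/-- The pullback `(f^* B)_x (v, w) = B_{f x} (df_x v, df_x w)`. -/
def pullback (B : BilinField J N) (f : M → N) : BilinField I M := fun x =>
  let b : E' →L[ℝ] E' →L[ℝ] ℝ := B (f x)
  let A : E →L[ℝ] E' := mfderiv I J f x
  let c : E →L[ℝ] E →L[ℝ] ℝ := b.bilinearComp A A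
  c

theorem pullback_apply (B : BilinField J N) (f : M → N) (x : M) (v w : TangentSpace I x) :
    pullback B f x v w = B (f x) (mfderiv I J f x v) (mfderiv I J f x w) := rfl

/-- The metric `G` written in the preferred chart at `x`, at the coordinate point `u`. -/
def coordMetric (G : BilinField I M) (x : M) (u : E) : E →L[ℝ] E →L[ℝ] ℝ :=
  pullback (I := 𝓘(ℝ, E)) G (extChartAt I x).symm u

/-- Christoffel symbols of the first kind in the chart at `x`, as the linear form
`Z ↦ (∂_X G(Y,Z) + ∂_Y G(X,Z) - ∂_Z G(X,Y)) / 2`. -/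
def christoffelLower (G : BilinField I M) (x : M) (u X Y : E) : E →L[ℝ] ℝ :=
  (1 / 2 : ℝ) • (fderiv ℝ (coordMetric G x) u X Y + fderiv ℝ (coordMetric G x) u Y X
    - ((fderiv ℝ (coordMetric G x) u).flip X).flip Y)

/-- Christoffel symbols of the Levi-Civita connection of `G` in the chart at `x`: the vector
`Γ(X,Y)` with `G(Γ(X,Y), Z) = christoffelLower G x u X Y Z` for all `Z` (for nondegenerate `G` on
a finite-dimensional manifold, `coordMetric G x u` is invertible as a map to the dual). -/
def christoffel (G : BilinField I M) (x : M) (u X Y : E) : E :=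
  (coordMetric G x u).inverse (christoffelLower G x u X Y)

/-- The curvature tensor `R(X,Y)Z = D_X D_Y Z - D_Y D_X Z - D_[X,Y] Z` of the Levi-Civita
connection of `G`, in the chart at `x`. -/
def curvature (G : BilinField I M) (x : M) (u X Y Z : E) : E :=
  fderiv ℝ (fun v => christoffel G x v Y Z) u X - fderiv ℝ (fun v => christoffel G x v X Z) u Y
    + christoffel G x u X (christoffel G x u Y Z) - christoffel G x u Y (christoffel G x u X Z)

/-- The second covariant derivative of a map `f : M → N` at `p`, for the Levi-Civita connection of
the metric `G` on `N`, and for vector fields with constant components in the chart of `M` at `p`: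
`D_V (df W)`, i.e. `∂_V ∂_W f + Γ(∂_V f, ∂_W f)` in the chart of `N` at `f p`. -/
def covHess (G : BilinField J N) (f : M → N) (p : M) (V W : TangentSpace I p) :
    TangentSpace J (f p) :=
  (fderiv ℝ (fderiv ℝ (writtenInExtChartAt I J p f)) (extChartAt I p p) (V : E) (W : E)
    + christoffel G (f p) (extChartAt J (f p) (f p)) (mfderiv I J f p V) (mfderiv I J f p W) : E')

/-- The smooth curve `γ`, on the open set `s` of parameters, is a non-null geodesic parametrised by
arclength: `G(γ', γ') = ±1` and `D_{γ'} γ' = 0`. -/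
structure IsUnitGeodesicOn (G : BilinField J N) (γ : ℝ → N) (s : Set ℝ) : Prop where
  smooth : ContMDiffOn 𝓘(ℝ, ℝ) J ∞ γ s
  unit : ∀ t ∈ s, |pullback (I := 𝓘(ℝ, ℝ)) G γ t (1 : ℝ) (1 : ℝ)| = 1
  geodesic : ∀ t ∈ s, covHess (I := 𝓘(ℝ, ℝ)) G γ t (1 : ℝ) (1 : ℝ) = 0

/-- A smooth immersion. -/
structure IsSmoothImmersion (I : ModelWithCorners ℝ E H) (J : ModelWithCorners ℝ E' H')
    (f : M → N) : Prop where
  smooth : ContMDiff I J ∞ f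
  injective : ∀ p, Function.Injective (mfderiv I J f p)

end General

section Surfaces

variable {M : Type*} [TopologicalSpace M] [ChartedSpace Plane M]
  {E' : Type*} [NormedAddCommGroup E'] [NormedSpace ℝ E']
  {H' : Type*} [TopologicalSpace H'] {J : ModelWithCorners ℝ E' H'}
  {N : Type*} [TopologicalSpace N] [ChartedSpace H' N]

/-- The vector `e_i` of the model plane, seen as the coordinate vector `∂_i` at `p` for the chart
at `p`. -/
def coordVec (p : M) (i : Fin 2) : TangentSpace (𝓡 2) p :=
  (EuclideanSpace.single i (1 : ℝ) : Plane)

/-- The Gauss curvature `G(R(∂₁,∂₂)∂₂,∂₁) / (G₁₁ G₂₂ - G₁₂²)` of a surface. -/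
def gaussCurvature (G : BilinField (𝓡 2) M) (x : M) : ℝ :=
  let e : Fin 2 → Plane := coordVec x
  let R : Plane := curvature G x (extChartAt (𝓡 2) x x) (e 0) (e 1) (e 1)
  G x R (e 0) / (G x (e 0) (e 0) * G x (e 1) (e 1) - G x (e 0) (e 1) ^ 2)

/-- The matrix `h_ij = G(∂_i Φ, ∂_j Φ)` of the induced metric of a surface `Φ`. -/
def inducedGram (G : BilinField J N) (Φ : M → N) (p : M) : Matrix (Fin 2) (Fin 2) ℝ :=
  Matrix.of fun i j => pullback (I := 𝓡 2) G Φ p (coordVec p i) (coordVec p j)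

/-- The trace `T = h^ij D_{∂_i} ∂_j Φ`. -/
def traceHess (G : BilinField J N) (Φ : M → N) (p : M) : TangentSpace J (Φ p) :=
  ∑ i, ∑ j, (inducedGram G Φ p)⁻¹ i j •
    covHess (I := 𝓡 2) G Φ p (coordVec p i) (coordVec p j)

/-- The mean curvature vector of a surface `Φ` with nondegenerate induced metric: half the trace of
the second fundamental form, the latter being the normal part of `D_{∂_i} ∂_j Φ`. The subtracted sum
`h^ij G(T, ∂_i Φ) ∂_j Φ` is the tangential part of `T`. -/
def meanCurvature (G : BilinField J N) (Φ : M → N) (p : M) : TangentSpace J (Φ p) :=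
  (1 / 2 : ℝ) • (traceHess G Φ p
    - ∑ i, ∑ j, ((inducedGram G Φ p)⁻¹ i j *
        G (Φ p) (traceHess G Φ p) (mfderiv (𝓡 2) J Φ p (coordVec p i))) •
          mfderiv (𝓡 2) J Φ p (coordVec p j))

/-- A surface is `G`-minimal if its induced metric is nondegenerate and its mean curvature vector
vanishes. -/
structure IsMinimalSurface (G : BilinField J N) (Φ : M → N) : Prop where
  nondegenerate : ∀ p, ∀ v : TangentSpace (𝓡 2) p,
    (∀ w, pullback (I := 𝓡 2) G Φ p v w = 0) → v = 0
  minimal : ∀ p, meanCurvature G Φ p = 0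

end Surfaces

end PseudoRiemannian

open PseudoRiemannian

section Lorentz

/-- A smooth Lorentzian metric on a surface. -/
structure LorentzMetric (M : Type*) [TopologicalSpace M] [ChartedSpace Plane M]
    [IsManifold (𝓡 2) ∞ M] where
  metric : BilinField (𝓡 2) M
  symm : ∀ x v w, metric x v w = metric x w v
  nondegenerate : ∀ x v, (∀ w, metric x v w = 0) → v = 0
  indefinite : ∀ x, (∃ v, 0 < metric x v v) ∧ ∃ w, metric x w w < 0
  smooth : ContMDiff (𝓡 2) ((𝓡 2).prod 𝓘(ℝ, Plane →L[ℝ] Plane →L[ℝ] ℝ)) ∞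
    (fun x : M => TotalSpace.mk' (Plane →L[ℝ] Plane →L[ℝ] ℝ)
      (E := fun x : M => TangentSpace (𝓡 2) x →L[ℝ] TangentSpace (𝓡 2) x →L[ℝ] ℝ) x (metric x))

/-- A para-Kähler structure `(g, j)` on a surface: a Lorentzian metric `g` and a smooth field `j` of
endomorphisms with `j² = id` and `g(j·, j·) = -g(·, ·)`.

At each point `g` admits exactly two such `j`, opposite to each other; in an orthonormal frame with
`g(e₁,e₁) = 1 = -g(e₂,e₂)` they are `j e₁ = ± e₂`, `j e₂ = ± e₁`. Hence the choice of a smooth `j` is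
the same as the choice of an orientation (the one for which these frames satisfy `j e₁ = e₂` exactly
when they are positively oriented). The Nijenhuis tensor of `j` vanishes automatically in
dimension two. -/
structure ParaKahlerSurface (M : Type*) [TopologicalSpace M] [ChartedSpace Plane M]
    [IsManifold (𝓡 2) ∞ M] extends LorentzMetric M where
  j : ∀ x : M, TangentSpace (𝓡 2) x →L[ℝ] TangentSpace (𝓡 2) x
  j_sq : ∀ x v, j x (j x v) = v
  j_metric : ∀ x v w, metric x (j x v) (j x w) = -metric x v w
  j_smooth : ContMDiff (𝓡 2) ((𝓡 2).prod 𝓘(ℝ, Plane →L[ℝ] Plane)) ∞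
    (fun x : M => TotalSpace.mk' (Plane →L[ℝ] Plane)
      (E := fun x : M => TangentSpace (𝓡 2) x →L[ℝ] TangentSpace (𝓡 2) x) x (j x))

variable {M : Type*} [TopologicalSpace M] [ChartedSpace Plane M] [IsManifold (𝓡 2) ∞ M]
  {M₁ : Type*} [TopologicalSpace M₁] [ChartedSpace Plane M₁] [IsManifold (𝓡 2) ∞ M₁]
  {M₂ : Type*} [TopologicalSpace M₂] [ChartedSpace Plane M₂] [IsManifold (𝓡 2) ∞ M₂]

/-- The symplectic form `ω(v, w) = g(j v, w)`. -/
def ParaKahlerSurface.omega (A : ParaKahlerSurface M) : BilinField (𝓡 2) M :=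
  fun x => (A.metric x).comp (A.j x)

/-- The metric `G^ε = π₁^* g₁ + ε π₂^* g₂` on the product. -/
def prodMetric (ε : ℝ) (A₁ : LorentzMetric M₁) (A₂ : LorentzMetric M₂) :
    BilinField ((𝓡 2).prod (𝓡 2)) (M₁ × M₂) :=
  fun z => pullback A₁.metric Prod.fst z + ε • pullback A₂.metric Prod.snd z

/-- The symplectic form `Ω^ε = π₁^* ω₁ + ε π₂^* ω₂` on the product. -/
def prodOmega (ε : ℝ) (A₁ : ParaKahlerSurface M₁) (A₂ : ParaKahlerSurface M₂) :
    BilinField ((𝓡 2).prod (𝓡 2)) (M₁ × M₂) :=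
  fun z => pullback A₁.omega Prod.fst z + ε • pullback A₂.omega Prod.snd z

/-- Non-flatness: the Gauss curvature vanishes nowhere, or, more generally, it is nonzero on a dense
set (in particular, almost everywhere) and the product of its values at any two non-flat points is
positive. -/
def LorentzMetric.IsNonFlat (A : LorentzMetric M) : Prop :=
  (∀ x, gaussCurvature A.metric x ≠ 0) ∨
    (Dense {x | gaussCurvature A.metric x ≠ 0} ∧
      ∀ x y, gaussCurvature A.metric x ≠ 0 → gaussCurvature A.metric y ≠ 0 →
        0 < gaussCurvature A.metric x * gaussCurvature A.metric y)

variable {S : Type*} [TopologicalSpace S] [ChartedSpace Plane S]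

/-- `Φ : S → M₁ × M₂` is Lagrangian for `Ω^ε`: the pullback of `Ω^ε` vanishes. -/
def IsLagrangian (ε : ℝ) (A₁ : ParaKahlerSurface M₁) (A₂ : ParaKahlerSurface M₂)
    (Φ : S → M₁ × M₂) : Prop :=
  ∀ p, ∀ v w : TangentSpace (𝓡 2) p,
    pullback (I := 𝓡 2) (prodOmega ε A₁ A₂) Φ p v w = 0

/-- The rank at `p` of a map between surfaces. -/
def rankAt (f : S → M) (p : S) : ℕ :=
  Module.finrank ℝ (LinearMap.range (mfderiv (𝓡 2) (𝓡 2) f p).toLinearMap)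

/-- `Φ = (φ, ψ)` is of projected rank one at `p`: `φ` or `ψ` has rank one at `p`. -/
def IsProjectedRankOneAt (Φ : S → M₁ × M₂) (p : S) : Prop :=
  rankAt (fun q => (Φ q).1) p = 1 ∨ rankAt (fun q => (Φ q).2) p = 1

/-- Near `p`, the surface `Φ` is a product of two non-null geodesics `γ₁`, `γ₂`: in a smooth local
parametrisation `F` of `S` around `p` one has `Φ (F (s, t)) = (γ₁ s, γ₂ t)`. -/
def IsProductOfGeodesicsNear (A₁ : LorentzMetric M₁) (A₂ : LorentzMetric M₂)
    (Φ : S → M₁ × M₂) (p : S) : Prop :=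
  ∃ (δ : ℝ) (F : OpenPartialHomeomorph (ℝ × ℝ) S) (γ₁ : ℝ → M₁) (γ₂ : ℝ → M₂),
    0 < δ ∧ F.source = Ioo (-δ) δ ×ˢ Ioo (-δ) δ ∧ F (0, 0) = p ∧
    ContMDiffOn 𝓘(ℝ, ℝ × ℝ) (𝓡 2) ∞ F F.source ∧
    ContMDiffOn (𝓡 2) 𝓘(ℝ, ℝ × ℝ) ∞ F.symm F.target ∧
    IsUnitGeodesicOn A₁.metric γ₁ (Ioo (-δ) δ) ∧
    IsUnitGeodesicOn A₂.metric γ₂ (Ioo (-δ) δ) ∧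
    ∀ s ∈ Ioo (-δ) δ, ∀ t ∈ Ioo (-δ) δ, Φ (F (s, t)) = (γ₁ s, γ₂ t)

end Lorentz

end

set_option linter.unusedSectionVars false

noncomputable section

open PseudoRiemannian

namespace LocalGeometry

/-! ### Derivatives of bilinear expressions. -/

section Calculus

variable {E E' F : Type*} [NormedAddCommGroup E] [NormedSpace ℝ E] [NormedAddCommGroup E']
  [NormedSpace ℝ E'] [NormedAddCommGroup F] [NormedSpace ℝ F]

/-! Write Φ = (φ, ψ). The proof first shows that φ^*ω vanishes, by a curvature argument, and then
reads the geodesics off the remaining equations.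

Curvature. Since j is parallel (`IsParaKahlerOn.fderiv_j`), the 1-forms η with η ∘ j = η form a
parallel line field. A local nowhere zero section therefore satisfies ∇η = α ⊗ η, and its connection
form satisfies dα = -κω (`extDeriv_connectionForm`). Choose such η₁, η₂ near φ(p) and ψ(p). The
tensor g + ω has rank one, of the form η ⊗ μ; as φ^*ω = ψ^*ω, the ω-terms may be added for free, and
the induced metric becomes h = φ^*(η₁ ⊗ μ₁) - ψ^*(η₂ ⊗ μ₂). Let N be the coefficient of φ^*η₁ ∧
ψ^*η₂. Then N divides det h, so it is nowhere zero. The cubic form G(D_X ∂_Y Φ, J ∂_Z Φ) is totally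
symmetric, by the Lagrangian condition, and trace-free, by minimality; this is exactly what is
needed for d log|N| - ½ d log|det h| = φ^*α₁ + ψ^*α₂, the constancy of the Lagrangian angle
(`IsMinimalLagrangianOn.exists_hasFDerivAt_det`). The right-hand side is thus closed, which reads
(κ∘φ + κ∘ψ) φ^*ω = 0 (`IsMinimalLagrangianOn.ricci_form_eq_zero`).

Non-flatness. If φ^*ω were nonzero at p, φ would be a local diffeomorphism there, and density would
provide a point q with φ^*ω ≠ 0 and κ(φ(q)) ≠ 0. Then κ(φ(q)) = -κ(ψ(q)) ≠ 0, against the constancy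
of the sign of κ. So φ^*ω = ψ^*ω = 0 (`pullback_omega_eq_zero`), neither dφ nor dψ is onto, and the
immersion property leaves rank one for both (`rankAt_eq_one`).

Product. Rank one gives local functions a, b with φ = α ∘ a, ψ = β ∘ b and (a, b) a chart, so h =
⟨α', α'⟩ da² - ⟨β', β'⟩ db². Nondegeneracy makes both curves non-null, hence they can be
parametrised by arclength. The vanishing mean curvature makes the acceleration of each curve tangent
to it, and unit speed makes it orthogonal to the velocity, so it is zero
(`IsMinimalLagrangianOn.exists_product_of_geodesics`).

All this takes place in open subsets of the plane. The transfer from the manifolds rests on the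
transformation law of Christoffel symbols, a consequence of the uniqueness of the torsion-free
metric connection (`eq_christoffelSymbol`). -/

theorem trilinear_add_left (D : E →L[ℝ] E →L[ℝ] E →L[ℝ] F) (X X' Y Z : E) :
    D (X + X') Y Z = D X Y Z + D X' Y Z := by
  rw [ContinuousLinearMap.map_add]; rfl

theorem trilinear_add_mid (D : E →L[ℝ] E →L[ℝ] E →L[ℝ] F) (X Y Y' Z : E) :
    D X (Y + Y') Z = D X Y Z + D X Y' Z := by
  rw [ContinuousLinearMap.map_add]; rfl

theorem trilinear_add_right (D : E →L[ℝ] E →L[ℝ] E →L[ℝ] F) (X Y Z Z' : E) :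
    D X Y (Z + Z') = D X Y Z + D X Y Z' :=
  ContinuousLinearMap.map_add _ _ _

theorem trilinear_smul_left (D : E →L[ℝ] E →L[ℝ] E →L[ℝ] F) (c : ℝ) (X Y Z : E) :
    D (c • X) Y Z = c • D X Y Z := by
  rw [ContinuousLinearMap.map_smul]; rfl

theorem trilinear_smul_mid (D : E →L[ℝ] E →L[ℝ] E →L[ℝ] F) (c : ℝ) (X Y Z : E) :
    D X (c • Y) Z = c • D X Y Z := by
  rw [ContinuousLinearMap.map_smul]; rfl

theorem trilinear_smul_right (D : E →L[ℝ] E →L[ℝ] E →L[ℝ] F) (c : ℝ) (X Y Z : E) :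
    D X Y (c • Z) = c • D X Y Z :=
  ContinuousLinearMap.map_smul _ _ _

/-- The derivative is given existentially, through its values only: later computations rewrite with
these values and never meet the composed operator. -/
theorem exists_hasFDerivAt_bilinear {g : E → E →L[ℝ] E →L[ℝ] F} {f a b : E' → E}
    {f' a' b' : E' →L[ℝ] E} {u : E'} (hd : DifferentiableAt ℝ g (f u)) (hf : HasFDerivAt f f' u)
    (ha : HasFDerivAt a a' u) (hb : HasFDerivAt b b' u) :
    ∃ L : E' →L[ℝ] F, HasFDerivAt (fun v => g (f v) (a v) (b v)) L u ∧
      ∀ X, L X = fderiv ℝ g (f u) (f' X) (a u) (b u) + g (f u) (a' X) (b u) +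
        g (f u) (a u) (b' X) := by
  have h0 : HasFDerivAt g (fderiv ℝ g (f u)) (f u) := hd.hasFDerivAt
  have h1 := HasFDerivAt.comp (𝕜 := ℝ) (E := E') (F := E) (G := E →L[ℝ] E →L[ℝ] F) u h0 hf
  refine ⟨_, (h1.clm_apply ha).clm_apply hb, fun X => ?_⟩
  simp
  abel

theorem exists_hasFDerivAt_clm_apply {g : E → E →L[ℝ] F} {f a : E' → E}
    {f' a' : E' →L[ℝ] E} {u : E'} (hd : DifferentiableAt ℝ g (f u)) (hf : HasFDerivAt f f' u)
    (ha : HasFDerivAt a a' u) :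
    ∃ L : E' →L[ℝ] F, HasFDerivAt (fun v => g (f v) (a v)) L u ∧
      ∀ X, L X = fderiv ℝ g (f u) (f' X) (a u) + g (f u) (a' X) := by
  have h0 : HasFDerivAt g (fderiv ℝ g (f u)) (f u) := hd.hasFDerivAt
  have h1 := HasFDerivAt.comp (𝕜 := ℝ) (E := E') (F := E) (G := E →L[ℝ] F) u h0 hf
  refine ⟨_, h1.clm_apply ha, fun X => ?_⟩
  simp
  abel

theorem exists_hasFDerivAt_bilinear_const {g : E → E →L[ℝ] E →L[ℝ] F} {u : E}
    (hd : DifferentiableAt ℝ g u) (Y Z : E) :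
    ∃ L : E →L[ℝ] F, HasFDerivAt (fun v => g v Y Z) L u ∧ ∀ X, L X = fderiv ℝ g u X Y Z := by
  obtain ⟨L, hL, h⟩ := exists_hasFDerivAt_bilinear (f := id) hd (hasFDerivAt_id u)
    (hasFDerivAt_const Y u) (hasFDerivAt_const Z u)
  exact ⟨L, hL, fun X => by simp [h]⟩

end Calculus

/-! ### Levi-Civita connections and second covariant derivatives on vector spaces. -/

section General

variable {E : Type*} [NormedAddCommGroup E] [NormedSpace ℝ E] [FiniteDimensional ℝ E]

/-- A symmetric nondegenerate bilinear form. -/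
structure IsMetricForm (b : E →L[ℝ] E →L[ℝ] ℝ) : Prop where
  symm : ∀ v w, b v w = b w v
  nondegenerate : ∀ v, (∀ w, b v w = 0) → v = 0

/-- A form without radical injects the space into its dual, which has the same finite dimension.
This is what makes the `inverse` in the Christoffel symbols a true inverse. -/
theorem IsMetricForm.isInvertible {b : E →L[ℝ] E →L[ℝ] ℝ} (hb : IsMetricForm b) :
    b.IsInvertible := by
  have hinj : Function.Injective (b : E →ₗ[ℝ] (E →L[ℝ] ℝ)) := by
    rw [← LinearMap.ker_eq_bot, LinearMap.ker_eq_bot']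
    intro v hv
    refine hb.nondegenerate v fun w => ?_
    have := congrArg (fun l : E →L[ℝ] ℝ => l w) hv
    simpa using this
  have hdim : Module.finrank ℝ E = Module.finrank ℝ (E →L[ℝ] ℝ) := by
    rw [← (LinearMap.toContinuousLinearMap (𝕜 := ℝ) (E := E) (F' := ℝ)).finrank_eq]
    exact (Subspace.dual_finrank_eq (K := ℝ) (V := E)).symm
  let e := LinearEquiv.ofInjectiveOfFinrankEq (b : E →ₗ[ℝ] (E →L[ℝ] ℝ)) hinj hdim
  exact ⟨e.toContinuousLinearEquiv, by ext v w; rfl⟩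

theorem IsMetricForm.ext_left {b : E →L[ℝ] E →L[ℝ] ℝ} (hb : IsMetricForm b) {v w : E}
    (h : ∀ z, b v z = b w z) : v = w := by
  rw [← sub_eq_zero]
  exact hb.nondegenerate _ fun z => by simp [h z]

/-- The Christoffel symbols of the first kind of a field of bilinear forms on a vector space. -/
def christoffelFirst (g : E → E →L[ℝ] E →L[ℝ] ℝ) (u X Y : E) : E →L[ℝ] ℝ :=
  (1 / 2 : ℝ) • (fderiv ℝ g u X Y + fderiv ℝ g u Y X - ((fderiv ℝ g u).flip X).flip Y)

theorem christoffelFirst_apply (g : E → E →L[ℝ] E →L[ℝ] ℝ) (u X Y Z : E) :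
    christoffelFirst g u X Y Z =
      (1 / 2) * (fderiv ℝ g u X Y Z + fderiv ℝ g u Y X Z - fderiv ℝ g u Z X Y) := by
  simp [christoffelFirst]

/-- The Christoffel symbols of a field of bilinear forms on a vector space, as a bilinear map. -/
def christoffelSymbol (g : E → E →L[ℝ] E →L[ℝ] ℝ) (u : E) : E →ₗ[ℝ] E →ₗ[ℝ] E :=
  LinearMap.mk₂ ℝ (fun X Y => (g u).inverse (christoffelFirst g u X Y))
    (fun X X' Y => by
      rw [← map_add]
      congr 1
      ext Z
      simp only [christoffelFirst_apply, add_apply, trilinear_add_left,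
        trilinear_add_mid]
      ring)
    (fun c X Y => by
      rw [← map_smul]
      congr 1
      ext Z
      simp only [christoffelFirst_apply, smul_apply, trilinear_smul_left,
        trilinear_smul_mid, smul_eq_mul]
      ring)
    (fun X Y Y' => by
      rw [← map_add]
      congr 1
      ext Z
      simp only [christoffelFirst_apply, add_apply, trilinear_add_left,
        trilinear_add_mid, trilinear_add_right]
      ring)
    (fun c X Y => by
      rw [← map_smul]
      congr 1
      ext Z
      simp only [christoffelFirst_apply, smul_apply, trilinear_smul_left,
        trilinear_smul_mid, trilinear_smul_right,
        smul_eq_mul]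
      ring)

theorem christoffelSymbol_apply (g : E → E →L[ℝ] E →L[ℝ] ℝ) (u X Y : E) :
    christoffelSymbol g u X Y = (g u).inverse (christoffelFirst g u X Y) := rfl

theorem metric_christoffelSymbol {g : E → E →L[ℝ] E →L[ℝ] ℝ} {u : E} (hg : IsMetricForm (g u))
    (X Y Z : E) : g u (christoffelSymbol g u X Y) Z =
      (1 / 2) * (fderiv ℝ g u X Y Z + fderiv ℝ g u Y X Z - fderiv ℝ g u Z X Y) := by
  rw [christoffelSymbol_apply, hg.isInvertible.self_apply_inverse, christoffelFirst_apply]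

theorem christoffelSymbol_symm {g : E → E →L[ℝ] E →L[ℝ] ℝ} {u : E} (hg : IsMetricForm (g u))
    (hs : ∀ X Y Z, fderiv ℝ g u X Y Z = fderiv ℝ g u X Z Y) (X Y : E) :
    christoffelSymbol g u X Y = christoffelSymbol g u Y X := by
  refine hg.ext_left fun Z => ?_
  rw [metric_christoffelSymbol hg, metric_christoffelSymbol hg, hs Z X Y]
  ring

/-- Metric compatibility: in the sum of the two Koszul expressions all terms cancel except the
derivative in direction X, which appears twice. -/
theorem fderiv_metric {g : E → E →L[ℝ] E →L[ℝ] ℝ} {u : E} (hg : IsMetricForm (g u))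
    (hs : ∀ X Y Z, fderiv ℝ g u X Y Z = fderiv ℝ g u X Z Y) (X Y Z : E) :
    fderiv ℝ g u X Y Z =
      g u (christoffelSymbol g u X Y) Z + g u Y (christoffelSymbol g u X Z) := by
  rw [hg.symm Y, metric_christoffelSymbol hg, metric_christoffelSymbol hg, hs Y X Z, hs Z X Y,
    hs X Z Y]
  ring

/-- Uniqueness of the torsion-free metric connection. -/
theorem eq_christoffelSymbol {g : E → E →L[ℝ] E →L[ℝ] ℝ} {u : E} (hg : IsMetricForm (g u))
    {B : E → E → E} (hB : ∀ X Y, B X Y = B Y X)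
    (h : ∀ X Y Z, fderiv ℝ g u X Y Z = g u (B X Y) Z + g u Y (B X Z)) (X Y : E) :
    B X Y = christoffelSymbol g u X Y := by
  refine hg.ext_left fun Z => ?_
  -- Koszul's argument: by compatibility and symmetry of B, the alternating sum of the three
  -- derivatives collapses to twice g(B X Y, Z).
  rw [metric_christoffelSymbol hg, h, h, h, hB Y X, hB Z X, hB Z Y, hg.symm (B X Z), hg.symm Y]
  ring

theorem fderiv_symm_of_eventually {g : E → E →L[ℝ] E →L[ℝ] ℝ} {u : E}
    (hd : DifferentiableAt ℝ g u) (hs : ∀ᶠ v in 𝓝 u, ∀ X Y, g v X Y = g v Y X) (X Y Z : E) :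
    fderiv ℝ g u X Y Z = fderiv ℝ g u X Z Y := by
  obtain ⟨L, hL, h⟩ := exists_hasFDerivAt_bilinear_const hd Y Z
  obtain ⟨L', hL', h'⟩ := exists_hasFDerivAt_bilinear_const hd Z Y
  rw [← h, ← h', hL.unique (hL'.congr_of_eventuallyEq (hs.mono fun v hv => hv Y Z))]

theorem IsMetricForm.pullback {b : E →L[ℝ] E →L[ℝ] ℝ} (hb : IsMetricForm b) {A : E →L[ℝ] E}
    (hA : Function.Surjective A) : IsMetricForm (b.bilinearComp A A) where
  symm v w := by simpa using hb.symm _ _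
  nondegenerate v hv := by
    have h0 : A v = 0 := hb.nondegenerate _ fun w => by
      obtain ⟨w', rfl⟩ := hA w
      simpa using hv w'
    have hi : Function.Injective A :=
      (LinearMap.injective_iff_surjective (f := A.toLinearMap)).2 hA
    exact hi (by simpa using h0)

theorem hasFDerivAt_fderiv_apply {F : Type*} [NormedAddCommGroup F] [NormedSpace ℝ F]
    {f : E → F} {u : E} (hf : ContDiffAt ℝ 2 f u) (Y : E) :
    HasFDerivAt (fun v => fderiv ℝ f v Y) ((fderiv ℝ (fderiv ℝ f) u).flip Y) u := by
  have h : DifferentiableAt ℝ (fderiv ℝ f) u :=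
    (hf.fderiv_right (m := 1) (by norm_num)).differentiableAt (by norm_num)
  simpa using h.hasFDerivAt.clm_apply (hasFDerivAt_const Y u)

theorem fderiv_fderiv_symm {F : Type*} [NormedAddCommGroup F] [NormedSpace ℝ F]
    {f : E → F} {u : E} (hf : ContDiffAt ℝ 2 f u) (X Y : E) :
    fderiv ℝ (fderiv ℝ f) u X Y = fderiv ℝ (fderiv ℝ f) u Y X :=
  (hf.isSymmSndFDerivAt (by simp)).eq X Y

variable {E' : Type*} [NormedAddCommGroup E'] [NormedSpace ℝ E'] [FiniteDimensional ℝ E']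

/-- The second covariant derivative of a map between vector spaces, the target being endowed with
a field of bilinear forms. -/
def covariantHessian (g : E → E →L[ℝ] E →L[ℝ] ℝ) (f : E' → E) (u X Y : E') : E :=
  fderiv ℝ (fderiv ℝ f) u X Y + christoffelSymbol g (f u) (fderiv ℝ f u X) (fderiv ℝ f u Y)

theorem covariantHessian_symm {g : E → E →L[ℝ] E →L[ℝ] ℝ} {f : E' → E} {u : E'}
    (hg : IsMetricForm (g (f u)))
    (hs : ∀ X Y Z, fderiv ℝ g (f u) X Y Z = fderiv ℝ g (f u) X Z Y)
    (hf : ContDiffAt ℝ 2 f u) (X Y : E') :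
    covariantHessian g f u X Y = covariantHessian g f u Y X := by
  rw [covariantHessian, fderiv_fderiv_symm hf, christoffelSymbol_symm hg hs]; rfl

/-- The derivative of the pullback of a metric, in terms of second covariant derivatives. -/
theorem hasFDerivAt_pullback_metric {g : E → E →L[ℝ] E →L[ℝ] ℝ} {f : E' → E} {u : E'}
    (hf : ContDiffAt ℝ 2 f u) (hd : DifferentiableAt ℝ g (f u)) (hg : IsMetricForm (g (f u)))
    (hs : ∀ X Y Z, fderiv ℝ g (f u) X Y Z = fderiv ℝ g (f u) X Z Y) (Y Z : E') :
    ∃ L : E' →L[ℝ] ℝ, HasFDerivAt (fun v => g (f v) (fderiv ℝ f v Y) (fderiv ℝ f v Z)) L u ∧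
      ∀ X, L X = g (f u) (covariantHessian g f u X Y) (fderiv ℝ f u Z) +
        g (f u) (fderiv ℝ f u Y) (covariantHessian g f u X Z) := by
  obtain ⟨L, hL, h⟩ := exists_hasFDerivAt_bilinear hd
    (hf.differentiableAt (by norm_num)).hasFDerivAt (hasFDerivAt_fderiv_apply hf Y)
    (hasFDerivAt_fderiv_apply hf Z)
  refine ⟨L, hL, fun X => ?_⟩
  rw [h, fderiv_metric hg hs]
  simp only [covariantHessian, ContinuousLinearMap.flip_apply, map_add,
    add_apply]
  ring

/-- The transformation law of Christoffel symbols. -/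
theorem fderiv_christoffelSymbol {g g' : E → E →L[ℝ] E →L[ℝ] ℝ} {τ : E → E} {u : E}
    (hτ : ContDiffAt ℝ 2 τ u) (hi : Function.Surjective (fderiv ℝ τ u))
    (hd : DifferentiableAt ℝ g (τ u)) (hg : IsMetricForm (g (τ u)))
    (hs : ∀ X Y Z, fderiv ℝ g (τ u) X Y Z = fderiv ℝ g (τ u) X Z Y)
    (h : ∀ᶠ v in 𝓝 u, ∀ X Y, g' v X Y = g (τ v) (fderiv ℝ τ v X) (fderiv ℝ τ v Y))
    (hd' : DifferentiableAt ℝ g' u) (X Y : E) :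
    fderiv ℝ τ u (christoffelSymbol g' u X Y) = covariantHessian g τ u X Y := by
  have h0 := h.self_of_nhds
  have hg' : IsMetricForm (g' u) := by
    convert hg.pullback hi
    ext X Y; simpa using h0 X Y
  have hinj : Function.Injective (fderiv ℝ τ u) :=
    (LinearMap.injective_iff_surjective (f := (fderiv ℝ τ u).toLinearMap)).2 hi
  -- B is the connection of the target pulled back through the isomorphism dτ. It is torsion-free
  -- and compatible with g', so uniqueness identifies it.
  choose B hB using fun X Y => hi (covariantHessian g τ u X Y)
  have hBB : ∀ X Y, B X Y = christoffelSymbol g' u X Y := by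
    refine eq_christoffelSymbol hg' (fun X Y => hinj ?_) fun X Y Z => ?_
    · rw [hB, hB, covariantHessian_symm hg hs hτ]
    · obtain ⟨L, hL, hL'⟩ := hasFDerivAt_pullback_metric hτ hd hg hs Y Z
      obtain ⟨L', hL2, h2⟩ := exists_hasFDerivAt_bilinear_const hd' Y Z
      rw [← h2, hL2.unique (hL.congr_of_eventuallyEq (h.mono fun v hv => hv Y Z)), hL', h0, h0, hB,
        hB]
  rw [← hBB, hB]

theorem fderiv_fderiv_comp {F : Type*} [NormedAddCommGroup F] [NormedSpace ℝ F]
    {f : E → F} {σ : E' → E} {u : E'} (hf : ContDiffAt ℝ 2 f (σ u)) (hσ : ContDiffAt ℝ 2 σ u)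
    (X Y : E') : fderiv ℝ (fderiv ℝ (f ∘ σ)) u X Y =
      fderiv ℝ (fderiv ℝ f) (σ u) (fderiv ℝ σ u X) (fderiv ℝ σ u Y) +
        fderiv ℝ f (σ u) (fderiv ℝ (fderiv ℝ σ) u X Y) := by
  have hfe : ∀ᶠ v in 𝓝 u, ContDiffAt ℝ 2 f (σ v) :=
    hσ.continuousAt.eventually (hf.eventually (by simp))
  -- The first-order chain rule is needed on a neighbourhood, since it is differentiated once more.
  have he : (fun v => fderiv ℝ (f ∘ σ) v Y) =ᶠ[𝓝 u] fun v => fderiv ℝ f (σ v) (fderiv ℝ σ v Y) := by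
    filter_upwards [hfe, hσ.eventually (by simp)] with v h1 h2
    rw [fderiv_comp v (h1.differentiableAt (by norm_num)) (h2.differentiableAt (by norm_num))]
    rfl
  have h1 := hasFDerivAt_fderiv_apply (hf.comp u hσ) Y
  obtain ⟨L, hL, h⟩ := exists_hasFDerivAt_clm_apply
    ((hf.fderiv_right (m := 1) (by norm_num)).differentiableAt (by norm_num))
    (hσ.differentiableAt (by norm_num)).hasFDerivAt (hasFDerivAt_fderiv_apply hσ Y)
  have h4 := congrArg (fun l : E' →L[ℝ] F => l X) (h1.unique (hL.congr_of_eventuallyEq he))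
  simpa [h] using h4

/-- Second covariant derivatives are invariant under isometries of the target. -/
theorem covariantHessian_comp_left {g g' : E → E →L[ℝ] E →L[ℝ] ℝ} {τ : E → E} {f : E' → E}
    {u : E'} (hf : ContDiffAt ℝ 2 f u)
    (hτ : ContDiffAt ℝ 2 τ (f u)) (hi : Function.Surjective (fderiv ℝ τ (f u)))
    (hd : DifferentiableAt ℝ g (τ (f u))) (hg : IsMetricForm (g (τ (f u))))
    (hs : ∀ X Y Z, fderiv ℝ g (τ (f u)) X Y Z = fderiv ℝ g (τ (f u)) X Z Y)
    (h : ∀ᶠ v in 𝓝 (f u), ∀ X Y, g' v X Y = g (τ v) (fderiv ℝ τ v X) (fderiv ℝ τ v Y))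
    (hd' : DifferentiableAt ℝ g' (f u)) (X Y : E') :
    covariantHessian g (τ ∘ f) u X Y = fderiv ℝ τ (f u) (covariantHessian g' f u X Y) := by
  rw [covariantHessian, fderiv_fderiv_comp hτ hf, covariantHessian, map_add,
    fderiv_christoffelSymbol hτ hi hd hg hs h hd', covariantHessian,
    fderiv_comp u (hτ.differentiableAt (by norm_num)) (hf.differentiableAt (by norm_num))]
  simp only [ContinuousLinearMap.comp_apply, Function.comp_apply]
  abel

/-- Second covariant derivatives under changes of coordinates in the source. -/
theorem covariantHessian_comp_right {E'' : Type*} [NormedAddCommGroup E''] [NormedSpace ℝ E'']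
    [FiniteDimensional ℝ E''] {g : E → E →L[ℝ] E →L[ℝ] ℝ} {f : E' → E} {σ : E'' → E'} {u : E''}
    (hf : ContDiffAt ℝ 2 f (σ u)) (hσ : ContDiffAt ℝ 2 σ u) (X Y : E'') :
    covariantHessian g (f ∘ σ) u X Y =
      covariantHessian g f (σ u) (fderiv ℝ σ u X) (fderiv ℝ σ u Y) +
        fderiv ℝ f (σ u) (fderiv ℝ (fderiv ℝ σ) u X Y) := by
  rw [covariantHessian, fderiv_fderiv_comp hf hσ, covariantHessian,
    fderiv_comp u (hf.differentiableAt (by norm_num)) (hσ.differentiableAt (by norm_num))]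
  simp only [ContinuousLinearMap.comp_apply, Function.comp_apply]
  abel

end General

end LocalGeometry

namespace LocalGeometry

/-! ### Linear algebra of a para-Kähler plane. -/

section LinearAlgebra

/-- A nondegenerate symmetric bilinear form `b` on the plane and an endomorphism `j` with `j² = id`
and `b(j·, j·) = -b`. -/
structure IsParaKahlerForm (b : Plane →L[ℝ] Plane →L[ℝ] ℝ) (j : Plane →L[ℝ] Plane) : Prop
    extends IsMetricForm b where
  j_sq : ∀ v, j (j v) = v
  j_metric : ∀ v w, b (j v) (j w) = -b v w

variable {b : Plane →L[ℝ] Plane →L[ℝ] ℝ} {j : Plane →L[ℝ] Plane}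

theorem IsParaKahlerForm.skew (h : IsParaKahlerForm b j) (v w : Plane) :
    b (j v) w = -b v (j w) := by
  conv_lhs => rw [← h.j_sq w]
  exact h.j_metric _ _

theorem IsParaKahlerForm.apply_j_self (h : IsParaKahlerForm b j) (v : Plane) : b (j v) v = 0 := by
  have h1 := h.skew v v
  rw [h.symm v] at h1
  linarith

/-- A non-null vector `v` and its image `j v` span the plane. -/
theorem IsParaKahlerForm.exists_basis (h : IsParaKahlerForm b j) :
    ∃ v, b v v ≠ 0 ∧ ∀ y, ∃ s t : ℝ, y = s • v + t • j v := by
  have hv : ∃ v, b v v ≠ 0 := by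
    by_contra! hn
    have h0 : ∀ x y, b x y = 0 := fun x y => by
      have h1 := hn (x + y)
      simp only [map_add, add_apply, hn] at h1
      have := h.symm x y
      linarith
    have h1 := h.nondegenerate (EuclideanSpace.single 0 1) fun w => h0 _ w
    have h2 := congrArg (fun x : Plane => x 0) h1
    simp at h2
  obtain ⟨v, hv⟩ := hv
  refine ⟨v, hv, ?_⟩
  have hli : LinearIndependent ℝ ![v, j v] := by
    rw [LinearIndependent.pair_iff]
    intro s t hst
    have h1 := congrArg (fun x => b x v) hst
    have h2 := congrArg (fun x => b x (j v)) hst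
    have h3 := h.apply_j_self v
    have h4 := h.j_metric v v
    have h5 := h.symm v (j v)
    simp only [map_add, map_smul, add_apply, smul_apply, smul_eq_mul, map_zero, zero_apply,
      h3] at h1 h2
    rw [h4, h5, h3] at h2
    constructor
    · simpa [hv] using h1
    · simpa [hv] using h2
  have hsp := hli.span_eq_top_of_card_eq_finrank (by simp)
  intro y
  have hy : y ∈ Submodule.span ℝ (Set.range ![v, j v]) := hsp ▸ Submodule.mem_top
  rw [Matrix.range_cons, Matrix.range_cons, Matrix.range_empty, Set.union_empty] at hy
  obtain ⟨s, t, hst⟩ := Submodule.mem_span_pair.1 hy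
  exact ⟨s, t, hst.symm⟩

/-- Invariance under j means vanishing on the (-1)-eigenline of j, so such functionals form a line.
One of the two is unbundled because it will be a covariant derivative. -/
theorem IsParaKahlerForm.coframe_unique (h : IsParaKahlerForm b j) {η μ : Plane → ℝ}
    (hη : IsLinearMap ℝ η) (hμ : IsLinearMap ℝ μ) (hηj : ∀ v, η (j v) = η v)
    (hμj : ∀ v, μ (j v) = μ v) (e y : Plane) : μ y * η e = μ e * η y := by
  obtain ⟨v, -, hv⟩ := h.exists_basis
  obtain ⟨s, t, rfl⟩ := hv e
  obtain ⟨s', t', rfl⟩ := hv y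
  simp only [hη.map_add, hη.map_smul, hμ.map_add, hμ.map_smul, hηj, hμj, smul_eq_mul]
  ring

/-- The vector y + j y is the projection of y, up to a factor 2, to the (+1)-eigenline of j, and η
is a coordinate on that line when it is nonzero. -/
theorem IsParaKahlerForm.coframe_smul (h : IsParaKahlerForm b j) {η : Plane →L[ℝ] ℝ}
    (hηj : ∀ v, η (j v) = η v) (e y : Plane) : η e • (y + j y) = η y • (e + j e) := by
  obtain ⟨v, -, hv⟩ := h.exists_basis
  obtain ⟨s, t, rfl⟩ := hv e
  obtain ⟨s', t', rfl⟩ := hv y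
  simp only [map_add, map_smul, hηj, h.j_sq, smul_eq_mul]
  module

/-- The algebra behind ∇j = 0, with K = ∇_X j. Anticommutation leaves two free entries in the basis
(v, j v), and the metric condition evaluated at (v, v) and (v, j v) kills them. -/
theorem IsParaKahlerForm.eq_zero_of_anticommute (h : IsParaKahlerForm b j)
    (K : Plane →ₗ[ℝ] Plane) (h1 : ∀ y, K (j y) = -j (K y))
    (h2 : ∀ y z, b (K y) (j z) + b (j y) (K z) = 0) (y : Plane) : K y = 0 := by
  obtain ⟨v, hv0, hv⟩ := h.exists_basis
  obtain ⟨s, t, hst⟩ := hv (K v)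
  have h3 := h.apply_j_self v
  have h4 := h.symm v (j v)
  have h5 := h.j_metric v v
  have e1 := h2 v v
  have e2 := h2 v (j v)
  rw [h.j_sq, h1] at e2
  rw [hst] at e1 e2
  simp only [map_add, map_smul, map_neg, add_apply, smul_apply, smul_eq_mul, h.j_sq, h3, h4,
    h5] at e1 e2
  have ht : t = 0 := by
    have : t * b v v = 0 := by linarith
    simpa [hv0] using this
  have hs : s = 0 := by
    have : s * b v v = 0 := by linarith
    simpa [hv0] using this
  have hK : K v = 0 := by rw [hst, hs, ht]; simp
  obtain ⟨s', t', rfl⟩ := hv y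
  simp [hK, h1]

/-- The Lie algebra so(1,1) is one-dimensional and j is one of its elements. It is applied to
curvature endomorphisms. -/
theorem IsParaKahlerForm.eq_smul_of_skew (h : IsParaKahlerForm b j)
    (K : Plane →ₗ[ℝ] Plane) (h1 : ∀ y z, b (K y) z + b y (K z) = 0) :
    ∃ c : ℝ, ∀ y, K y = c • j y := by
  obtain ⟨v, hv0, hv⟩ := h.exists_basis
  obtain ⟨s, t, hst⟩ := hv (K v)
  obtain ⟨s', t', hst'⟩ := hv (K (j v))
  have h3 := h.apply_j_self v
  have h4 := h.symm v (j v)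
  have h5 := h.j_metric v v
  have e1 := h1 v v
  have e2 := h1 v (j v)
  have e3 := h1 (j v) (j v)
  rw [hst] at e1 e2
  rw [hst'] at e2 e3
  simp only [map_add, map_smul, add_apply, smul_apply, smul_eq_mul, h3, h4, h5] at e1 e2 e3
  have hs : s = 0 := by
    have : s * b v v = 0 := by linarith
    simpa [hv0] using this
  have ht' : t' = 0 := by
    have : t' * b v v = 0 := by linarith
    simpa [hv0] using this
  have hs' : s' = t := by
    have : (s' - t) * b v v = 0 := by linarith
    simpa [hv0, sub_eq_zero] using this
  refine ⟨t, fun y => ?_⟩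
  obtain ⟨p, q, rfl⟩ := hv y
  simp only [map_add, map_smul, hst, hst', hs, ht', hs', h.j_sq]
  module

/-- The form ω is an area form for b; the sign reflects the Lorentzian signature. It turns the Gram
determinant in the Gauss curvature into a square of ω. -/
theorem IsParaKahlerForm.omega_sq (h : IsParaKahlerForm b j) (x y : Plane) :
    b (j x) y ^ 2 = -(b x x * b y y - b x y ^ 2) := by
  obtain ⟨v, hv0, hv⟩ := h.exists_basis
  obtain ⟨s, t, rfl⟩ := hv x
  obtain ⟨s', t', rfl⟩ := hv y
  have h3 := h.apply_j_self v
  have h4 := h.symm v (j v)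
  have h5 := h.j_metric v v
  simp only [map_add, map_smul, add_apply, smul_apply, smul_eq_mul, h3, h4, h5, h.j_sq]
  ring

theorem IsParaKahlerForm.omega_antisymm (h : IsParaKahlerForm b j) (x y : Plane) :
    b (j x) y = -b (j y) x := by rw [h.skew, h.symm]

theorem plane_eq (x : Plane) :
    x = x 0 • EuclideanSpace.single 0 1 + x 1 • EuclideanSpace.single 1 1 := by
  ext i
  fin_cases i <;> simp

theorem IsParaKahlerForm.omega_ne_zero (h : IsParaKahlerForm b j) :
    b (j (EuclideanSpace.single 0 1)) (EuclideanSpace.single 1 1) ≠ 0 := by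
  intro h0
  have h1 : j (EuclideanSpace.single 0 1) = 0 := h.nondegenerate _ fun w => by
    rw [plane_eq w, map_add, map_smul, map_smul, h0, h.apply_j_self]
    simp
  have h2 := h.j_sq (EuclideanSpace.single 0 1)
  rw [h1, map_zero] at h2
  have h3 := congrArg (fun x : Plane => x 0) h2
  simp at h3

end LinearAlgebra

/-! ### The Levi-Civita connection of a para-Kähler structure. -/

section Connection

/-- A smooth para-Kähler structure on an open subset of the plane. -/
structure IsParaKahlerOn (g : Plane → Plane →L[ℝ] Plane →L[ℝ] ℝ) (j : Plane → Plane →L[ℝ] Plane)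
    (U : Set Plane) : Prop where
  isOpen : IsOpen U
  smooth_metric : ContDiffOn ℝ ∞ g U
  smooth_j : ContDiffOn ℝ ∞ j U
  form : ∀ u ∈ U, IsParaKahlerForm (g u) (j u)

variable {g : Plane → Plane →L[ℝ] Plane →L[ℝ] ℝ} {j : Plane → Plane →L[ℝ] Plane} {U : Set Plane}

theorem IsParaKahlerOn.differentiableAt (h : IsParaKahlerOn g j U) {u : Plane} (hu : u ∈ U) :
    DifferentiableAt ℝ g u :=
  (h.smooth_metric.contDiffAt (h.isOpen.mem_nhds hu)).differentiableAt (by simp)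

theorem IsParaKahlerOn.differentiableAt_j (h : IsParaKahlerOn g j U) {u : Plane} (hu : u ∈ U) :
    DifferentiableAt ℝ j u :=
  (h.smooth_j.contDiffAt (h.isOpen.mem_nhds hu)).differentiableAt (by simp)

theorem IsParaKahlerOn.fderiv_symm (h : IsParaKahlerOn g j U) {u : Plane} (hu : u ∈ U)
    (X Y Z : Plane) : fderiv ℝ g u X Y Z = fderiv ℝ g u X Z Y :=
  fderiv_symm_of_eventually (h.differentiableAt hu)
    (Filter.mem_of_superset (h.isOpen.mem_nhds hu) fun v hv => (h.form v hv).symm) X Y Z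

theorem IsParaKahlerOn.fderiv_metric (h : IsParaKahlerOn g j U) {u : Plane} (hu : u ∈ U)
    (X Y Z : Plane) : fderiv ℝ g u X Y Z =
      g u (christoffelSymbol g u X Y) Z + g u Y (christoffelSymbol g u X Z) :=
  LocalGeometry.fderiv_metric (h.form u hu).toIsMetricForm (h.fderiv_symm hu) X Y Z

theorem exists_hasFDerivAt_clm_apply_const {F G : Type*} [NormedAddCommGroup F] [NormedSpace ℝ F]
    [NormedAddCommGroup G] [NormedSpace ℝ G]
    {A : F → F →L[ℝ] G} {u : F} (hd : DifferentiableAt ℝ A u) (Y : F) :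
    ∃ L : F →L[ℝ] G, HasFDerivAt (fun v => A v Y) L u ∧ ∀ X, L X = fderiv ℝ A u X Y := by
  obtain ⟨L, hL, h⟩ := exists_hasFDerivAt_clm_apply (f := id) hd (hasFDerivAt_id u)
    (hasFDerivAt_const Y u)
  exact ⟨L, hL, fun X => by simp [h]⟩

/-- The paracomplex structure is parallel. -/
theorem IsParaKahlerOn.fderiv_j (h : IsParaKahlerOn g j U) {u : Plane} (hu : u ∈ U)
    (X Y : Plane) : fderiv ℝ j u X Y =
      j u (christoffelSymbol g u X Y) - christoffelSymbol g u X (j u Y) := by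
  have hj := h.form u hu
  have hnhds := h.isOpen.mem_nhds hu
  have d1 : ∀ Y, fderiv ℝ j u X (j u Y) + j u (fderiv ℝ j u X Y) = 0 := fun Y => by
    obtain ⟨L, hL, hLX⟩ := exists_hasFDerivAt_clm_apply_const (h.differentiableAt_j hu) Y
    obtain ⟨L', hL', hLX'⟩ := exists_hasFDerivAt_clm_apply (f := id) (h.differentiableAt_j hu)
      (hasFDerivAt_id u) hL
    have h1 := hL'.unique ((hasFDerivAt_const Y u).congr_of_eventuallyEq
      (Filter.mem_of_superset hnhds fun v hv => (h.form v hv).j_sq Y))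
    have h2 := hLX' X
    rw [h1, hLX] at h2
    simpa using h2.symm
  have d2 : ∀ Y Z, fderiv ℝ g u X (j u Y) (j u Z) + g u (fderiv ℝ j u X Y) (j u Z) +
      g u (j u Y) (fderiv ℝ j u X Z) = -fderiv ℝ g u X Y Z := fun Y Z => by
    obtain ⟨L, hL, hLX⟩ := exists_hasFDerivAt_clm_apply_const (h.differentiableAt_j hu) Y
    obtain ⟨L', hL', hLX'⟩ := exists_hasFDerivAt_clm_apply_const (h.differentiableAt_j hu) Z
    obtain ⟨M, hM, hMX⟩ := exists_hasFDerivAt_bilinear (f := id) (h.differentiableAt hu)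
      (hasFDerivAt_id u) hL hL'
    obtain ⟨N, hN, hNX⟩ := exists_hasFDerivAt_bilinear_const (h.differentiableAt hu) Y Z
    have h1 := hM.unique (hN.neg.congr_of_eventuallyEq
      (Filter.mem_of_superset hnhds fun v hv => (h.form v hv).j_metric Y Z))
    have h2 := hMX X
    rw [h1, hLX, hLX'] at h2
    rw [← hNX]
    simpa using h2.symm
  -- K is ∇_X j. The derivatives `d1` of j² = id and `d2` of g(j·, j·) = -g are the two conditions
  -- under which it must vanish.
  let K : Plane →ₗ[ℝ] Plane := (fderiv ℝ j u X).toLinearMap +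
    christoffelSymbol g u X ∘ₗ (j u).toLinearMap - (j u).toLinearMap ∘ₗ christoffelSymbol g u X
  have hK : ∀ y, K y = fderiv ℝ j u X y + christoffelSymbol g u X (j u y) -
    j u (christoffelSymbol g u X y) := fun y => rfl
  have := hj.eq_zero_of_anticommute K (fun y => ?_) (fun y z => ?_) Y
  · rw [hK] at this
    rw [eq_sub_iff_add_eq, ← sub_eq_zero, this]
  · rw [hK, hK, eq_neg_of_add_eq_zero_left (d1 y)]
    simp only [map_add, map_sub, hj.j_sq]
    abel
  · have h1 := d2 y z
    rw [h.fderiv_metric hu, h.fderiv_metric hu] at h1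
    have h2 := hj.j_metric y (christoffelSymbol g u X z)
    have h3 := hj.j_metric (christoffelSymbol g u X y) z
    simp only [hK, map_add, map_sub, add_apply, sub_apply]
    linarith

theorem IsParaKahlerOn.contDiffOn_christoffelSymbol (h : IsParaKahlerOn g j U) (X Y : Plane) :
    ContDiffOn ℝ ∞ (fun v => christoffelSymbol g v X Y) U := by
  have h0 : ∀ X Y Z : Plane, ContDiffOn ℝ ∞ (fun v => fderiv ℝ g v X Y Z) U := fun X Y Z => by
    have h1 : ContDiffOn ℝ ∞ (fun v => g v Y Z) U :=
      (h.smooth_metric.clm_apply contDiffOn_const).clm_apply contDiffOn_const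
    have h2 := (h1.fderiv_of_isOpen (m := ∞) h.isOpen (by simp)).clm_apply
      (contDiffOn_const (c := X))
    refine h2.congr fun v hv => ?_
    obtain ⟨L, hL, hLX⟩ := exists_hasFDerivAt_bilinear_const (h.differentiableAt hv) Y Z
    rw [hL.fderiv, hLX]
  have h1 : ContDiffOn ℝ ∞ (fun v => christoffelFirst g v X Y) U := by
    rw [contDiffOn_clm_apply]
    intro Z
    simp only [christoffelFirst_apply]
    exact contDiffOn_const.mul (((h0 _ _ _).add (h0 _ _ _)).sub (h0 _ _ _))
  have h2 : ContDiffOn ℝ ∞ (fun v => (g v).inverse) U := fun v hv =>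
    ((h.form v hv).toIsMetricForm.isInvertible.contDiffAt_map_inverse).comp_contDiffWithinAt v
      (h.smooth_metric v hv)
  exact h2.clm_apply h1

end Connection
end LocalGeometry

namespace LocalGeometry

theorem two_le_infty : (2 : ℕ∞ω) ≤ ∞ :=
  WithTop.coe_le_coe.2 (le_top : (2 : ℕ∞) ≤ ⊤)

/-! ### Null coframes, their connection forms, and Gauss curvature. -/

section Curvature

variable {g : Plane → Plane →L[ℝ] Plane →L[ℝ] ℝ} {j : Plane → Plane →L[ℝ] Plane} {U : Set Plane}

theorem IsParaKahlerOn.mono (h : IsParaKahlerOn g j U) {V : Set Plane} (hV : IsOpen V)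
    (hVU : V ⊆ U) : IsParaKahlerOn g j V where
  isOpen := hV
  smooth_metric := h.smooth_metric.mono hVU
  smooth_j := h.smooth_j.mono hVU
  form u hu := h.form u (hVU hu)

/-- A nowhere vanishing 1-form `η` with `η ∘ j = η`. -/
structure IsNullCoframeOn (j : Plane → Plane →L[ℝ] Plane) (η : Plane → Plane →L[ℝ] ℝ)
    (U : Set Plane) : Prop where
  smooth : ContDiffOn ℝ ∞ η U
  apply_j : ∀ u ∈ U, ∀ X, η u (j u X) = η u X
  ne_zero : ∀ u ∈ U, η u ≠ 0

/-- The connection form `α` of a null coframe `η`, i.e. `∇_X η = α(X) η`. -/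
structure IsConnectionFormOn (g : Plane → Plane →L[ℝ] Plane →L[ℝ] ℝ)
    (η α : Plane → Plane →L[ℝ] ℝ) (U : Set Plane) : Prop where
  smooth : ContDiffOn ℝ ∞ α U
  apply : ∀ u ∈ U, ∀ X Y, fderiv ℝ η u X Y - η u (christoffelSymbol g u X Y) = α u X * η u Y

/-- As j is parallel, the covariant derivative of a j-invariant 1-form is again j-invariant. -/
theorem fderiv_coframe_j (h : IsParaKahlerOn g j U) {η : Plane → Plane →L[ℝ] ℝ}
    (hη : IsNullCoframeOn j η U) {u : Plane} (hu : u ∈ U) (X Y : Plane) :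
    fderiv ℝ η u X (j u Y) - η u (christoffelSymbol g u X (j u Y)) =
      fderiv ℝ η u X Y - η u (christoffelSymbol g u X Y) := by
  have hd : DifferentiableAt ℝ η u :=
    (hη.smooth.contDiffAt (h.isOpen.mem_nhds hu)).differentiableAt (by simp)
  obtain ⟨L, hL, hLX⟩ := exists_hasFDerivAt_clm_apply_const (h.differentiableAt_j hu) Y
  obtain ⟨M, hM, hMX⟩ := exists_hasFDerivAt_clm_apply (f := id) hd (hasFDerivAt_id u) hL
  obtain ⟨N, hN, hNX⟩ := exists_hasFDerivAt_clm_apply_const hd Y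
  have h1 := hM.unique (hN.congr_of_eventuallyEq
      (Filter.mem_of_superset (h.isOpen.mem_nhds hu) fun v hv => hη.apply_j v hv Y))
  have h2 := hMX X
  rw [h1, hNX, hLX, h.fderiv_j hu, map_sub, id_eq, hη.apply_j u hu] at h2
  simp only [ContinuousLinearMap.id_apply] at h2
  linarith

/-- For any 1-form ξ, the sum ξ + ξ ∘ j is j-invariant. With ξ = g_x(v, ·), constant in u, and v
non-null, its value on v at x is g(v, v) ≠ 0, because v and j v are orthogonal. Uniqueness up to
scale then makes ∇η a multiple of η. -/
theorem exists_nullCoframe (h : IsParaKahlerOn g j U) {x : Plane} (hx : x ∈ U) :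
    ∃ V ⊆ U, IsOpen V ∧ x ∈ V ∧ ∃ η α, IsNullCoframeOn j η V ∧ IsConnectionFormOn g η α V := by
  obtain ⟨v, hv0, -⟩ := (h.form x hx).exists_basis
  let ξ : Plane →L[ℝ] ℝ := g x v
  let η : Plane → Plane →L[ℝ] ℝ := fun u => ξ + ξ.comp (j u)
  have hηs : ContDiffOn ℝ ∞ η U :=
    contDiffOn_const.add (contDiffOn_const.clm_comp h.smooth_j)
  have hηv : ContDiffOn ℝ ∞ (fun u => η u v) U := hηs.clm_apply contDiffOn_const
  have hηx : η x v ≠ 0 := by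
    have := (h.form x hx).apply_j_self v
    rw [(h.form x hx).symm] at this
    simpa [η, ξ, this] using hv0
  let V := U ∩ (fun u => η u v) ⁻¹' {0}ᶜ
  have hVU : V ⊆ U := inter_subset_left
  have hV : IsOpen V := hηv.continuousOn.isOpen_inter_preimage h.isOpen isOpen_compl_singleton
  have hN : IsNullCoframeOn j η V :=
    { smooth := hηs.mono hVU
      apply_j := fun u hu X => by
        simp only [η, add_apply, ContinuousLinearMap.comp_apply, (h.form u (hVU hu)).j_sq]
        ring
      ne_zero := fun u hu h0 => hu.2 (by simp [h0]) }
  -- The factor of proportionality, read off on v: α(X) = (∇_X η)(v) / η(v).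
  let α : Plane → Plane →L[ℝ] ℝ := fun u => LinearMap.toContinuousLinearMap
    ((η u v)⁻¹ • (((ContinuousLinearMap.apply ℝ ℝ v).toLinearMap ∘ₗ (fderiv ℝ η u).toLinearMap) -
      (η u).toLinearMap ∘ₗ (christoffelSymbol g u).flip v))
  have hα : ∀ u X, α u X = (η u v)⁻¹ * (fderiv ℝ η u X v - η u (christoffelSymbol g u X v)) :=
    fun u X => rfl
  refine ⟨V, hVU, hV, ⟨hx, hηx⟩, η, α, hN, ?_, fun u hu X Y => ?_⟩
  · rw [contDiffOn_clm_apply]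
    intro X
    simp only [hα]
    refine ((hηv.mono hVU).inv fun u hu => hu.2).mul (ContDiffOn.sub ?_ ?_)
    · exact (((hηs.mono hVU).fderiv_of_isOpen (m := ∞) hV (by simp)).clm_apply
        contDiffOn_const).clm_apply contDiffOn_const
    · exact (hηs.mono hVU).clm_apply ((h.contDiffOn_christoffelSymbol X v).mono hVU)
  · have hu' := hVU hu
    have := (h.form u hu').coframe_unique (η := η u)
      (μ := fun Y => fderiv ℝ η u X Y - η u (christoffelSymbol g u X Y)) (η u).isLinear
      ⟨fun y z => by simp only [map_add]; ring,
        fun c y => by simp only [map_smul, smul_eq_mul]; ring⟩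
      (hN.apply_j u hu) (fderiv_coframe_j (h.mono hV hVU) hN hu X) v Y
    rw [hα, inv_mul_eq_div, div_mul_eq_mul_div, eq_div_iff hu.2]
    exact this

/-- The curvature tensor of a field of bilinear forms on the plane. -/
def curvatureTensor (g : Plane → Plane →L[ℝ] Plane →L[ℝ] ℝ) (u X Y Z : Plane) : Plane :=
  fderiv ℝ (fun v => christoffelSymbol g v Y Z) u X -
    fderiv ℝ (fun v => christoffelSymbol g v X Z) u Y +
    christoffelSymbol g u X (christoffelSymbol g u Y Z) -
    christoffelSymbol g u Y (christoffelSymbol g u X Z)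

/-- The Gauss curvature of a field of bilinear forms on the plane. -/
def planeCurvature (g : Plane → Plane →L[ℝ] Plane →L[ℝ] ℝ) (u : Plane) : ℝ :=
  g u (curvatureTensor g u (EuclideanSpace.single 0 1) (EuclideanSpace.single 1 1)
      (EuclideanSpace.single 1 1)) (EuclideanSpace.single 0 1) /
    (g u (EuclideanSpace.single 0 1) (EuclideanSpace.single 0 1) *
      g u (EuclideanSpace.single 1 1) (EuclideanSpace.single 1 1) -
      g u (EuclideanSpace.single 0 1) (EuclideanSpace.single 1 1) ^ 2)

theorem IsParaKahlerOn.differentiableAt_christoffelSymbol (h : IsParaKahlerOn g j U) {u : Plane}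
    (hu : u ∈ U) (X Y : Plane) : DifferentiableAt ℝ (fun v => christoffelSymbol g v X Y) u :=
  ((h.contDiffOn_christoffelSymbol X Y).contDiffAt (h.isOpen.mem_nhds hu)).differentiableAt
    (by simp)

/-- Differentiate metric compatibility once more: the second derivatives of g(Y, Z) in directions W
and X commute, and the antisymmetric part of their expressions is the claim. -/
theorem curvatureTensor_skew (h : IsParaKahlerOn g j U) {u : Plane} (hu : u ∈ U)
    (W X Y Z : Plane) :
    g u (curvatureTensor g u W X Y) Z + g u Y (curvatureTensor g u W X Z) = 0 := by
  have hnhds := h.isOpen.mem_nhds hu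
  have hd := h.differentiableAt hu
  have hf : ContDiffAt ℝ 2 (fun v => g v Y Z) u :=
    (((h.smooth_metric.contDiffAt hnhds).clm_apply contDiffAt_const).clm_apply
      contDiffAt_const).of_le two_le_infty
  have key : ∀ W X, fderiv ℝ (fderiv ℝ (fun v => g v Y Z)) u W X =
      (g u (christoffelSymbol g u W (christoffelSymbol g u X Y)) Z +
        g u (christoffelSymbol g u X Y) (christoffelSymbol g u W Z) +
        g u (fderiv ℝ (fun v => christoffelSymbol g v X Y) u W) Z) +
      (g u (christoffelSymbol g u W Y) (christoffelSymbol g u X Z) +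
        g u Y (christoffelSymbol g u W (christoffelSymbol g u X Z)) +
        g u Y (fderiv ℝ (fun v => christoffelSymbol g v X Z) u W)) := fun W X => by
    obtain ⟨L, hL, hLX⟩ := exists_hasFDerivAt_bilinear (f := id) hd (hasFDerivAt_id u)
      (h.differentiableAt_christoffelSymbol hu X Y).hasFDerivAt (hasFDerivAt_const Z u)
    obtain ⟨M, hM, hMX⟩ := exists_hasFDerivAt_bilinear (f := id) hd (hasFDerivAt_id u)
      (hasFDerivAt_const Y u) (h.differentiableAt_christoffelSymbol hu X Z).hasFDerivAt
    have h1 := (hasFDerivAt_fderiv_apply hf X).unique ((hL.add hM).congr_of_eventuallyEq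
      (Filter.mem_of_superset hnhds fun v hv => by
        obtain ⟨N, hN, hNX⟩ := exists_hasFDerivAt_bilinear_const (h.differentiableAt hv) Y Z
        simp only [mem_ofPred_eq, hN.fderiv, hNX]
        exact h.fderiv_metric hv X Y Z))
    have h2 := congrArg (fun l : Plane →L[ℝ] ℝ => l W) h1
    simp only [ContinuousLinearMap.flip_apply, add_apply, hLX, hMX, id_eq,
      ContinuousLinearMap.id_apply, h.fderiv_metric hu, zero_apply, map_zero] at h2
    rw [h2]
    ring
  have h3 := fderiv_fderiv_symm hf W X
  rw [key, key] at h3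
  simp only [curvatureTensor, map_add, map_sub, add_apply, sub_apply]
  linarith

/-- The Ricci identity for η: commuting second derivatives of η(Y), expanded by ∇η = α ⊗ η, leave
only the exterior derivative of α. -/
theorem coframe_curvatureTensor (h : IsParaKahlerOn g j U) {η α : Plane → Plane →L[ℝ] ℝ}
    (hη : IsNullCoframeOn j η U) (hα : IsConnectionFormOn g η α U) {u : Plane} (hu : u ∈ U)
    (W X Y : Plane) : η u (curvatureTensor g u W X Y) =
      -(fderiv ℝ α u W X - fderiv ℝ α u X W) * η u Y := by
  have hnhds := h.isOpen.mem_nhds hu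
  have hηd : DifferentiableAt ℝ η u := (hη.smooth.contDiffAt hnhds).differentiableAt (by simp)
  have hαd : DifferentiableAt ℝ α u := (hα.smooth.contDiffAt hnhds).differentiableAt (by simp)
  have hf : ContDiffAt ℝ 2 (fun v => η v Y) u :=
    ((hη.smooth.contDiffAt hnhds).clm_apply contDiffAt_const).of_le two_le_infty
  have hD : ∀ v ∈ U, ∀ X Y, fderiv ℝ η v X Y =
      η v (christoffelSymbol g v X Y) + α v X * η v Y := fun v hv X Y => by
    rw [← hα.apply v hv]; ring
  have key : ∀ W X, fderiv ℝ (fderiv ℝ (fun v => η v Y)) u W X =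
      η u (christoffelSymbol g u W (christoffelSymbol g u X Y)) +
        α u W * η u (christoffelSymbol g u X Y) +
        η u (fderiv ℝ (fun v => christoffelSymbol g v X Y) u W) + fderiv ℝ α u W X * η u Y +
        α u X * (η u (christoffelSymbol g u W Y) + α u W * η u Y) := fun W X => by
    obtain ⟨L, hL, hLX⟩ := exists_hasFDerivAt_clm_apply (f := id) hηd (hasFDerivAt_id u)
      (h.differentiableAt_christoffelSymbol hu X Y).hasFDerivAt
    obtain ⟨M, hM, hMX⟩ := exists_hasFDerivAt_clm_apply_const hηd Y
    obtain ⟨N, hN, hNX⟩ := exists_hasFDerivAt_clm_apply_const hαd X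
    have h1 := (hasFDerivAt_fderiv_apply hf X).unique ((hL.add (hN.mul hM)).congr_of_eventuallyEq
      (Filter.mem_of_superset hnhds fun v hv => by
        obtain ⟨M', hM', hMX'⟩ := exists_hasFDerivAt_clm_apply_const
          ((hη.smooth.contDiffAt (h.isOpen.mem_nhds hv)).differentiableAt (by simp)) Y
        simp only [mem_ofPred_eq, hM'.fderiv, hMX']
        exact hD v hv X Y))
    have h2 := congrArg (fun l : Plane →L[ℝ] ℝ => l W) h1
    simp only [ContinuousLinearMap.flip_apply, add_apply, smul_apply, smul_eq_mul, hLX, hMX, hNX,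
      id_eq, ContinuousLinearMap.id_apply, hD u hu] at h2
    rw [h2]
    ring
  have h3 := fderiv_fderiv_symm hf W X
  rw [key, key] at h3
  simp only [curvatureTensor, map_add, map_sub]
  linarith

/-- A map with a skew adjoint is automatically linear, since K y is determined by the functional
-b(y, K ·). This provides linearity of R(W, X) without expanding the curvature tensor. -/
theorem IsMetricForm.isLinearMap_of_skew {b : Plane →L[ℝ] Plane →L[ℝ] ℝ} (hb : IsMetricForm b)
    {K : Plane → Plane} (h : ∀ y z, b (K y) z + b y (K z) = 0) : IsLinearMap ℝ K where
  map_add y y' := hb.ext_left fun z => by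
    have h1 := h (y + y') z
    have h2 := h y z
    have h3 := h y' z
    simp only [map_add, add_apply] at h1 ⊢
    linarith
  map_smul c y := hb.ext_left fun z => by
    have h1 := h (c • y) z
    have h2 := h y z
    simp only [map_smul, smul_apply, smul_eq_mul] at h1 ⊢
    linear_combination h1 - c * h2

/-- Alternating 2-forms on the plane are multiples of the determinant. -/
theorem alternating_plane (B : Plane →L[ℝ] Plane →L[ℝ] ℝ) (X Y : Plane) :
    B X Y - B Y X = (X 0 * Y 1 - X 1 * Y 0) *
      (B (EuclideanSpace.single 0 1) (EuclideanSpace.single 1 1) -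
        B (EuclideanSpace.single 1 1) (EuclideanSpace.single 0 1)) := by
  conv_lhs => rw [plane_eq X, plane_eq Y]
  simp only [map_add, map_smul, add_apply, smul_apply, smul_eq_mul]
  ring

/-- The curvature form of a null coframe: `dα = -κ ω`. -/
theorem extDeriv_connectionForm (h : IsParaKahlerOn g j U) {η α : Plane → Plane →L[ℝ] ℝ}
    (hη : IsNullCoframeOn j η U) (hα : IsConnectionFormOn g η α U) {u : Plane} (hu : u ∈ U)
    (X Y : Plane) : fderiv ℝ α u X Y - fderiv ℝ α u Y X =
      -planeCurvature g u * g u (j u X) Y := by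
  have hf := h.form u hu
  -- Both sides are alternating in X and Y, so one pair of basis vectors suffices.
  suffices hs : fderiv ℝ α u (EuclideanSpace.single 0 1) (EuclideanSpace.single 1 1) -
      fderiv ℝ α u (EuclideanSpace.single 1 1) (EuclideanSpace.single 0 1) =
      -planeCurvature g u * g u (j u (EuclideanSpace.single 0 1)) (EuclideanSpace.single 1 1) by
    have h1 := alternating_plane ((g u).comp (j u)) X Y
    simp only [ContinuousLinearMap.comp_apply] at h1
    rw [hf.omega_antisymm Y X, hf.omega_antisymm (EuclideanSpace.single 1 1)] at h1
    rw [alternating_plane, hs]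
    linear_combination (-planeCurvature g u / 2) * -h1
  set e₀ : Plane := EuclideanSpace.single 0 1
  set e₁ : Plane := EuclideanSpace.single 1 1
  have hlin := hf.toIsMetricForm.isLinearMap_of_skew (curvatureTensor_skew h hu e₀ e₁)
  -- R(e₀, e₁) = c j by skewness. Applying η gives c = -dα(e₀, e₁), while the definition of the
  -- Gauss curvature gives c = κ ω(e₀, e₁).
  obtain ⟨c, hc⟩ := hf.eq_smul_of_skew hlin.mk' (curvatureTensor_skew h hu e₀ e₁)
  have hc' : ∀ y, curvatureTensor g u e₀ e₁ y = c • j u y := hc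
  obtain ⟨y, hy⟩ : ∃ y, η u y ≠ 0 := by
    by_contra! hn
    exact hη.ne_zero u hu (by ext y; simpa using hn y)
  have h1 := coframe_curvatureTensor h hη hα hu e₀ e₁ y
  rw [hc', map_smul, hη.apply_j u hu, smul_eq_mul] at h1
  have h2 := mul_right_cancel₀ hy h1
  have h3 : g u (j u e₀) e₁ ≠ 0 := hf.omega_ne_zero
  have h4 := hf.omega_sq e₀ e₁
  have h5 : g u e₀ e₀ * g u e₁ e₁ - g u e₀ e₁ ^ 2 = -g u (j u e₀) e₁ ^ 2 := by linarith
  have h6 : planeCurvature g u = c * g u (j u e₁) e₀ / (-g u (j u e₀) e₁ ^ 2) := by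
    rw [← h5]
    simp only [planeCurvature]
    rw [hc', map_smul, smul_apply, smul_eq_mul]
  rw [h6, hf.omega_antisymm e₁ e₀, h2]
  field_simp

end Curvature

/-! ### Invariance under local isomorphisms of para-Kähler structures. -/

section Maps

variable {g g' : Plane → Plane →L[ℝ] Plane →L[ℝ] ℝ} {j j' : Plane → Plane →L[ℝ] Plane}
  {U V : Set Plane} {τ : Plane → Plane}

/-- A local diffeomorphism `τ` with `τ^* g = g'` and `dτ ∘ j' = j ∘ dτ`. -/
structure IsParaKahlerMapOn (g' : Plane → Plane →L[ℝ] Plane →L[ℝ] ℝ)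
    (j' : Plane → Plane →L[ℝ] Plane) (g : Plane → Plane →L[ℝ] Plane →L[ℝ] ℝ)
    (j : Plane → Plane →L[ℝ] Plane) (τ : Plane → Plane) (V U : Set Plane) : Prop where
  smooth : ContDiffOn ℝ ∞ τ V
  mapsTo : MapsTo τ V U
  surjective : ∀ v ∈ V, Function.Surjective (fderiv ℝ τ v)
  metric : ∀ v ∈ V, ∀ X Y, g' v X Y = g (τ v) (fderiv ℝ τ v X) (fderiv ℝ τ v Y)
  map_j : ∀ v ∈ V, ∀ X, fderiv ℝ τ v (j' v X) = j (τ v) (fderiv ℝ τ v X)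

theorem IsParaKahlerMapOn.contDiffAt (hτ : IsParaKahlerMapOn g' j' g j τ V U) (hV : IsOpen V)
    {v : Plane} (hv : v ∈ V) : ContDiffAt ℝ 2 τ v :=
  (hτ.smooth.contDiffAt (hV.mem_nhds hv)).of_le two_le_infty

theorem IsParaKahlerMapOn.fderiv_christoffelSymbol (hτ : IsParaKahlerMapOn g' j' g j τ V U)
    (h' : IsParaKahlerOn g' j' V) (h : IsParaKahlerOn g j U) {v : Plane} (hv : v ∈ V)
    (X Y : Plane) :
    fderiv ℝ τ v (christoffelSymbol g' v X Y) = covariantHessian g τ v X Y :=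
  LocalGeometry.fderiv_christoffelSymbol (hτ.contDiffAt h'.isOpen hv) (hτ.surjective v hv)
    (h.differentiableAt (hτ.mapsTo hv)) (h.form _ (hτ.mapsTo hv)).toIsMetricForm
    (h.fderiv_symm (hτ.mapsTo hv))
    (Filter.mem_of_superset (h'.isOpen.mem_nhds hv) fun w hw => hτ.metric w hw)
    (h'.differentiableAt hv) X Y

/-- The derivative of the pullback of a 1-form. -/
theorem exists_hasFDerivAt_pullback_form {β : Plane → Plane →L[ℝ] ℝ} {f : Plane → Plane}
    {u : Plane} (hf : ContDiffAt ℝ 2 f u) (hβ : DifferentiableAt ℝ β (f u)) (Y : Plane) :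
    ∃ L : Plane →L[ℝ] ℝ, HasFDerivAt (fun v => β (f v) (fderiv ℝ f v Y)) L u ∧
      ∀ X, L X = fderiv ℝ β (f u) (fderiv ℝ f u X) (fderiv ℝ f u Y) +
        β (f u) (fderiv ℝ (fderiv ℝ f) u X Y) := by
  obtain ⟨L, hL, h⟩ := exists_hasFDerivAt_clm_apply hβ
    (hf.differentiableAt (by norm_num)).hasFDerivAt (hasFDerivAt_fderiv_apply hf Y)
  exact ⟨L, hL, fun X => by rw [h]; rfl⟩

/-- The pullback of a 1-form. -/
def pullbackForm (τ : Plane → Plane) (β : Plane → Plane →L[ℝ] ℝ) (v : Plane) : Plane →L[ℝ] ℝ :=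
  (β (τ v)).comp (fderiv ℝ τ v)

theorem fderiv_pullbackForm {β : Plane → Plane →L[ℝ] ℝ} {f : Plane → Plane}
    {u : Plane} (hf : ContDiffAt ℝ 2 f u) (hβ : DifferentiableAt ℝ β (f u)) (X Y : Plane) :
    fderiv ℝ (pullbackForm f β) u X Y =
      fderiv ℝ β (f u) (fderiv ℝ f u X) (fderiv ℝ f u Y) +
        β (f u) (fderiv ℝ (fderiv ℝ f) u X Y) := by
  have hd : DifferentiableAt ℝ (pullbackForm f β) u :=
    (hβ.comp u (hf.differentiableAt (by norm_num))).clm_comp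
      ((hf.fderiv_right (m := 1) (by norm_num)).differentiableAt (by norm_num))
  obtain ⟨L, hL, h⟩ := exists_hasFDerivAt_pullback_form hf hβ Y
  obtain ⟨M, hM, hMX⟩ := exists_hasFDerivAt_clm_apply_const hd Y
  rw [← h, ← hMX, hL.unique hM]

theorem contDiffOn_pullbackForm {β : Plane → Plane →L[ℝ] ℝ} (hτ : ContDiffOn ℝ ∞ τ V)
    (hV : IsOpen V) (hm : MapsTo τ V U) (hβ : ContDiffOn ℝ ∞ β U) :
    ContDiffOn ℝ ∞ (pullbackForm τ β) V :=
  (hβ.comp hτ hm).clm_comp (hτ.fderiv_of_isOpen hV (by simp))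

theorem IsNullCoframeOn.pullback {η : Plane → Plane →L[ℝ] ℝ}
    (hτ : IsParaKahlerMapOn g' j' g j τ V U) (hV : IsOpen V) (hη : IsNullCoframeOn j η U) :
    IsNullCoframeOn j' (pullbackForm τ η) V where
  smooth := contDiffOn_pullbackForm hτ.smooth hV hτ.mapsTo hη.smooth
  apply_j v hv X := by
    simp only [pullbackForm, ContinuousLinearMap.comp_apply, hτ.map_j v hv,
      hη.apply_j _ (hτ.mapsTo hv)]
  ne_zero v hv h0 := by
    refine hη.ne_zero _ (hτ.mapsTo hv) ?_
    ext X
    obtain ⟨Y, rfl⟩ := hτ.surjective v hv X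
    simpa [pullbackForm] using congrArg (fun l : Plane →L[ℝ] ℝ => l Y) h0

theorem IsConnectionFormOn.pullback {η α : Plane → Plane →L[ℝ] ℝ}
    (hτ : IsParaKahlerMapOn g' j' g j τ V U) (h' : IsParaKahlerOn g' j' V)
    (h : IsParaKahlerOn g j U) (hη : IsNullCoframeOn j η U) (hα : IsConnectionFormOn g η α U) :
    IsConnectionFormOn g' (pullbackForm τ η) (pullbackForm τ α) V where
  smooth := contDiffOn_pullbackForm hτ.smooth h'.isOpen hτ.mapsTo hα.smooth
  apply v hv X Y := by
    have hm := hτ.mapsTo hv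
    rw [fderiv_pullbackForm (hτ.contDiffAt h'.isOpen hv)
      ((hη.smooth.contDiffAt (h.isOpen.mem_nhds hm)).differentiableAt (by simp))]
    simp only [pullbackForm, ContinuousLinearMap.comp_apply]
    rw [hτ.fderiv_christoffelSymbol h' h hv, ← hα.apply _ hm, covariantHessian, map_add]
    ring

/-- Invariance of the Gauss curvature. -/
theorem IsParaKahlerMapOn.planeCurvature_eq (hτ : IsParaKahlerMapOn g' j' g j τ V U)
    (h' : IsParaKahlerOn g' j' V) (h : IsParaKahlerOn g j U) {η α : Plane → Plane →L[ℝ] ℝ}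
    (hη : IsNullCoframeOn j η U) (hα : IsConnectionFormOn g η α U) {v : Plane} (hv : v ∈ V) :
    planeCurvature g' v = planeCurvature g (τ v) := by
  have hm := hτ.mapsTo hv
  have h2 := hτ.contDiffAt h'.isOpen hv
  have hd : DifferentiableAt ℝ α (τ v) :=
    (hα.smooth.contDiffAt (h.isOpen.mem_nhds hm)).differentiableAt (by simp)
  -- The curvature equation holds for the pulled back coframe upstairs and for the original one
  -- downstairs. The second derivatives of τ drop out by symmetry, and the common factor ω(e₀, e₁)
  -- is cancelled.
  have h1 := extDeriv_connectionForm h' (hη.pullback hτ h'.isOpen) (hα.pullback hτ h' h hη) hv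
    (EuclideanSpace.single 0 1) (EuclideanSpace.single 1 1)
  rw [fderiv_pullbackForm h2 hd, fderiv_pullbackForm h2 hd, fderiv_fderiv_symm h2
    (EuclideanSpace.single 1 1), add_sub_add_right_eq_sub, extDeriv_connectionForm h hη hα hm,
    ← hτ.map_j v hv, ← hτ.metric v hv] at h1
  have := mul_right_cancel₀ (h'.form v hv).omega_ne_zero h1
  linarith

/-- Locally κ = -dα(e₀, e₁) / ω(e₀, e₁), a quotient of continuous functions. -/
theorem IsParaKahlerOn.continuousAt_planeCurvature (h : IsParaKahlerOn g j U) {u : Plane}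
    (hu : u ∈ U) : ContinuousAt (planeCurvature g) u := by
  obtain ⟨V, hVU, hV, huV, η, α, hη, hα⟩ := exists_nullCoframe h hu
  have h' := h.mono hV hVU
  have hD : ∀ X Y : Plane, ContinuousOn (fun v => fderiv ℝ α v X Y) V := fun X Y =>
    (((hα.smooth.fderiv_of_isOpen (m := ∞) hV (by simp)).clm_apply
        contDiffOn_const).clm_apply contDiffOn_const).continuousOn
  let e₀ : Plane := EuclideanSpace.single 0 1
  let e₁ : Plane := EuclideanSpace.single 1 1
  have hω : ContinuousOn (fun v => g v (j v e₀) e₁) V :=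
    ((h'.smooth_metric.clm_apply (h'.smooth_j.clm_apply contDiffOn_const)).clm_apply
      contDiffOn_const).continuousOn
  refine ContinuousOn.continuousAt (s := V) ?_ (hV.mem_nhds huV)
  refine (((hD e₀ e₁).sub (hD e₁ e₀)).neg.div hω
    fun v hv => (h'.form v hv).omega_ne_zero).congr fun v hv => ?_
  have h1 := extDeriv_connectionForm h' hη hα hv e₀ e₁
  change planeCurvature g v = -(fderiv ℝ α v e₀ e₁ - fderiv ℝ α v e₁ e₀) / g v (j v e₀) e₁
  rw [eq_div_iff (h'.form v hv).omega_ne_zero]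
  change planeCurvature g v * g v (j v e₀) e₁ = -(fderiv ℝ α v e₀ e₁ - fderiv ℝ α v e₁ e₀)
  rw [h1]
  ring

end Maps

end LocalGeometry

namespace LocalGeometry

/-! ### Pullbacks of ω and of null coframes by one map. -/

section Factor

variable {g : Plane → Plane →L[ℝ] Plane →L[ℝ] ℝ} {j : Plane → Plane →L[ℝ] Plane}
  {U : Set Plane} {f : Plane → Plane} {u : Plane}

/-- Since g and j are parallel, so is ω; only the second covariant derivative of f contributes. -/
theorem exists_hasFDerivAt_pullback_omega (h : IsParaKahlerOn g j U) (hf : ContDiffAt ℝ 2 f u)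
    (hu : f u ∈ U) (Y Z : Plane) :
    ∃ L : Plane →L[ℝ] ℝ,
      HasFDerivAt (fun v => g (f v) (j (f v) (fderiv ℝ f v Y)) (fderiv ℝ f v Z)) L u ∧
      ∀ X, L X = g (f u) (j (f u) (covariantHessian g f u X Y)) (fderiv ℝ f u Z) +
        g (f u) (j (f u) (fderiv ℝ f u Y)) (covariantHessian g f u X Z) := by
  have hd := (hf.differentiableAt (by norm_num)).hasFDerivAt
  obtain ⟨L, hL, hLX⟩ := exists_hasFDerivAt_clm_apply (h.differentiableAt_j hu) hd
    (hasFDerivAt_fderiv_apply hf Y)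
  obtain ⟨M, hM, hMX⟩ := exists_hasFDerivAt_bilinear (h.differentiableAt hu) hd hL
    (hasFDerivAt_fderiv_apply hf Z)
  refine ⟨M, hM, fun X => ?_⟩
  rw [hMX, hLX, h.fderiv_metric hu, h.fderiv_j hu]
  simp only [covariantHessian, ContinuousLinearMap.flip_apply, map_add, map_sub,
    add_apply, sub_apply]
  ring

/-- In contrast to ω, the coframe is only parallel up to scale, which accounts for the additional
term in α. -/
theorem exists_hasFDerivAt_pullback_coframe (h : IsParaKahlerOn g j U) (hf : ContDiffAt ℝ 2 f u)
    (hu : f u ∈ U) {η α : Plane → Plane →L[ℝ] ℝ} (hη : IsNullCoframeOn j η U)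
    (hα : IsConnectionFormOn g η α U) (Y : Plane) :
    ∃ L : Plane →L[ℝ] ℝ, HasFDerivAt (fun v => η (f v) (fderiv ℝ f v Y)) L u ∧
      ∀ X, L X = η (f u) (covariantHessian g f u X Y) +
        α (f u) (fderiv ℝ f u X) * η (f u) (fderiv ℝ f u Y) := by
  obtain ⟨L, hL, hLX⟩ := exists_hasFDerivAt_pullback_form hf
    ((hη.smooth.contDiffAt (h.isOpen.mem_nhds hu)).differentiableAt (by simp)) Y
  refine ⟨L, hL, fun X => ?_⟩
  rw [hLX, covariantHessian, map_add, ← hα.apply _ hu]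
  ring

/-- The left-hand side is b(y + j y, z), and y + j y moves on a line on which η is the coordinate.
So g + ω has rank one, which drives the computation with the induced metric. -/
theorem IsParaKahlerForm.exists_coframe_factor {b : Plane →L[ℝ] Plane →L[ℝ] ℝ}
    {j : Plane →L[ℝ] Plane} (h : IsParaKahlerForm b j) {η : Plane →L[ℝ] ℝ}
    (hηj : ∀ v, η (j v) = η v) (h0 : η ≠ 0) :
    ∃ m : Plane → ℝ, ∀ y z, b y z + b (j y) z = η y * m z := by
  obtain ⟨e, he⟩ : ∃ y, η y ≠ 0 := by
    by_contra! hn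
    exact h0 (by ext y; simpa using hn y)
  refine ⟨fun z => b (e + j e) z / η e, fun y z => ?_⟩
  have h1 := congrArg (fun x => b x z) (h.coframe_smul hηj e y)
  simp only [map_smul, map_add, smul_apply, add_apply, smul_eq_mul] at h1 ⊢
  field_simp
  linarith

end Factor

/-! ### Minimal Lagrangian surfaces in coordinates: constant angle and Ricci form. -/

section MinimalLagrangian

variable {g₁ g₂ : Plane → Plane →L[ℝ] Plane →L[ℝ] ℝ} {j₁ j₂ : Plane → Plane →L[ℝ] Plane}
  {U₁ U₂ W : Set Plane} {φ ψ : Plane → Plane} {u : Plane}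

/-- The metric induced by `(φ, ψ)` from `g₁ - g₂`. -/
def inducedForm (g₁ g₂ : Plane → Plane →L[ℝ] Plane →L[ℝ] ℝ) (φ ψ : Plane → Plane)
    (u : Plane) : Plane →L[ℝ] Plane →L[ℝ] ℝ :=
  (g₁ (φ u)).bilinearComp (fderiv ℝ φ u) (fderiv ℝ φ u) -
    (g₂ (ψ u)).bilinearComp (fderiv ℝ ψ u) (fderiv ℝ ψ u)

theorem inducedForm_apply (u X Y : Plane) : inducedForm g₁ g₂ φ ψ u X Y =
    g₁ (φ u) (fderiv ℝ φ u X) (fderiv ℝ φ u Y) - g₂ (ψ u) (fderiv ℝ ψ u X) (fderiv ℝ ψ u Y) := rfl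

/-- The cubic form `(X, Y, Z) ↦ G(D_X ∂_Y Φ, J ∂_Z Φ)` of `Φ = (φ, ψ)` for `G = g₁ - g₂`. -/
def cubicForm (g₁ g₂ : Plane → Plane →L[ℝ] Plane →L[ℝ] ℝ) (j₁ j₂ : Plane → Plane →L[ℝ] Plane)
    (φ ψ : Plane → Plane) (u X Y Z : Plane) : ℝ :=
  g₁ (φ u) (covariantHessian g₁ φ u X Y) (j₁ (φ u) (fderiv ℝ φ u Z)) -
    g₂ (ψ u) (covariantHessian g₂ ψ u X Y) (j₂ (ψ u) (fderiv ℝ ψ u Z))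

/-- The determinant of `h` times the trace of `b` with respect to `h`, on the span of `v`, `w`. -/
def adjugateTrace {F : Type*} [AddCommGroup F] [Module ℝ F] (h : Plane → Plane → ℝ)
    (b : Plane → Plane → F) (v w : Plane) : F :=
  h w w • b v v - h v w • (b v w + b w v) + h v v • b w w

/-- A minimal Lagrangian immersion into `g₁ - g₂`. -/
structure IsMinimalLagrangianOn (g₁ g₂ : Plane → Plane →L[ℝ] Plane →L[ℝ] ℝ)
    (j₁ j₂ : Plane → Plane →L[ℝ] Plane) (φ ψ : Plane → Plane) (W U₁ U₂ : Set Plane) :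
    Prop where
  isOpen : IsOpen W
  smooth_fst : ContDiffOn ℝ ∞ φ W
  smooth_snd : ContDiffOn ℝ ∞ ψ W
  mapsTo_fst : MapsTo φ W U₁
  mapsTo_snd : MapsTo ψ W U₂
  lagrangian : ∀ u ∈ W, ∀ X Y, g₁ (φ u) (j₁ (φ u) (fderiv ℝ φ u X)) (fderiv ℝ φ u Y) =
    g₂ (ψ u) (j₂ (ψ u) (fderiv ℝ ψ u X)) (fderiv ℝ ψ u Y)
  nondegenerate : ∀ u ∈ W, IsMetricForm (inducedForm g₁ g₂ φ ψ u)
  minimal : ∀ u ∈ W, ∀ Z, adjugateTrace (fun X Y => inducedForm g₁ g₂ φ ψ u X Y)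
    (fun X Y => cubicForm g₁ g₂ j₁ j₂ φ ψ u X Y Z)
    (EuclideanSpace.single 0 1) (EuclideanSpace.single 1 1) = 0

theorem IsMetricForm.det_ne_zero {b : Plane →L[ℝ] Plane →L[ℝ] ℝ} (hb : IsMetricForm b) :
    b (EuclideanSpace.single 0 1) (EuclideanSpace.single 0 1) *
      b (EuclideanSpace.single 1 1) (EuclideanSpace.single 1 1) -
      b (EuclideanSpace.single 0 1) (EuclideanSpace.single 1 1) ^ 2 ≠ 0 := by
  intro h0
  set e₀ : Plane := EuclideanSpace.single 0 1 with he₀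
  set e₁ : Plane := EuclideanSpace.single 1 1 with he₁
  have hs := hb.symm e₁ e₀
  -- If the determinant vanishes, the columns of the adjugate lie in the radical, so all entries are
  -- zero and e₀ is in the radical too.
  have h1 : b e₁ e₁ • e₀ - b e₀ e₁ • e₁ = 0 := hb.nondegenerate _ fun w => by
    rw [plane_eq w, ← he₀, ← he₁]
    simp only [map_sub, map_smul, map_add, sub_apply, smul_apply, smul_eq_mul, hs]
    linear_combination w 0 * h0
  have h2 : -b e₀ e₁ • e₀ + b e₀ e₀ • e₁ = 0 := hb.nondegenerate _ fun w => by
    rw [plane_eq w, ← he₀, ← he₁]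
    simp only [map_smul, map_add, add_apply, smul_apply, smul_eq_mul, hs]
    linear_combination w 1 * h0
  have h11 := congrArg (fun x : Plane => x 0) h1
  have h01 := congrArg (fun x : Plane => x 1) h1
  have h00 := congrArg (fun x : Plane => x 1) h2
  simp [he₀, he₁] at h11 h01 h00
  have h3 : e₀ = 0 := hb.nondegenerate _ fun w => by
    rw [plane_eq w, ← he₀, ← he₁]
    simp only [map_smul, map_add, smul_eq_mul]
    rw [he₀, he₁, h00, h01]
    ring
  have h4 := congrArg (fun x : Plane => x 0) h3
  simp [he₀] at h4

theorem IsMinimalLagrangianOn.contDiffAt_fst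
    (h : IsMinimalLagrangianOn g₁ g₂ j₁ j₂ φ ψ W U₁ U₂) (hu : u ∈ W) : ContDiffAt ℝ 2 φ u :=
  (h.smooth_fst.contDiffAt (h.isOpen.mem_nhds hu)).of_le two_le_infty

theorem IsMinimalLagrangianOn.contDiffAt_snd
    (h : IsMinimalLagrangianOn g₁ g₂ j₁ j₂ φ ψ W U₁ U₂) (hu : u ∈ W) : ContDiffAt ℝ 2 ψ u :=
  (h.smooth_snd.contDiffAt (h.isOpen.mem_nhds hu)).of_le two_le_infty

/-- This is the derivative of φ^*ω = ψ^*ω in direction X. With the symmetry of second covariant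
derivatives it makes the cubic form totally symmetric. -/
theorem IsMinimalLagrangianOn.cubicForm_symm
    (h : IsMinimalLagrangianOn g₁ g₂ j₁ j₂ φ ψ W U₁ U₂) (h₁ : IsParaKahlerOn g₁ j₁ U₁)
    (h₂ : IsParaKahlerOn g₂ j₂ U₂) (hu : u ∈ W) (X Y Z : Plane) :
    cubicForm g₁ g₂ j₁ j₂ φ ψ u X Y Z = cubicForm g₁ g₂ j₁ j₂ φ ψ u X Z Y := by
  have m₁ := h.mapsTo_fst hu
  have m₂ := h.mapsTo_snd hu
  obtain ⟨L, hL, hLX⟩ := exists_hasFDerivAt_pullback_omega h₁ (h.contDiffAt_fst hu) m₁ Y Z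
  obtain ⟨M, hM, hMX⟩ := exists_hasFDerivAt_pullback_omega h₂ (h.contDiffAt_snd hu) m₂ Y Z
  have h1 := congrArg (fun l : Plane →L[ℝ] ℝ => l X) (hL.unique (hM.congr_of_eventuallyEq
    (Filter.mem_of_superset (h.isOpen.mem_nhds hu) fun v hv => h.lagrangian v hv Y Z)))
  simp only [hLX, hMX] at h1
  rw [(h₁.form _ m₁).skew, (h₂.form _ m₂).skew, (h₁.form _ m₁).symm (j₁ _ _),
    (h₂.form _ m₂).symm (j₂ _ _)] at h1
  simp only [cubicForm]
  linarith

theorem IsMinimalLagrangianOn.cubicForm_symm_left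
    (h : IsMinimalLagrangianOn g₁ g₂ j₁ j₂ φ ψ W U₁ U₂) (h₁ : IsParaKahlerOn g₁ j₁ U₁)
    (h₂ : IsParaKahlerOn g₂ j₂ U₂) (hu : u ∈ W) (X Y Z : Plane) :
    cubicForm g₁ g₂ j₁ j₂ φ ψ u X Y Z = cubicForm g₁ g₂ j₁ j₂ φ ψ u Y X Z := by
  have m₁ := h.mapsTo_fst hu
  have m₂ := h.mapsTo_snd hu
  rw [cubicForm, covariantHessian_symm (h₁.form _ m₁).toIsMetricForm (h₁.fderiv_symm m₁)
    (h.contDiffAt_fst hu), covariantHessian_symm (h₂.form _ m₂).toIsMetricForm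
    (h₂.fderiv_symm m₂) (h.contDiffAt_snd hu)]
  rfl

/-- The matrices h and Y - C factor through the same covectors m₁, m₂. So det h is the minor of N
times the minor of m, and det h times the trace of Y - C is the same minor of m times the minor of N
differentiated in the direction P. The trace of C is zero and drops out. -/
theorem adjugate_trace_identity {N₁₀ N₁₁ N₂₀ N₂₁ m₁₀ m₁₁ m₂₀ m₂₁ P₁₀ P₁₁ P₂₀ P₂₁
    h₀₀ h₀₁ h₁₁ C₀₀ C₀₁ C₁₀ C₁₁ Y₀₀ Y₀₁ Y₁₀ Y₁₁ : ℝ} (e₀₀ : h₀₀ = N₁₀ * m₁₀ - N₂₀ * m₂₀)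
    (e₀₁ : h₀₁ = N₁₀ * m₁₁ - N₂₀ * m₂₁) (e₁₀ : h₀₁ = N₁₁ * m₁₀ - N₂₁ * m₂₀)
    (e₁₁ : h₁₁ = N₁₁ * m₁₁ - N₂₁ * m₂₁)
    (y₀₀ : Y₀₀ - C₀₀ = P₁₀ * m₁₀ - P₂₀ * m₂₀) (y₀₁ : Y₀₁ - C₀₁ = P₁₀ * m₁₁ - P₂₀ * m₂₁)
    (y₁₀ : Y₁₀ - C₁₀ = P₁₁ * m₁₀ - P₂₁ * m₂₀) (y₁₁ : Y₁₁ - C₁₁ = P₁₁ * m₁₁ - P₂₁ * m₂₁)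
    (hC : h₁₁ * C₀₀ - h₀₁ * (C₀₁ + C₁₀) + h₀₀ * C₁₁ = 0) :
    (N₁₀ * N₂₁ - N₁₁ * N₂₀) * (h₁₁ * Y₀₀ - h₀₁ * (Y₀₁ + Y₁₀) + h₀₀ * Y₁₁) =
      (h₀₀ * h₁₁ - h₀₁ ^ 2) * (P₁₀ * N₂₁ + N₁₀ * P₂₁ - P₁₁ * N₂₀ - N₁₁ * P₂₀) := by
  have hd : h₀₀ * h₁₁ - h₀₁ ^ 2 = (N₁₀ * N₂₁ - N₁₁ * N₂₀) * (m₁₁ * m₂₀ - m₁₀ * m₂₁) := by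
    -- The off-diagonal entry has two factorisations, by symmetry of h; the determinant only factors
    -- if each is used once in the square.
    rw [pow_two]; nth_rewrite 2 [e₁₀]; rw [e₀₀, e₀₁, e₁₁]; ring
  have ht : h₁₁ * Y₀₀ - h₀₁ * (Y₀₁ + Y₁₀) + h₀₀ * Y₁₁ =
      (m₁₁ * m₂₀ - m₁₀ * m₂₁) * (P₁₀ * N₂₁ + N₁₀ * P₂₁ - P₁₁ * N₂₀ - N₁₁ * P₂₀) := by
    have : h₁₁ * Y₀₀ - h₀₁ * (Y₀₁ + Y₁₀) + h₀₀ * Y₁₁ = h₁₁ * (Y₀₀ - C₀₀) - h₀₁ * (Y₀₁ - C₀₁) -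
        h₀₁ * (Y₁₀ - C₁₀) + h₀₀ * (Y₁₁ - C₁₁) := by linear_combination hC
    rw [this, y₀₀, y₀₁, y₁₀, y₁₁]
    nth_rewrite 1 [e₁₀]
    rw [e₀₀, e₀₁, e₁₁]
    ring
  rw [hd, ht]
  ring

/-- The coefficient of `φ^*η₁ ∧ ψ^*η₂`. -/
def coframeDet (η₁ η₂ : Plane → Plane →L[ℝ] ℝ) (φ ψ : Plane → Plane) (u : Plane) : ℝ :=
  η₁ (φ u) (fderiv ℝ φ u (EuclideanSpace.single 0 1)) *
    η₂ (ψ u) (fderiv ℝ ψ u (EuclideanSpace.single 1 1)) -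
  η₁ (φ u) (fderiv ℝ φ u (EuclideanSpace.single 1 1)) *
    η₂ (ψ u) (fderiv ℝ ψ u (EuclideanSpace.single 0 1))

/-- The determinant of the induced metric. -/
def inducedDet (g₁ g₂ : Plane → Plane →L[ℝ] Plane →L[ℝ] ℝ) (φ ψ : Plane → Plane)
    (u : Plane) : ℝ :=
  inducedForm g₁ g₂ φ ψ u (EuclideanSpace.single 0 1) (EuclideanSpace.single 0 1) *
    inducedForm g₁ g₂ φ ψ u (EuclideanSpace.single 1 1) (EuclideanSpace.single 1 1) -
    inducedForm g₁ g₂ φ ψ u (EuclideanSpace.single 0 1) (EuclideanSpace.single 1 1) ^ 2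

/-- A minimal Lagrangian surface has constant Lagrangian angle: the logarithmic derivatives of
`φ^*η₁ ∧ ψ^*η₂` and of the area form differ by the connection form. -/
theorem IsMinimalLagrangianOn.exists_hasFDerivAt_det
    (h : IsMinimalLagrangianOn g₁ g₂ j₁ j₂ φ ψ W U₁ U₂) (h₁ : IsParaKahlerOn g₁ j₁ U₁)
    (h₂ : IsParaKahlerOn g₂ j₂ U₂) {η₁ α₁ η₂ α₂ : Plane → Plane →L[ℝ] ℝ}
    (hη₁ : IsNullCoframeOn j₁ η₁ U₁) (hα₁ : IsConnectionFormOn g₁ η₁ α₁ U₁)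
    (hη₂ : IsNullCoframeOn j₂ η₂ U₂) (hα₂ : IsConnectionFormOn g₂ η₂ α₂ U₂) (hu : u ∈ W) :
    coframeDet η₁ η₂ φ ψ u ≠ 0 ∧ ∃ n' d' : Plane →L[ℝ] ℝ,
      HasFDerivAt (coframeDet η₁ η₂ φ ψ) n' u ∧ HasFDerivAt (inducedDet g₁ g₂ φ ψ) d' u ∧
      ∀ X, coframeDet η₁ η₂ φ ψ u * d' X = 2 * inducedDet g₁ g₂ φ ψ u *
        (n' X - (α₁ (φ u) (fderiv ℝ φ u X) + α₂ (ψ u) (fderiv ℝ ψ u X)) *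
          coframeDet η₁ η₂ φ ψ u) := by
  have m₁ := h.mapsTo_fst hu
  have m₂ := h.mapsTo_snd hu
  have c₁ := h.contDiffAt_fst hu
  have c₂ := h.contDiffAt_snd hu
  have f₁ := h₁.form _ m₁
  have f₂ := h₂.form _ m₂
  obtain ⟨μ₁, hμ₁⟩ := f₁.exists_coframe_factor (hη₁.apply_j _ m₁) (hη₁.ne_zero _ m₁)
  obtain ⟨μ₂, hμ₂⟩ := f₂.exists_coframe_factor (hη₂.apply_j _ m₂) (hη₂.ne_zero _ m₂)
  have hsymm := (h.nondegenerate u hu).symm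
  have hdet : inducedDet g₁ g₂ φ ψ u ≠ 0 := (h.nondegenerate u hu).det_ne_zero
  -- The Lagrangian condition allows ω-terms to be added to the metric at no cost, turning g into
  -- the rank one tensor g + ω on each factor.
  have hh : ∀ X Y, inducedForm g₁ g₂ φ ψ u X Y =
      η₁ (φ u) (fderiv ℝ φ u X) * μ₁ (fderiv ℝ φ u Y) -
        η₂ (ψ u) (fderiv ℝ ψ u X) * μ₂ (fderiv ℝ ψ u Y) := fun X Y => by
    rw [← hμ₁, ← hμ₂, inducedForm_apply, h.lagrangian u hu]
    ring
  -- The same factorisation for second covariant derivatives. Here the ω-terms do not cancel: they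
  -- are minus the cubic form.
  have hY : ∀ X Y Z, (g₁ (φ u) (covariantHessian g₁ φ u X Y) (fderiv ℝ φ u Z) -
        g₂ (ψ u) (covariantHessian g₂ ψ u X Y) (fderiv ℝ ψ u Z)) -
        cubicForm g₁ g₂ j₁ j₂ φ ψ u X Y Z =
      η₁ (φ u) (covariantHessian g₁ φ u X Y) * μ₁ (fderiv ℝ φ u Z) -
        η₂ (ψ u) (covariantHessian g₂ ψ u X Y) * μ₂ (fderiv ℝ ψ u Z) := fun X Y Z => by
    rw [← hμ₁, ← hμ₂, cubicForm, f₁.skew, f₂.skew]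
    ring
  -- Minimality contracts the first two slots of the cubic form; total symmetry moves the
  -- contraction to the last two.
  have hC : ∀ X, adjugateTrace (fun X Y => inducedForm g₁ g₂ φ ψ u X Y)
      (fun Y Z => cubicForm g₁ g₂ j₁ j₂ φ ψ u X Y Z)
      (EuclideanSpace.single 0 1) (EuclideanSpace.single 1 1) = 0 := fun X => by
    rw [← h.minimal u hu X]
    congr 1
    ext Y Z
    rw [h.cubicForm_symm_left h₁ h₂ hu, h.cubicForm_symm h₁ h₂ hu]
  set e₀ : Plane := EuclideanSpace.single 0 1 with he₀
  set e₁ : Plane := EuclideanSpace.single 1 1 with he₁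
  -- The determinant of the induced metric is a multiple of this minor.
  have hn : coframeDet η₁ η₂ φ ψ u ≠ 0 := by
    intro h0
    apply hdet
    simp only [inducedDet, coframeDet, ← he₀, ← he₁] at h0 ⊢
    rw [pow_two]
    nth_rewrite 2 [hsymm e₀ e₁]
    simp only [hh]
    linear_combination (μ₁ (fderiv ℝ φ u e₁) * μ₂ (fderiv ℝ ψ u e₀) -
      μ₁ (fderiv ℝ φ u e₀) * μ₂ (fderiv ℝ ψ u e₁)) * h0
  refine ⟨hn, ?_⟩
  have hform : ∀ Y Z, ∃ L : Plane →L[ℝ] ℝ,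
      HasFDerivAt (fun v => inducedForm g₁ g₂ φ ψ v Y Z) L u ∧
      ∀ X, L X = (g₁ (φ u) (covariantHessian g₁ φ u X Y) (fderiv ℝ φ u Z) -
        g₂ (ψ u) (covariantHessian g₂ ψ u X Y) (fderiv ℝ ψ u Z)) +
        (g₁ (φ u) (covariantHessian g₁ φ u X Z) (fderiv ℝ φ u Y) -
        g₂ (ψ u) (covariantHessian g₂ ψ u X Z) (fderiv ℝ ψ u Y)) := fun Y Z => by
    obtain ⟨L, hL, hLX⟩ := hasFDerivAt_pullback_metric c₁ (h₁.differentiableAt m₁)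
      f₁.toIsMetricForm (h₁.fderiv_symm m₁) Y Z
    obtain ⟨M, hM, hMX⟩ := hasFDerivAt_pullback_metric c₂ (h₂.differentiableAt m₂)
      f₂.toIsMetricForm (h₂.fderiv_symm m₂) Y Z
    refine ⟨L - M, hL.sub hM, fun X => ?_⟩
    rw [sub_apply, hLX, hMX, f₁.symm (fderiv ℝ φ u Y), f₂.symm (fderiv ℝ ψ u Y)]
    ring
  obtain ⟨L₀₀, hL₀₀, hL₀₀'⟩ := hform e₀ e₀
  obtain ⟨L₀₁, hL₀₁, hL₀₁'⟩ := hform e₀ e₁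
  obtain ⟨L₁₁, hL₁₁, hL₁₁'⟩ := hform e₁ e₁
  obtain ⟨M₁₀, hM₁₀, hM₁₀'⟩ := exists_hasFDerivAt_pullback_coframe h₁ c₁ m₁ hη₁ hα₁ e₀
  obtain ⟨M₁₁, hM₁₁, hM₁₁'⟩ := exists_hasFDerivAt_pullback_coframe h₁ c₁ m₁ hη₁ hα₁ e₁
  obtain ⟨M₂₀, hM₂₀, hM₂₀'⟩ := exists_hasFDerivAt_pullback_coframe h₂ c₂ m₂ hη₂ hα₂ e₀
  obtain ⟨M₂₁, hM₂₁, hM₂₁'⟩ := exists_hasFDerivAt_pullback_coframe h₂ c₂ m₂ hη₂ hα₂ e₁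
  refine ⟨_, _, (hM₁₀.mul hM₂₁).sub (hM₁₁.mul hM₂₀), (hL₀₀.mul hL₁₁).sub (hL₀₁.pow 2),
    fun X => ?_⟩
  -- Half the derivative of det h along X is det h times the trace of G(D_X ∂_Y Φ, ∂_Z Φ), and the
  -- P's are the derivatives of the N's without their connection terms.
  have key := adjugate_trace_identity (hh e₀ e₀) (hh e₀ e₁) ((hsymm e₀ e₁).trans (hh e₁ e₀))
    (hh e₁ e₁) (hY X e₀ e₀) (hY X e₀ e₁) (hY X e₁ e₀) (hY X e₁ e₁)
    (by simpa only [adjugateTrace, smul_eq_mul] using hC X)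
  simp only [coframeDet, inducedDet, ← he₀, ← he₁, sub_apply, add_apply, smul_apply, smul_eq_mul,
    hL₀₀', hL₀₁', hL₁₁', hM₁₀', hM₁₁', hM₂₀', hM₂₁', nsmul_eq_mul]
  push_cast
  linear_combination 2 * key

/-- The Ricci form of `g₁ - g₂` vanishes along a minimal Lagrangian surface. -/
theorem IsMinimalLagrangianOn.ricci_form_eq_zero
    (h : IsMinimalLagrangianOn g₁ g₂ j₁ j₂ φ ψ W U₁ U₂) (h₁ : IsParaKahlerOn g₁ j₁ U₁)
    (h₂ : IsParaKahlerOn g₂ j₂ U₂) (hu : u ∈ W) (X Y : Plane) :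
    (planeCurvature g₁ (φ u) + planeCurvature g₂ (ψ u)) *
      g₁ (φ u) (j₁ (φ u) (fderiv ℝ φ u X)) (fderiv ℝ φ u Y) = 0 := by
  obtain ⟨V₁, hVU₁, hV₁, huV₁, η₁, α₁, hη₁, hα₁⟩ := exists_nullCoframe h₁ (h.mapsTo_fst hu)
  obtain ⟨V₂, hVU₂, hV₂, huV₂, η₂, α₂, hη₂, hα₂⟩ := exists_nullCoframe h₂ (h.mapsTo_snd hu)
  replace h₁ := h₁.mono hV₁ hVU₁
  replace h₂ := h₂.mono hV₂ hVU₂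
  let W' := W ∩ φ ⁻¹' V₁ ∩ (W ∩ ψ ⁻¹' V₂)
  have hW' : IsOpen W' := (h.smooth_fst.continuousOn.isOpen_inter_preimage h.isOpen hV₁).inter
    (h.smooth_snd.continuousOn.isOpen_inter_preimage h.isOpen hV₂)
  have hsub : W' ⊆ W := fun v hv => hv.1.1
  replace h : IsMinimalLagrangianOn g₁ g₂ j₁ j₂ φ ψ W' V₁ V₂ :=
    { isOpen := hW'
      smooth_fst := h.smooth_fst.mono hsub
      smooth_snd := h.smooth_snd.mono hsub
      mapsTo_fst := fun v hv => hv.1.2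
      mapsTo_snd := fun v hv => hv.2.2
      lagrangian := fun v hv => h.lagrangian v (hsub hv)
      nondegenerate := fun v hv => h.nondegenerate v (hsub hv)
      minimal := fun v hv => h.minimal v (hsub hv) }
  replace hu : u ∈ W' := ⟨⟨hu, huV₁⟩, hu, huV₂⟩
  -- The logarithm of |N| / √|det h|. `Real.log` has derivative 1/x on both sides of zero, so the
  -- signs of N and det h play no role.
  let ℓ : Plane → ℝ := fun v => Real.log (coframeDet η₁ η₂ φ ψ v) -
    (1 / 2) * Real.log (inducedDet g₁ g₂ φ ψ v)
  let β : Plane → Plane →L[ℝ] ℝ := pullbackForm φ α₁ + pullbackForm ψ α₂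
  have hℓ : ∀ v ∈ W', HasFDerivAt ℓ (β v) v := fun v hv => by
    obtain ⟨hn, n', d', hn', hd', hX⟩ := h.exists_hasFDerivAt_det h₁ h₂ hη₁ hα₁ hη₂ hα₂ hv
    have hd : inducedDet g₁ g₂ φ ψ v ≠ 0 := (h.nondegenerate v hv).det_ne_zero
    have hβ : β v = (coframeDet η₁ η₂ φ ψ v)⁻¹ • n' -
        (1 / 2 : ℝ) • ((inducedDet g₁ g₂ φ ψ v)⁻¹ • d') := by
      ext X
      have hX' := hX X
      simp only [β, Pi.add_apply, pullbackForm, add_apply, sub_apply, smul_apply, smul_eq_mul,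
        ContinuousLinearMap.comp_apply]
      field_simp
      linear_combination hX'
    rw [hβ]
    exact (hn'.log hn).sub ((hd'.log hd).const_mul (1 / 2 : ℝ))
  have a₁ : DifferentiableAt ℝ α₁ (φ u) :=
    (hα₁.smooth.contDiffAt (hV₁.mem_nhds huV₁)).differentiableAt (by simp)
  have a₂ : DifferentiableAt ℝ α₂ (ψ u) :=
    (hα₂.smooth.contDiffAt (hV₂.mem_nhds huV₂)).differentiableAt (by simp)
  have p₁ : DifferentiableAt ℝ (pullbackForm φ α₁) u :=
    ((contDiffOn_pullbackForm h.smooth_fst hW' h.mapsTo_fst hα₁.smooth).contDiffAt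
      (hW'.mem_nhds hu)).differentiableAt (by simp)
  have p₂ : DifferentiableAt ℝ (pullbackForm ψ α₂) u :=
    ((contDiffOn_pullbackForm h.smooth_snd hW' h.mapsTo_snd hα₂.smooth).contDiffAt
      (hW'.mem_nhds hu)).differentiableAt (by simp)
  -- As dℓ = β, the form β is closed. Once the second derivatives of φ and ψ cancel, this says that
  -- the pulled back curvature forms add up to zero.
  have hs := second_derivative_symmetric_of_eventually_of_real
    (Filter.mem_of_superset (hW'.mem_nhds hu) hℓ) (p₁.add p₂).hasFDerivAt X Y
  rw [fderiv_add p₁ p₂] at hs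
  simp only [add_apply, fderiv_pullbackForm (h.contDiffAt_fst hu) a₁,
    fderiv_pullbackForm (h.contDiffAt_snd hu) a₂] at hs
  rw [fderiv_fderiv_symm (h.contDiffAt_fst hu) X, fderiv_fderiv_symm (h.contDiffAt_snd hu) X] at hs
  have e₁ := extDeriv_connectionForm h₁ hη₁ hα₁ huV₁ (fderiv ℝ φ u X) (fderiv ℝ φ u Y)
  have e₂ := extDeriv_connectionForm h₂ hη₂ hα₂ huV₂ (fderiv ℝ ψ u X) (fderiv ℝ ψ u Y)
  rw [← h.lagrangian u hu] at e₂
  linear_combination e₁ + e₂ - hs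

end MinimalLagrangian

end LocalGeometry

namespace PseudoRiemannian

/-! ### Functoriality of pullbacks of bilinear fields. -/

section Pullback

variable {E : Type*} [NormedAddCommGroup E] [NormedSpace ℝ E]
  {H : Type*} [TopologicalSpace H] {I : ModelWithCorners ℝ E H}
  {M : Type*} [TopologicalSpace M] [ChartedSpace H M]
  {E' : Type*} [NormedAddCommGroup E'] [NormedSpace ℝ E']
  {H' : Type*} [TopologicalSpace H'] {J : ModelWithCorners ℝ E' H'}
  {N : Type*} [TopologicalSpace N] [ChartedSpace H' N]
  {E'' : Type*} [NormedAddCommGroup E''] [NormedSpace ℝ E'']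
  {H'' : Type*} [TopologicalSpace H''] {K : ModelWithCorners ℝ E'' H''}
  {P : Type*} [TopologicalSpace P] [ChartedSpace H'' P]

theorem pullback_congr (B : BilinField J N) {f f' : M → N} {x : M} (h : f =ᶠ[𝓝 x] f') :
    pullback (I := I) B f x = pullback B f' x := by
  have h1 : (mfderiv I J f x : E →L[ℝ] E') = mfderiv I J f' x := h.mfderiv_eq
  have h2 : ∀ y y' : N, y = y' → (B y : E' →L[ℝ] E' →L[ℝ] ℝ) = B y' := by rintro _ _ rfl; rfl
  have h3 := h2 _ _ h.eq_of_nhds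
  ext v w
  change (B (f x) : E' →L[ℝ] E' →L[ℝ] ℝ) ((mfderiv I J f x : E →L[ℝ] E') v)
    ((mfderiv I J f x : E →L[ℝ] E') w) = (B (f' x) : E' →L[ℝ] E' →L[ℝ] ℝ)
    ((mfderiv I J f' x : E →L[ℝ] E') v) ((mfderiv I J f' x : E →L[ℝ] E') w)
  rw [h1, h3]
  rfl

theorem pullback_comp (B : BilinField K P) {f : M → N} {h : N → P} {x : M}
    (hf : MDifferentiableAt I J f x) (hh : MDifferentiableAt J K h (f x)) :
    pullback (I := I) B (h ∘ f) x = pullback (pullback (I := J) B h) f x := by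
  ext v w
  rw [pullback_apply, mfderiv_comp x hh hf]
  rfl

end Pullback

/-! ### Bilinear fields in charts and changes of charts. -/

section Charts

variable {M : Type*} [TopologicalSpace M] [ChartedSpace Plane M] [IsManifold (𝓡 2) ∞ M]

instance isManifold_one : IsManifold (𝓡 2) 1 M := IsManifold.of_le (n := ∞) (by simp)

theorem isOpen_chart_target (x : M) : IsOpen (extChartAt (𝓡 2) x).target :=
  isOpen_extChartAt_target x

theorem contMDiffAt_chart_symm (x : M) {u : Plane} (hu : u ∈ (extChartAt (𝓡 2) x).target) :
    ContMDiffAt 𝓘(ℝ, Plane) (𝓡 2) ∞ (extChartAt (𝓡 2) x).symm u :=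
  (contMDiffOn_extChartAt_symm x).contMDiffAt ((isOpen_chart_target x).mem_nhds hu)

theorem contMDiffAt_chart (x : M) {y : M} (hy : y ∈ (extChartAt (𝓡 2) x).source) :
    ContMDiffAt (𝓡 2) 𝓘(ℝ, Plane) ∞ (extChartAt (𝓡 2) x) y :=
  contMDiffAt_extChartAt' (by simpa using hy)

theorem isInvertible_mfderiv_chart_symm (x : M) {u : Plane}
    (hu : u ∈ (extChartAt (𝓡 2) x).target) :
    (mfderiv 𝓘(ℝ, Plane) (𝓡 2) (extChartAt (𝓡 2) x).symm u).IsInvertible := by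
  have := isInvertible_mfderivWithin_extChartAt_symm (I := 𝓡 2) hu
  rwa [ModelWithCorners.range_eq_univ, mfderivWithin_univ] at this

theorem coordMetric_apply (B : BilinField (𝓡 2) M) (x : M) (u X Y : Plane) :
    coordMetric B x u X Y = B ((extChartAt (𝓡 2) x).symm u)
      (mfderiv 𝓘(ℝ, Plane) (𝓡 2) (extChartAt (𝓡 2) x).symm u X)
      (mfderiv 𝓘(ℝ, Plane) (𝓡 2) (extChartAt (𝓡 2) x).symm u Y) := rfl

theorem coordMetric_self (B : BilinField (𝓡 2) M) (x : M) (X Y : Plane) :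
    coordMetric B x (extChartAt (𝓡 2) x x) X Y = B x X Y := by
  have h1 := mfderivWithin_range_extChartAt_symm (I := 𝓡 2) (x := x)
  rw [ModelWithCorners.range_eq_univ, mfderivWithin_univ] at h1
  have h2 : ∀ y y' : M, y = y' → (B y : Plane →L[ℝ] Plane →L[ℝ] ℝ) = B y' := by
    rintro _ _ rfl; rfl
  rw [coordMetric_apply, h1]
  exact congrArg (fun b : Plane →L[ℝ] Plane →L[ℝ] ℝ => b X Y)
    (h2 _ _ ((extChartAt (𝓡 2) x).left_inv (mem_extChartAt_source x)))

/-- The change of coordinates between two charts. -/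
def transition (x y : M) : Plane → Plane := extChartAt (𝓡 2) y ∘ (extChartAt (𝓡 2) x).symm

/-- The domain of the change of coordinates. -/
def transitionDomain (x y : M) : Set Plane :=
  (extChartAt (𝓡 2) x).target ∩ (extChartAt (𝓡 2) x).symm ⁻¹' (extChartAt (𝓡 2) y).source

theorem isOpen_transitionDomain (x y : M) : IsOpen (transitionDomain x y) :=
  (continuousOn_extChartAt_symm x).isOpen_inter_preimage (isOpen_chart_target x)
    (isOpen_extChartAt_source y)

theorem contMDiffAt_transition (x y : M) {u : Plane} (hu : u ∈ transitionDomain x y) :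
    ContMDiffAt 𝓘(ℝ, Plane) 𝓘(ℝ, Plane) ∞ (transition x y) u :=
  (contMDiffAt_chart y hu.2).comp u (contMDiffAt_chart_symm x hu.1)

theorem contDiffOn_transition (x y : M) :
    ContDiffOn ℝ ∞ (transition x y) (transitionDomain x y) := fun _ hu =>
  (contMDiffAt_transition x y hu).contDiffAt.contDiffWithinAt

theorem mapsTo_transition (x y : M) :
    MapsTo (transition x y) (transitionDomain x y) (extChartAt (𝓡 2) y).target :=
  fun _ hu => (extChartAt (𝓡 2) y).map_source hu.2

theorem chart_symm_transition (x y : M) {u : Plane} (hu : u ∈ transitionDomain x y) :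
    (extChartAt (𝓡 2) y).symm (transition x y u) = (extChartAt (𝓡 2) x).symm u :=
  (extChartAt (𝓡 2) y).left_inv hu.2

theorem transition_mem (x y : M) {u : Plane} (hu : u ∈ transitionDomain x y) :
    transition x y u ∈ transitionDomain y x :=
  ⟨mapsTo_transition x y hu, by
    rw [mem_preimage, chart_symm_transition x y hu]
    exact (extChartAt (𝓡 2) x).map_target hu.1⟩

theorem transition_transition (x y : M) {u : Plane} (hu : u ∈ transitionDomain x y) :
    transition y x (transition x y u) = u := by
  change extChartAt (𝓡 2) x ((extChartAt (𝓡 2) y).symm (transition x y u)) = u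
  rw [chart_symm_transition x y hu]
  exact (extChartAt (𝓡 2) x).right_inv hu.1

theorem surjective_fderiv_transition (x y : M) {u : Plane} (hu : u ∈ transitionDomain x y) :
    Function.Surjective (fderiv ℝ (transition x y) u) := by
  have h1 : transition y x ∘ transition x y =ᶠ[𝓝 u] id :=
    Filter.mem_of_superset ((isOpen_transitionDomain x y).mem_nhds hu)
      fun v hv => transition_transition x y hv
  have d1 : DifferentiableAt ℝ (transition x y) u :=
    (contMDiffAt_transition x y hu).contDiffAt.differentiableAt (by simp)
  have d2 : DifferentiableAt ℝ (transition y x) (transition x y u) :=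
    (contMDiffAt_transition y x (transition_mem x y hu)).contDiffAt.differentiableAt (by simp)
  have h2 := h1.fderiv_eq (𝕜 := ℝ)
  rw [fderiv_comp u d2 d1, fderiv_id] at h2
  refine (LinearMap.injective_iff_surjective (f := (fderiv ℝ (transition x y) u).toLinearMap)).1 ?_
  intro X Y hXY
  have h3 : ∀ Z, fderiv ℝ (transition y x) (transition x y u) (fderiv ℝ (transition x y) u Z) = Z :=
    fun Z => congrArg (fun l : Plane →L[ℝ] Plane => l Z) h2
  rw [← h3 X, ← h3 Y]
  exact congrArg _ hXY

/-- The coordinate expressions of a field of bilinear forms in two charts. -/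
theorem coordMetric_transition (B : BilinField (𝓡 2) M) (x y : M) {u : Plane}
    (hu : u ∈ transitionDomain x y) (X Y : Plane) :
    coordMetric B x u X Y = coordMetric B y (transition x y u)
      (fderiv ℝ (transition x y) u X) (fderiv ℝ (transition x y) u Y) := by
  have h1 : (extChartAt (𝓡 2) x).symm =ᶠ[𝓝 u] (extChartAt (𝓡 2) y).symm ∘ transition x y :=
    Filter.mem_of_superset ((isOpen_transitionDomain x y).mem_nhds hu)
      fun v hv => (chart_symm_transition x y hv).symm
  have h2 : coordMetric B x u =
      pullback (I := 𝓘(ℝ, Plane)) (J := 𝓘(ℝ, Plane)) (M := Plane) (N := Plane) (coordMetric B y)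
        (transition x y) u := by
    have h3 := (contMDiffAt_transition x y hu).mdifferentiableAt (by simp)
    have h4 := (contMDiffAt_chart_symm y (mapsTo_transition x y hu)).mdifferentiableAt (by simp)
    exact (pullback_congr (I := 𝓘(ℝ, Plane)) (J := 𝓡 2) B h1).trans
      (pullback_comp (I := 𝓘(ℝ, Plane)) (J := 𝓘(ℝ, Plane)) (K := 𝓡 2) (N := Plane) B h3 h4)
  rw [h2, ← mfderiv_eq_fderiv]
  rfl

/-- Coordinate fields are the tangent map of the inverse chart applied to constant fields. -/
theorem contMDiffOn_chartField (x : M) (X : Plane) :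
    ContMDiffOn 𝓘(ℝ, Plane) (𝓡 2).tangent ∞ (fun u : Plane =>
      TotalSpace.mk' Plane (E := fun x : M => TangentSpace (𝓡 2) x) ((extChartAt (𝓡 2) x).symm u)
        (mfderiv 𝓘(ℝ, Plane) (𝓡 2) (extChartAt (𝓡 2) x).symm u X))
      (extChartAt (𝓡 2) x).target := by
  have h0 := isOpen_chart_target x
  have h1 := (contMDiffOn_extChartAt_symm (I := 𝓡 2) (n := ∞) x).contMDiffOn_tangentMapWithin
    (m := ∞) (by simp) h0.uniqueMDiffOn
  have h2 : ContMDiffOn 𝓘(ℝ, Plane) 𝓘(ℝ, Plane).tangent ∞ (fun u : Plane =>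
      (⟨u, X⟩ : TangentBundle 𝓘(ℝ, Plane) Plane)) (extChartAt (𝓡 2) x).target :=
    contMDiffOn_vectorSpace_iff_contDiffOn.2 contDiffOn_const
  refine (h1.comp h2 fun u hu => hu).congr fun u hu => ?_
  simp only [tangentMapWithin, Function.comp_apply, mfderivWithin_of_isOpen h0 hu]

end Charts

end PseudoRiemannian

/-! ### Coordinate expressions of a para-Kähler surface. -/

section Lorentz

variable {M : Type*} [TopologicalSpace M] [ChartedSpace Plane M] [IsManifold (𝓡 2) ∞ M]

open LocalGeometry

theorem LorentzMetric.contMDiffOn_apply (A : LorentzMetric M) (x : M)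
    {V W : ∀ u : Plane, TangentSpace (𝓡 2) ((extChartAt (𝓡 2) x).symm u)}
    (hV : ContMDiffOn 𝓘(ℝ, Plane) (𝓡 2).tangent ∞ (fun u : Plane =>
      TotalSpace.mk' Plane (E := fun x : M => TangentSpace (𝓡 2) x) ((extChartAt (𝓡 2) x).symm u)
        (V u)) (extChartAt (𝓡 2) x).target)
    (hW : ContMDiffOn 𝓘(ℝ, Plane) (𝓡 2).tangent ∞ (fun u : Plane =>
      TotalSpace.mk' Plane (E := fun x : M => TangentSpace (𝓡 2) x) ((extChartAt (𝓡 2) x).symm u)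
        (W u)) (extChartAt (𝓡 2) x).target) :
    ContDiffOn ℝ ∞ (fun u => A.metric ((extChartAt (𝓡 2) x).symm u) (V u) (W u))
      (extChartAt (𝓡 2) x).target := by
  rw [← contMDiffOn_iff_contDiffOn]
  have : ContMDiffOn 𝓘(ℝ, Plane) ((𝓡 2).prod 𝓘(ℝ)) ∞
      (fun m ↦ TotalSpace.mk' ℝ (E := Bundle.Trivial M ℝ) ((extChartAt (𝓡 2) x).symm m)
        (A.metric ((extChartAt (𝓡 2) x).symm m) (V m) (W m))) (extChartAt (𝓡 2) x).target := by
    apply ContMDiffOn.clm_bundle_apply₂ (F₁ := Plane) (F₂ := Plane)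
    · exact A.smooth.comp_contMDiffOn (contMDiffOn_extChartAt_symm x)
    · exact hV
    · exact hW
  intro u hu
  have h1 := this u hu
  simp only [contMDiffWithinAt_totalSpace] at h1
  exact h1.2

theorem LorentzMetric.contDiffOn_coordMetric (A : LorentzMetric M) (x : M) :
    ContDiffOn ℝ ∞ (coordMetric A.metric x) (extChartAt (𝓡 2) x).target := by
  rw [contDiffOn_clm_apply]
  intro X
  rw [contDiffOn_clm_apply]
  intro Y
  exact A.contMDiffOn_apply x (contMDiffOn_chartField x X) (contMDiffOn_chartField x Y)

theorem ParaKahlerSurface.contDiffOn_coordOmega (A : ParaKahlerSurface M) (x : M) :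
    ContDiffOn ℝ ∞ (coordMetric A.omega x) (extChartAt (𝓡 2) x).target := by
  rw [contDiffOn_clm_apply]
  intro X
  rw [contDiffOn_clm_apply]
  intro Y
  refine A.contMDiffOn_apply x (V := fun u => A.j _ (mfderiv 𝓘(ℝ, Plane) (𝓡 2)
    (extChartAt (𝓡 2) x).symm u X)) ?_ (contMDiffOn_chartField x Y)
  apply ContMDiffOn.clm_bundle_apply (F₁ := Plane) (F₂ := Plane)
  · exact A.j_smooth.comp_contMDiffOn (contMDiffOn_extChartAt_symm x)
  · exact contMDiffOn_chartField x X

/-- The paracomplex structure in the chart at `x`. -/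
def ParaKahlerSurface.coordJ (A : ParaKahlerSurface M) (x : M) (u : Plane) : Plane →L[ℝ] Plane :=
  (coordMetric A.metric x u).inverse ∘L coordMetric A.omega x u

theorem LorentzMetric.isMetricForm (A : LorentzMetric M) (x : M) {u : Plane}
    (hu : u ∈ (extChartAt (𝓡 2) x).target) : IsMetricForm (coordMetric A.metric x u) where
  symm X Y := A.symm ((extChartAt (𝓡 2) x).symm u)
    (mfderiv 𝓘(ℝ, Plane) (𝓡 2) (extChartAt (𝓡 2) x).symm u X)
    (mfderiv 𝓘(ℝ, Plane) (𝓡 2) (extChartAt (𝓡 2) x).symm u Y)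
  nondegenerate X hX := by
    have h := isInvertible_mfderiv_chart_symm x hu
    refine h.injective (Eq.trans ?_ (map_zero _).symm)
    refine A.nondegenerate _ _ fun w => ?_
    obtain ⟨Y, rfl⟩ := h.surjective w
    exact hX Y

/-- The coordinate structure was obtained by raising an index of ω, which makes its smoothness
immediate. Nondegeneracy of the metric shows that it is j itself read in the chart. -/
theorem ParaKahlerSurface.mfderiv_coordJ (A : ParaKahlerSurface M) (x : M) {u : Plane}
    (hu : u ∈ (extChartAt (𝓡 2) x).target) (X : Plane) :
    mfderiv 𝓘(ℝ, Plane) (𝓡 2) (extChartAt (𝓡 2) x).symm u (A.coordJ x u X) =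
      A.j _ (mfderiv 𝓘(ℝ, Plane) (𝓡 2) (extChartAt (𝓡 2) x).symm u X) := by
  obtain ⟨Z, hZ⟩ := (isInvertible_mfderiv_chart_symm x hu).surjective
    (A.j _ (mfderiv 𝓘(ℝ, Plane) (𝓡 2) (extChartAt (𝓡 2) x).symm u X))
  have hm := A.isMetricForm x hu
  suffices h : A.coordJ x u X = Z by rw [h, hZ]
  refine hm.ext_left fun W => ?_
  have h1 : coordMetric A.metric x u (A.coordJ x u X) W = coordMetric A.omega x u X W := by
    rw [ParaKahlerSurface.coordJ, ContinuousLinearMap.comp_apply,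
      hm.isInvertible.self_apply_inverse]
  have h2 : coordMetric A.omega x u X W = A.metric ((extChartAt (𝓡 2) x).symm u)
      (A.j _ (mfderiv 𝓘(ℝ, Plane) (𝓡 2) (extChartAt (𝓡 2) x).symm u X))
      (mfderiv 𝓘(ℝ, Plane) (𝓡 2) (extChartAt (𝓡 2) x).symm u W) := rfl
  rw [h1, h2, ← hZ]
  rfl

theorem ParaKahlerSurface.coordMetric_coordJ (A : ParaKahlerSurface M) (x : M) {u : Plane}
    (hu : u ∈ (extChartAt (𝓡 2) x).target) (X Y : Plane) :
    coordMetric A.metric x u (A.coordJ x u X) Y = coordMetric A.omega x u X Y := by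
  rw [ParaKahlerSurface.coordJ, ContinuousLinearMap.comp_apply,
    (A.isMetricForm x hu).isInvertible.self_apply_inverse]

theorem ParaKahlerSurface.isParaKahlerOn (A : ParaKahlerSurface M) (x : M) :
    IsParaKahlerOn (coordMetric A.metric x) (A.coordJ x) (extChartAt (𝓡 2) x).target where
  isOpen := isOpen_chart_target x
  smooth_metric := A.contDiffOn_coordMetric x
  smooth_j := by
    have h : ContDiffOn ℝ ∞ (fun u => (coordMetric A.metric x u).inverse)
        (extChartAt (𝓡 2) x).target := fun u hu =>
      (A.isMetricForm x hu).isInvertible.contDiffAt_map_inverse.comp_contDiffWithinAt u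
        (A.contDiffOn_coordMetric x u hu)
    exact h.clm_comp (A.contDiffOn_coordOmega x)
  form u hu :=
    { toIsMetricForm := A.isMetricForm x hu
      j_sq := fun X => by
        refine (isInvertible_mfderiv_chart_symm x hu).injective ?_
        rw [A.mfderiv_coordJ x hu, A.mfderiv_coordJ x hu, A.j_sq]
      j_metric := fun X Y => by
        rw [coordMetric_apply, A.mfderiv_coordJ x hu, A.mfderiv_coordJ x hu, A.j_metric]
        rfl }

theorem ParaKahlerSurface.isParaKahlerMapOn_transition (A : ParaKahlerSurface M) (x y : M) :
    IsParaKahlerMapOn (coordMetric A.metric x) (A.coordJ x) (coordMetric A.metric y) (A.coordJ y)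
      (transition x y) (transitionDomain x y) (extChartAt (𝓡 2) y).target where
  smooth := contDiffOn_transition x y
  mapsTo := mapsTo_transition x y
  surjective v hv := surjective_fderiv_transition x y hv
  metric v hv X Y := coordMetric_transition A.metric x y hv X Y
  map_j v hv X := by
    refine (A.isMetricForm y (mapsTo_transition x y hv)).ext_left fun Z => ?_
    obtain ⟨Y, rfl⟩ := surjective_fderiv_transition x y hv Z
    rw [← coordMetric_transition A.metric x y hv, A.coordMetric_coordJ x hv.1,
      A.coordMetric_coordJ y (mapsTo_transition x y hv), coordMetric_transition A.omega x y hv]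

theorem ParaKahlerSurface.gaussCurvature_eq (A : ParaKahlerSurface M) (x : M) :
    gaussCurvature A.metric x = planeCurvature (coordMetric A.metric x) (extChartAt (𝓡 2) x x) := by
  simp only [planeCurvature, coordMetric_self]
  rfl

/-- The curvature at y is defined in the chart at y, which varies with y. Invariance under
transition maps replaces it by the curvature in one fixed chart, where continuity is known. -/
theorem ParaKahlerSurface.continuous_gaussCurvature (A : ParaKahlerSurface M) :
    Continuous (gaussCurvature A.metric) := by
  rw [continuous_iff_continuousAt]
  intro x
  have hx : extChartAt (𝓡 2) x x ∈ (extChartAt (𝓡 2) x).target := mem_extChartAt_target x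
  obtain ⟨V, hVU, hV, hxV, η, α, hη, hα⟩ := exists_nullCoframe (A.isParaKahlerOn x) hx
  have h1 : ContinuousAt (fun y => planeCurvature (coordMetric A.metric x) (extChartAt (𝓡 2) x y))
      x := ContinuousAt.comp (f := extChartAt (𝓡 2) x)
    ((A.isParaKahlerOn x).continuousAt_planeCurvature hx) (continuousAt_extChartAt x)
  refine h1.congr ?_
  have h2 : ∀ᶠ y in 𝓝 x, extChartAt (𝓡 2) x y ∈ V :=
    (continuousAt_extChartAt x).eventually (hV.mem_nhds hxV)
  filter_upwards [h2, extChartAt_source_mem_nhds (I := 𝓡 2) x] with y hyV hy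
  have hyd : extChartAt (𝓡 2) y y ∈ transitionDomain y x :=
    ⟨mem_extChartAt_target y, by simpa using hy⟩
  have ht : transition y x (extChartAt (𝓡 2) y y) = extChartAt (𝓡 2) x y := by
    simp [transition]
  -- Invariance is proved through a null coframe on the whole target, which exists only on V; the
  -- transition map is restricted accordingly.
  let D := transitionDomain y x ∩ transition y x ⁻¹' V
  have hD : IsOpen D := (contDiffOn_transition y x).continuousOn.isOpen_inter_preimage
    (isOpen_transitionDomain y x) hV
  have hm := A.isParaKahlerMapOn_transition y x
  have hm' : IsParaKahlerMapOn (coordMetric A.metric y) (A.coordJ y) (coordMetric A.metric x)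
      (A.coordJ x) (transition y x) D V :=
    { smooth := hm.smooth.mono inter_subset_left
      mapsTo := fun v hv => hv.2
      surjective := fun v hv => hm.surjective v hv.1
      metric := fun v hv => hm.metric v hv.1
      map_j := fun v hv => hm.map_j v hv.1 }
  rw [A.gaussCurvature_eq y, hm'.planeCurvature_eq
    ((A.isParaKahlerOn y).mono hD fun v hv => hv.1.1) ((A.isParaKahlerOn x).mono hV hVU) hη hα
    ⟨hyd, by rw [mem_preimage, ht]; exact hyV⟩, ht]

end Lorentz

namespace LocalGeometry

/-! ### Connections of difference metrics on products. -/

section Product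

variable {E₁ : Type*} [NormedAddCommGroup E₁] [NormedSpace ℝ E₁] [FiniteDimensional ℝ E₁]
  {E₂ : Type*} [NormedAddCommGroup E₂] [NormedSpace ℝ E₂] [FiniteDimensional ℝ E₂]

theorem IsMetricForm.prod {b₁ : E₁ →L[ℝ] E₁ →L[ℝ] ℝ} {b₂ : E₂ →L[ℝ] E₂ →L[ℝ] ℝ}
    {b : E₁ × E₂ →L[ℝ] E₁ × E₂ →L[ℝ] ℝ} (h₁ : IsMetricForm b₁) (h₂ : IsMetricForm b₂)
    (h : ∀ X Y, b X Y = b₁ X.1 Y.1 - b₂ X.2 Y.2) : IsMetricForm b where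
  symm X Y := by rw [h, h, h₁.symm, h₂.symm]
  nondegenerate X hX := by
    refine Prod.ext (h₁.nondegenerate _ fun Y => ?_) (h₂.nondegenerate _ fun Y => ?_)
    · simpa [h] using hX (Y, 0)
    · simpa [h] using hX (0, Y)

/-- The Christoffel symbols of a difference metric on a product. -/
theorem christoffelSymbol_prod {g₁ : E₁ → E₁ →L[ℝ] E₁ →L[ℝ] ℝ} {g₂ : E₂ → E₂ →L[ℝ] E₂ →L[ℝ] ℝ}
    {g : E₁ × E₂ → E₁ × E₂ →L[ℝ] E₁ × E₂ →L[ℝ] ℝ} {u : E₁ × E₂}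
    (h : ∀ᶠ v in 𝓝 u, ∀ X Y, g v X Y = g₁ v.1 X.1 Y.1 - g₂ v.2 X.2 Y.2)
    (hd : DifferentiableAt ℝ g u) (d₁ : DifferentiableAt ℝ g₁ u.1) (d₂ : DifferentiableAt ℝ g₂ u.2)
    (h₁ : IsMetricForm (g₁ u.1)) (h₂ : IsMetricForm (g₂ u.2))
    (s₁ : ∀ X Y Z, fderiv ℝ g₁ u.1 X Y Z = fderiv ℝ g₁ u.1 X Z Y)
    (s₂ : ∀ X Y Z, fderiv ℝ g₂ u.2 X Y Z = fderiv ℝ g₂ u.2 X Z Y) (X Y : E₁ × E₂) :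
    christoffelSymbol g u X Y =
      (christoffelSymbol g₁ u.1 X.1 Y.1, christoffelSymbol g₂ u.2 X.2 Y.2) := by
  symm
  refine eq_christoffelSymbol (g := g) (u := u)
    (B := fun X Y => (christoffelSymbol g₁ u.1 X.1 Y.1, christoffelSymbol g₂ u.2 X.2 Y.2))
    (h₁.prod h₂ h.self_of_nhds) (fun X Y => ?_) (fun X Y Z => ?_) X Y
  · simp only [christoffelSymbol_symm h₁ s₁ X.1, christoffelSymbol_symm h₂ s₂ X.2]
  · obtain ⟨L, hL, hLX⟩ := exists_hasFDerivAt_bilinear_const hd Y Z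
    obtain ⟨L₁, hL₁, hLX₁⟩ := exists_hasFDerivAt_bilinear (f := Prod.fst) (u := u) d₁
      hasFDerivAt_fst (hasFDerivAt_const Y.1 u) (hasFDerivAt_const Z.1 u)
    obtain ⟨L₂, hL₂, hLX₂⟩ := exists_hasFDerivAt_bilinear (f := Prod.snd) (u := u) d₂
      hasFDerivAt_snd (hasFDerivAt_const Y.2 u) (hasFDerivAt_const Z.2 u)
    rw [← hLX, hL.unique ((hL₁.sub hL₂).congr_of_eventuallyEq (h.mono fun v hv => hv Y Z)),
      sub_apply, hLX₁, hLX₂, h.self_of_nhds, h.self_of_nhds, ContinuousLinearMap.coe_fst',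
      ContinuousLinearMap.coe_snd', fderiv_metric h₁ s₁, fderiv_metric h₂ s₂]
    simp
    ring

theorem fderiv_fderiv_prodMk {E : Type*} [NormedAddCommGroup E] [NormedSpace ℝ E]
    [FiniteDimensional ℝ E]
    {a : E → E₁} {b : E → E₂} {u : E} (ha : ContDiffAt ℝ 2 a u) (hb : ContDiffAt ℝ 2 b u)
    (X Y : E) : fderiv ℝ (fderiv ℝ fun v => (a v, b v)) u X Y =
      (fderiv ℝ (fderiv ℝ a) u X Y, fderiv ℝ (fderiv ℝ b) u X Y) := by
  have h1 := hasFDerivAt_fderiv_apply (ha.prodMk hb) Y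
  have h2 := (hasFDerivAt_fderiv_apply ha Y).prodMk (hasFDerivAt_fderiv_apply hb Y)
  have h3 : (fun v => fderiv ℝ (fun v => (a v, b v)) v Y) =ᶠ[𝓝 u]
      fun v => (fderiv ℝ a v Y, fderiv ℝ b v Y) := by
    filter_upwards [ha.eventually (by simp), hb.eventually (by simp)] with v hv hv'
    rw [(hv.differentiableAt (by norm_num)).fderiv_prodMk (hv'.differentiableAt (by norm_num))]
    rfl
  exact congrArg (fun l : E →L[ℝ] E₁ × E₂ => l X) (h1.unique (h2.congr_of_eventuallyEq h3))

end Product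

/-! ### Traces of second covariant derivatives and tangency. -/

section Trace

/-- This trace carries the factor det h, which scales by the squared determinant of A, while the
trace proper is invariant. The identity is polynomial, so A need not be invertible. -/
theorem adjugateTrace_comp {F : Type*} [AddCommGroup F] [Module ℝ F]
    (h : Plane →L[ℝ] Plane →L[ℝ] ℝ) (hs : ∀ X Y, h X Y = h Y X) (b : Plane →ₗ[ℝ] Plane →ₗ[ℝ] F)
    (A : Plane →L[ℝ] Plane) :
    adjugateTrace (fun X Y => h (A X) (A Y)) (fun X Y => b (A X) (A Y))
      (EuclideanSpace.single 0 1) (EuclideanSpace.single 1 1) =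
    (A (EuclideanSpace.single 0 1) 0 * A (EuclideanSpace.single 1 1) 1 -
      A (EuclideanSpace.single 0 1) 1 * A (EuclideanSpace.single 1 1) 0) ^ 2 •
      adjugateTrace (fun X Y => h X Y) (fun X Y => b X Y)
        (EuclideanSpace.single 0 1) (EuclideanSpace.single 1 1) := by
  set V := A (EuclideanSpace.single 0 1)
  set W := A (EuclideanSpace.single 1 1)
  simp only [adjugateTrace]
  change h W W • b V V - h V W • (b V W + b W V) + h V V • b W W = _
  rw [plane_eq V, plane_eq W]
  set e₀ : Plane := EuclideanSpace.single 0 1 with he₀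
  set e₁ : Plane := EuclideanSpace.single 1 1 with he₁
  simp only [map_add, map_smul, add_apply, smul_apply, LinearMap.add_apply, LinearMap.smul_apply,
    smul_eq_mul, hs e₁ e₀]
  simp [he₀, he₁]
  module

variable {g₁ g₂ g₁' g₂' : Plane → Plane →L[ℝ] Plane →L[ℝ] ℝ} {j₁ j₂ j₁' j₂' : Plane → Plane →L[ℝ] Plane}
  {φ ψ : Plane → Plane} {u : Plane}

/-- The second covariant derivative as a bilinear map. -/
def covariantHessianₗ (g : Plane → Plane →L[ℝ] Plane →L[ℝ] ℝ) (f : Plane → Plane) (u : Plane) :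
    Plane →ₗ[ℝ] Plane →ₗ[ℝ] Plane :=
  LinearMap.mk₂ ℝ (covariantHessian g f u)
    (fun X X' Y => by simp only [covariantHessian, map_add, add_apply, LinearMap.add_apply]; abel)
    (fun c X Y => by
      simp only [covariantHessian, map_smul, smul_apply, LinearMap.smul_apply, smul_add])
    (fun X Y Y' => by simp only [covariantHessian, map_add]; abel)
    (fun c X Y => by simp only [covariantHessian, map_smul, smul_add])

/-- The trace of the second covariant derivative of `(φ, ψ)` with respect to the metric induced
from `g₁ - g₂` is tangent: the mean curvature vector vanishes. -/
def IsTraceTangent (g₁ g₂ : Plane → Plane →L[ℝ] Plane →L[ℝ] ℝ) (φ ψ : Plane → Plane)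
    (u : Plane) : Prop :=
  ∃ v, adjugateTrace (fun X Y => inducedForm g₁ g₂ φ ψ u X Y) (covariantHessian g₁ φ u)
      (EuclideanSpace.single 0 1) (EuclideanSpace.single 1 1) = fderiv ℝ φ u v ∧
    adjugateTrace (fun X Y => inducedForm g₁ g₂ φ ψ u X Y) (covariantHessian g₂ ψ u)
      (EuclideanSpace.single 0 1) (EuclideanSpace.single 1 1) = fderiv ℝ ψ u v

theorem IsTraceTangent.congr {φ' ψ' : Plane → Plane} (h : IsTraceTangent g₁ g₂ φ ψ u)
    (hφ : φ' =ᶠ[𝓝 u] φ) (hψ : ψ' =ᶠ[𝓝 u] ψ) : IsTraceTangent g₁ g₂ φ' ψ' u := by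
  have h1 : fderiv ℝ φ' u = fderiv ℝ φ u := hφ.fderiv_eq
  have h2 : fderiv ℝ ψ' u = fderiv ℝ ψ u := hψ.fderiv_eq
  have h3 : fderiv ℝ (fderiv ℝ φ') u = fderiv ℝ (fderiv ℝ φ) u := hφ.fderiv.fderiv_eq
  have h4 : fderiv ℝ (fderiv ℝ ψ') u = fderiv ℝ (fderiv ℝ ψ) u := hψ.fderiv.fderiv_eq
  simpa only [IsTraceTangent, inducedForm, covariantHessian, funext_iff, h1, h2, h3, h4,
    hφ.eq_of_nhds, hψ.eq_of_nhds, adjugateTrace] using h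

/-- A change of coordinates on the surface rescales the trace and adds the image under the
differential of a trace of D²σ, which is tangent. -/
theorem IsTraceTangent.comp_right {σ : Plane → Plane} (h : IsTraceTangent g₁ g₂ φ ψ (σ u))
    (h₁ : ∀ X Y, g₁ (φ (σ u)) X Y = g₁ (φ (σ u)) Y X)
    (h₂ : ∀ X Y, g₂ (ψ (σ u)) X Y = g₂ (ψ (σ u)) Y X)
    (hφ : ContDiffAt ℝ 2 φ (σ u)) (hψ : ContDiffAt ℝ 2 ψ (σ u)) (hσ : ContDiffAt ℝ 2 σ u)
    (hi : Function.Surjective (fderiv ℝ σ u)) : IsTraceTangent g₁ g₂ (φ ∘ σ) (ψ ∘ σ) u := by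
  obtain ⟨v, hv₁, hv₂⟩ := h
  have hd : ∀ {f : Plane → Plane}, ContDiffAt ℝ 2 f (σ u) → ∀ X, fderiv ℝ (f ∘ σ) u X =
      fderiv ℝ f (σ u) (fderiv ℝ σ u X) := fun hf X => by
    rw [fderiv_comp u (hf.differentiableAt (by norm_num)) (hσ.differentiableAt (by norm_num))]
    rfl
  have hI : (fun X Y => inducedForm g₁ g₂ (φ ∘ σ) (ψ ∘ σ) u X Y) = fun X Y =>
      inducedForm g₁ g₂ φ ψ (σ u) (fderiv ℝ σ u X) (fderiv ℝ σ u Y) := by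
    funext X Y
    rw [inducedForm_apply, inducedForm_apply, hd hφ, hd hφ, hd hψ, hd hψ]
    rfl
  have hs : ∀ X Y, inducedForm g₁ g₂ φ ψ (σ u) X Y = inducedForm g₁ g₂ φ ψ (σ u) Y X :=
    fun X Y => by rw [inducedForm_apply, inducedForm_apply, h₁, h₂]
  set D := fderiv ℝ σ u
  set c : ℝ := (D (EuclideanSpace.single 0 1) 0 * D (EuclideanSpace.single 1 1) 1 -
      D (EuclideanSpace.single 0 1) 1 * D (EuclideanSpace.single 1 1) 0) ^ 2
  -- The tangential correction: the trace of the second derivative of the coordinate change. One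
  -- tangent vector z must serve both components.
  set w : Plane := adjugateTrace (fun X Y => inducedForm g₁ g₂ φ ψ (σ u) (D X) (D Y))
    (fun X Y => fderiv ℝ (fderiv ℝ σ) u X Y) (EuclideanSpace.single 0 1)
    (EuclideanSpace.single 1 1) with hw
  have key : ∀ (g : Plane → Plane →L[ℝ] Plane →L[ℝ] ℝ) (f : Plane → Plane),
      ContDiffAt ℝ 2 f (σ u) → adjugateTrace (fun X Y => inducedForm g₁ g₂ φ ψ (σ u) X Y)
      (covariantHessian g f (σ u)) (EuclideanSpace.single 0 1) (EuclideanSpace.single 1 1) =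
        fderiv ℝ f (σ u) v → ∀ z, D z = c • v + w →
      adjugateTrace (fun X Y => inducedForm g₁ g₂ φ ψ (σ u) (D X) (D Y))
      (covariantHessian g (f ∘ σ) u) (EuclideanSpace.single 0 1) (EuclideanSpace.single 1 1) =
        fderiv ℝ (f ∘ σ) u z := by
    intro g f hf h z hz
    have h1 := adjugateTrace_comp (inducedForm g₁ g₂ φ ψ (σ u)) hs (covariantHessianₗ g f (σ u)) D
    have h2 := h1.trans (congrArg (c • ·) h)
    rw [hd hf, hz, map_add, map_smul, ← h2, hw]
    simp only [adjugateTrace, covariantHessian_comp_right hf hσ, map_add, map_sub, map_smul]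
    change _ = _ • covariantHessian g f (σ u) _ _ - _ • (covariantHessian g f (σ u) _ _ +
      covariantHessian g f (σ u) _ _) + _ • covariantHessian g f (σ u) _ _ + _
    module
  obtain ⟨z, hz⟩ := hi (c • v + w)
  refine ⟨z, ?_, ?_⟩
  · rw [hI]
    exact key g₁ φ hφ hv₁ z hz
  · rw [hI]
    exact key g₂ ψ hψ hv₂ z hz

/-- Isometries of the factors preserve the induced metric and carry second covariant derivatives to
second covariant derivatives, so the same tangent vector works. -/
theorem IsTraceTangent.comp_left {τ₁ τ₂ : Plane → Plane} {V₁ V₂ U₁ U₂ : Set Plane}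
    (h : IsTraceTangent g₁' g₂' φ ψ u)
    (hτ₁ : IsParaKahlerMapOn g₁' j₁' g₁ j₁ τ₁ V₁ U₁) (hτ₂ : IsParaKahlerMapOn g₂' j₂' g₂ j₂ τ₂ V₂ U₂)
    (hV₁ : IsParaKahlerOn g₁' j₁' V₁) (hV₂ : IsParaKahlerOn g₂' j₂' V₂)
    (hU₁ : IsParaKahlerOn g₁ j₁ U₁) (hU₂ : IsParaKahlerOn g₂ j₂ U₂)
    (hφ : ContDiffAt ℝ 2 φ u) (hψ : ContDiffAt ℝ 2 ψ u) (hu₁ : φ u ∈ V₁) (hu₂ : ψ u ∈ V₂) :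
    IsTraceTangent g₁ g₂ (τ₁ ∘ φ) (τ₂ ∘ ψ) u := by
  obtain ⟨v, hv₁, hv₂⟩ := h
  have t₁ := (hτ₁.contDiffAt hV₁.isOpen hu₁)
  have t₂ := (hτ₂.contDiffAt hV₂.isOpen hu₂)
  have d₁ : ∀ X, fderiv ℝ (τ₁ ∘ φ) u X = fderiv ℝ τ₁ (φ u) (fderiv ℝ φ u X) := fun X => by
    rw [fderiv_comp u (t₁.differentiableAt (by norm_num)) (hφ.differentiableAt (by norm_num))]
    rfl
  have d₂ : ∀ X, fderiv ℝ (τ₂ ∘ ψ) u X = fderiv ℝ τ₂ (ψ u) (fderiv ℝ ψ u X) := fun X => by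
    rw [fderiv_comp u (t₂.differentiableAt (by norm_num)) (hψ.differentiableAt (by norm_num))]
    rfl
  have hI : (fun X Y => inducedForm g₁ g₂ (τ₁ ∘ φ) (τ₂ ∘ ψ) u X Y) =
      fun X Y => inducedForm g₁' g₂' φ ψ u X Y := by
    funext X Y
    rw [inducedForm_apply, inducedForm_apply, d₁, d₁, d₂, d₂, hτ₁.metric _ hu₁, hτ₂.metric _ hu₂]
    rfl
  have m₁ := hτ₁.mapsTo hu₁
  have m₂ := hτ₂.mapsTo hu₂
  have c₁ : ∀ X Y, covariantHessian g₁ (τ₁ ∘ φ) u X Y =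
      fderiv ℝ τ₁ (φ u) (covariantHessian g₁' φ u X Y) :=
    covariantHessian_comp_left hφ t₁ (hτ₁.surjective _ hu₁) (hU₁.differentiableAt m₁)
      (hU₁.form _ m₁).toIsMetricForm (hU₁.fderiv_symm m₁)
      (Filter.mem_of_superset (hV₁.isOpen.mem_nhds hu₁) fun v hv => hτ₁.metric v hv)
      (hV₁.differentiableAt hu₁)
  have c₂ : ∀ X Y, covariantHessian g₂ (τ₂ ∘ ψ) u X Y =
      fderiv ℝ τ₂ (ψ u) (covariantHessian g₂' ψ u X Y) :=
    covariantHessian_comp_left hψ t₂ (hτ₂.surjective _ hu₂) (hU₂.differentiableAt m₂)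
      (hU₂.form _ m₂).toIsMetricForm (hU₂.fderiv_symm m₂)
      (Filter.mem_of_superset (hV₂.isOpen.mem_nhds hu₂) fun v hv => hτ₂.metric v hv)
      (hV₂.differentiableAt hu₂)
  refine ⟨v, ?_, ?_⟩
  · rw [hI, d₁, ← hv₁]
    simp only [adjugateTrace, c₁, map_add, map_sub, map_smul]
  · rw [hI, d₂, ← hv₂]
    simp only [adjugateTrace, c₂, map_add, map_sub, map_smul]

/-- A Lagrangian surface with vanishing mean curvature has a trace-free cubic form. -/
theorem IsTraceTangent.adjugateTrace_cubicForm (h : IsTraceTangent g₁ g₂ φ ψ u)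
    (h₁ : IsParaKahlerForm (g₁ (φ u)) (j₁ (φ u))) (h₂ : IsParaKahlerForm (g₂ (ψ u)) (j₂ (ψ u)))
    (hL : ∀ X Y, g₁ (φ u) (j₁ (φ u) (fderiv ℝ φ u X)) (fderiv ℝ φ u Y) =
      g₂ (ψ u) (j₂ (ψ u) (fderiv ℝ ψ u X)) (fderiv ℝ ψ u Y)) (Z : Plane) :
    adjugateTrace (fun X Y => inducedForm g₁ g₂ φ ψ u X Y)
      (fun X Y => cubicForm g₁ g₂ j₁ j₂ φ ψ u X Y Z)
      (EuclideanSpace.single 0 1) (EuclideanSpace.single 1 1) = 0 := by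
  obtain ⟨v, hv₁, hv₂⟩ := h
  have h3 := congrArg (fun x => g₁ (φ u) x (j₁ (φ u) (fderiv ℝ φ u Z))) hv₁
  have h4 := congrArg (fun x => g₂ (ψ u) x (j₂ (ψ u) (fderiv ℝ ψ u Z))) hv₂
  -- The tangent vector v contributes G(dΦ v, J dΦ Z), which is zero on a Lagrangian surface.
  have h5 := hL Z v
  rw [h₁.symm, h₂.symm] at h5
  simp only [adjugateTrace, map_add, map_sub, map_smul, add_apply, sub_apply, smul_apply,
    smul_eq_mul] at h3 h4
  simp only [adjugateTrace, cubicForm, smul_eq_mul]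
  linear_combination h3 - h4 + h5

end Trace

end LocalGeometry

namespace PseudoRiemannian

/-! ### Maps between surfaces in charts. -/

section CoordinateMaps

variable {S : Type*} [TopologicalSpace S] [ChartedSpace Plane S] [IsManifold (𝓡 2) ∞ S]
  {M : Type*} [TopologicalSpace M] [ChartedSpace Plane M] [IsManifold (𝓡 2) ∞ M]
  {f : S → M}

/-- The coordinate points at which the expression of `f` in the charts at `p` and `f p` is
meaningful. -/
def coordDomain (f : S → M) (p : S) : Set Plane :=
  (extChartAt (𝓡 2) p).target ∩
    (f ∘ (extChartAt (𝓡 2) p).symm) ⁻¹' (extChartAt (𝓡 2) (f p)).source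

theorem isOpen_coordDomain (hf : Continuous f) (p : S) : IsOpen (coordDomain f p) :=
  (hf.comp_continuousOn (continuousOn_extChartAt_symm p)).isOpen_inter_preimage
    (isOpen_chart_target p) (isOpen_extChartAt_source (f p))

theorem chart_mem_coordDomain (f : S → M) (p : S) : extChartAt (𝓡 2) p p ∈ coordDomain f p :=
  ⟨mem_extChartAt_target p, by simp⟩

theorem mapsTo_writtenInExtChartAt (f : S → M) (p : S) :
    MapsTo (writtenInExtChartAt (𝓡 2) (𝓡 2) p f) (coordDomain f p)
      (extChartAt (𝓡 2) (f p)).target := fun _ hu => (extChartAt (𝓡 2) (f p)).map_source hu.2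

theorem contMDiffAt_writtenInExtChartAt (hf : ContMDiff (𝓡 2) (𝓡 2) ∞ f) (p : S) {u : Plane}
    (hu : u ∈ coordDomain f p) :
    ContMDiffAt 𝓘(ℝ, Plane) 𝓘(ℝ, Plane) ∞ (writtenInExtChartAt (𝓡 2) (𝓡 2) p f) u :=
  (contMDiffAt_chart (f p) hu.2).comp u
    ((hf _).comp u (contMDiffAt_chart_symm p hu.1))

theorem contDiffAt_writtenInExtChartAt (hf : ContMDiff (𝓡 2) (𝓡 2) ∞ f) (p : S) {u : Plane}
    (hu : u ∈ coordDomain f p) : ContDiffAt ℝ ∞ (writtenInExtChartAt (𝓡 2) (𝓡 2) p f) u :=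
  (contMDiffAt_writtenInExtChartAt hf p hu).contDiffAt

theorem chart_symm_writtenInExtChartAt (f : S → M) (p : S) {u : Plane}
    (hu : u ∈ coordDomain f p) :
    (extChartAt (𝓡 2) (f p)).symm (writtenInExtChartAt (𝓡 2) (𝓡 2) p f u) =
      f ((extChartAt (𝓡 2) p).symm u) :=
  (extChartAt (𝓡 2) (f p)).left_inv hu.2

theorem writtenInExtChartAt_self (f : S → M) (p : S) :
    writtenInExtChartAt (𝓡 2) (𝓡 2) p f (extChartAt (𝓡 2) p p) = extChartAt (𝓡 2) (f p) (f p) := by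
  simp [writtenInExtChartAt]

theorem mem_transitionDomain_symm (p : S) {u : Plane} (hu : u ∈ (extChartAt (𝓡 2) p).target) :
    u ∈ transitionDomain p ((extChartAt (𝓡 2) p).symm u) := ⟨hu, mem_extChartAt_source _⟩

theorem chart_mem_transitionDomain {x y : M} (hy : y ∈ (extChartAt (𝓡 2) x).source) :
    extChartAt (𝓡 2) y y ∈ transitionDomain y x :=
  ⟨mem_extChartAt_target y, by simpa using hy⟩

/-- Mean curvature at q is defined in the charts centred at q and Φ(q). This relation permits
passing to the charts of a fixed point p. -/
theorem writtenInExtChartAt_eventuallyEq (hf : Continuous f) (p : S) {u : Plane}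
    (hu : u ∈ coordDomain f p) {q : S} (hq : q = (extChartAt (𝓡 2) p).symm u) :
    writtenInExtChartAt (𝓡 2) (𝓡 2) p f =ᶠ[𝓝 u]
      transition (f q) (f p) ∘ writtenInExtChartAt (𝓡 2) (𝓡 2) q f ∘ transition p q := by
  have h1 : u ∈ transitionDomain p q := by subst hq; exact mem_transitionDomain_symm p hu.1
  have h2 : ∀ᶠ v in 𝓝 u, f ((extChartAt (𝓡 2) p).symm v) ∈ (extChartAt (𝓡 2) (f q)).source := by
    have h3 : ContinuousAt (f ∘ (extChartAt (𝓡 2) p).symm) u :=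
      hf.continuousAt.comp (contMDiffAt_chart_symm p hu.1).continuousAt
    refine h3.eventually ((isOpen_extChartAt_source (f q)).mem_nhds ?_)
    subst hq
    exact mem_extChartAt_source _
  filter_upwards [h2, (isOpen_transitionDomain p q).mem_nhds h1] with v hv hv'
  simp only [Function.comp_apply, writtenInExtChartAt, chart_symm_transition p q hv']
  simp only [transition, Function.comp_apply]
  rw [(extChartAt (𝓡 2) (f q)).left_inv hv]

theorem coordMetric_pullback (hf : ContMDiff (𝓡 2) (𝓡 2) ∞ f) (B : BilinField (𝓡 2) M) (p : S)
    {u : Plane} (hu : u ∈ coordDomain f p) (X Y : Plane) :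
    coordMetric (pullback (I := 𝓡 2) B f) p u X Y =
      coordMetric B (f p) (writtenInExtChartAt (𝓡 2) (𝓡 2) p f u)
        (fderiv ℝ (writtenInExtChartAt (𝓡 2) (𝓡 2) p f) u X)
        (fderiv ℝ (writtenInExtChartAt (𝓡 2) (𝓡 2) p f) u Y) := by
  have h1 : f ∘ (extChartAt (𝓡 2) p).symm =ᶠ[𝓝 u]
      (extChartAt (𝓡 2) (f p)).symm ∘ writtenInExtChartAt (𝓡 2) (𝓡 2) p f :=
    Filter.mem_of_superset ((isOpen_coordDomain hf.continuous p).mem_nhds hu)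
      fun v hv => (chart_symm_writtenInExtChartAt f p hv).symm
  have h2 : coordMetric (pullback (I := 𝓡 2) B f) p u =
      pullback (I := 𝓘(ℝ, Plane)) (J := 𝓘(ℝ, Plane)) (M := Plane) (N := Plane)
        (coordMetric B (f p)) (writtenInExtChartAt (𝓡 2) (𝓡 2) p f) u := by
    have h3 := (contMDiffAt_writtenInExtChartAt hf p hu).mdifferentiableAt (by simp)
    have h4 := (contMDiffAt_chart_symm (f p)
      (mapsTo_writtenInExtChartAt f p hu)).mdifferentiableAt (by simp)
    have h5 := (contMDiffAt_chart_symm p hu.1).mdifferentiableAt (by simp)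
    have h6 := (hf ((extChartAt (𝓡 2) p).symm u)).mdifferentiableAt (by simp)
    exact ((pullback_comp (I := 𝓘(ℝ, Plane)) (J := 𝓡 2) (K := 𝓡 2) B h5 h6).symm.trans
      (pullback_congr (I := 𝓘(ℝ, Plane)) (J := 𝓡 2) B h1)).trans
      (pullback_comp (I := 𝓘(ℝ, Plane)) (J := 𝓘(ℝ, Plane)) (K := 𝓡 2) (N := Plane) B h3 h4)
  rw [h2, ← mfderiv_eq_fderiv]
  rfl

theorem mfderiv_eq_fderiv_writtenInExtChartAt (hf : ContMDiff (𝓡 2) (𝓡 2) ∞ f) (p : S) :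
    (mfderiv (𝓡 2) (𝓡 2) f p : Plane →L[ℝ] Plane) =
      fderiv ℝ (writtenInExtChartAt (𝓡 2) (𝓡 2) p f) (extChartAt (𝓡 2) p p) := by
  rw [((hf p).mdifferentiableAt (by simp)).mfderiv, ModelWithCorners.range_eq_univ,
    fderivWithin_univ]

end CoordinateMaps

/-! ### Maps into products and product charts. -/

section Product

variable {S : Type*} [TopologicalSpace S] [ChartedSpace Plane S] [IsManifold (𝓡 2) ∞ S]
  {M₁ : Type*} [TopologicalSpace M₁] [ChartedSpace Plane M₁] [IsManifold (𝓡 2) ∞ M₁]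
  {M₂ : Type*} [TopologicalSpace M₂] [ChartedSpace Plane M₂] [IsManifold (𝓡 2) ∞ M₂]
  {Φ : S → M₁ × M₂}

theorem writtenInExtChartAt_prod' (Φ : S → M₁ × M₂) (p : S) (u : Plane) :
    writtenInExtChartAt (𝓡 2) ((𝓡 2).prod (𝓡 2)) p Φ u =
      (writtenInExtChartAt (𝓡 2) (𝓡 2) p (fun q => (Φ q).1) u,
        writtenInExtChartAt (𝓡 2) (𝓡 2) p (fun q => (Φ q).2) u) := by
  simp only [writtenInExtChartAt, extChartAt_prod]
  rfl

theorem mfderiv_prod_eq (hΦ : ContMDiff (𝓡 2) ((𝓡 2).prod (𝓡 2)) ∞ Φ) (p : S) (X : Plane) :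
    (mfderiv (𝓡 2) ((𝓡 2).prod (𝓡 2)) Φ p : Plane →L[ℝ] Plane × Plane) X =
      (fderiv ℝ (writtenInExtChartAt (𝓡 2) (𝓡 2) p fun q => (Φ q).1) (extChartAt (𝓡 2) p p) X,
        fderiv ℝ (writtenInExtChartAt (𝓡 2) (𝓡 2) p fun q => (Φ q).2) (extChartAt (𝓡 2) p p) X) := by
  rw [← mfderiv_eq_fderiv_writtenInExtChartAt hΦ.fst, ← mfderiv_eq_fderiv_writtenInExtChartAt hΦ.snd]
  have h1 : MDifferentiableAt (𝓡 2) (𝓡 2) (fun q => (Φ q).1) p :=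
    (hΦ.fst p).mdifferentiableAt (by simp)
  have h2 : MDifferentiableAt (𝓡 2) (𝓡 2) (fun q => (Φ q).2) p :=
    (hΦ.snd p).mdifferentiableAt (by simp)
  exact congrArg (fun l : Plane →L[ℝ] Plane × Plane => l X) (mfderiv_prodMk h1 h2)

theorem pullback_prod {E : Type*} [NormedAddCommGroup E] [NormedSpace ℝ E] {H : Type*}
    [TopologicalSpace H] {I : ModelWithCorners ℝ E H} {P : Type*} [TopologicalSpace P]
    [ChartedSpace H P] {f : P → M₁ × M₂} {p : P} (h : MDifferentiableAt I ((𝓡 2).prod (𝓡 2)) f p)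
    (B₁ : BilinField (𝓡 2) M₁) (B₂ : BilinField (𝓡 2) M₂) (ε : ℝ) (X Y : E) :
    pullback (I := I) (J := (𝓡 2).prod (𝓡 2))
      (fun z => pullback (I := (𝓡 2).prod (𝓡 2)) B₁ Prod.fst z +
        ε • pullback (I := (𝓡 2).prod (𝓡 2)) B₂ Prod.snd z) f p X Y =
      pullback (I := I) B₁ (fun q => (f q).1) p X Y +
        ε * pullback (I := I) B₂ (fun q => (f q).2) p X Y := by
  have e₁ := pullback_comp (I := I) (J := (𝓡 2).prod (𝓡 2)) (K := 𝓡 2) B₁ h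
    (mdifferentiableAt_fst (x := f p))
  have e₂ := pullback_comp (I := I) (J := (𝓡 2).prod (𝓡 2)) (K := 𝓡 2) B₂ h
    (mdifferentiableAt_snd (x := f p))
  have k₁ := congrArg (fun b : E →L[ℝ] E →L[ℝ] ℝ => b X Y) e₁
  have k₂ := congrArg (fun b : E →L[ℝ] E →L[ℝ] ℝ => b X Y) e₂
  exact (congrArg₂ (fun a b : ℝ => a + ε * b) k₁ k₂).symm

theorem coordMetric_prod (B₁ : BilinField (𝓡 2) M₁) (B₂ : BilinField (𝓡 2) M₂) (ε : ℝ)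
    (z : M₁ × M₂) {u : Plane × Plane} (h₁ : u.1 ∈ (extChartAt (𝓡 2) z.1).target)
    (h₂ : u.2 ∈ (extChartAt (𝓡 2) z.2).target) (X Y : Plane × Plane) :
    coordMetric (I := (𝓡 2).prod (𝓡 2)) (M := M₁ × M₂)
      (fun z => pullback (I := (𝓡 2).prod (𝓡 2)) B₁ Prod.fst z +
        ε • pullback (I := (𝓡 2).prod (𝓡 2)) B₂ Prod.snd z) z u X Y =
      coordMetric B₁ z.1 u.1 X.1 Y.1 + ε * coordMetric B₂ z.2 u.2 X.2 Y.2 := by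
  have c₁ := (contMDiffAt_chart_symm z.1 h₁).mdifferentiableAt (n := ∞) (by simp)
  have c₂ := (contMDiffAt_chart_symm z.2 h₂).mdifferentiableAt (n := ∞) (by simp)
  have f₁ : MDifferentiableAt 𝓘(ℝ, Plane × Plane) 𝓘(ℝ, Plane) (Prod.fst : Plane × Plane → Plane) u :=
    differentiableAt_fst.mdifferentiableAt
  have f₂ : MDifferentiableAt 𝓘(ℝ, Plane × Plane) 𝓘(ℝ, Plane) (Prod.snd : Plane × Plane → Plane) u :=
    differentiableAt_snd.mdifferentiableAt
  have e₁ := pullback_comp (I := 𝓘(ℝ, Plane × Plane)) (J := 𝓘(ℝ, Plane)) (K := 𝓡 2) (N := Plane)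
    (h := (extChartAt (𝓡 2) z.1).symm) (f := Prod.fst) B₁ f₁ c₁
  have e₂ := pullback_comp (I := 𝓘(ℝ, Plane × Plane)) (J := 𝓘(ℝ, Plane)) (K := 𝓡 2) (N := Plane)
    (h := (extChartAt (𝓡 2) z.2).symm) (f := Prod.snd) B₂ f₂ c₂
  have hd : MDifferentiableAt 𝓘(ℝ, Plane × Plane) ((𝓡 2).prod (𝓡 2))
      (fun u : Plane × Plane => ((extChartAt (𝓡 2) z.1).symm u.1, (extChartAt (𝓡 2) z.2).symm u.2))
      u := (MDifferentiableAt.comp u c₁ f₁).prodMk (MDifferentiableAt.comp u c₂ f₂)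
  have h3 : coordMetric (I := (𝓡 2).prod (𝓡 2)) (M := M₁ × M₂)
      (fun z => pullback (I := (𝓡 2).prod (𝓡 2)) B₁ Prod.fst z +
        ε • pullback (I := (𝓡 2).prod (𝓡 2)) B₂ Prod.snd z) z u X Y =
      pullback (I := 𝓘(ℝ, Plane × Plane)) (J := (𝓡 2).prod (𝓡 2))
      (fun z => pullback (I := (𝓡 2).prod (𝓡 2)) B₁ Prod.fst z +
        ε • pullback (I := (𝓡 2).prod (𝓡 2)) B₂ Prod.snd z)
      (fun u : Plane × Plane => ((extChartAt (𝓡 2) z.1).symm u.1, (extChartAt (𝓡 2) z.2).symm u.2))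
      u X Y := by
    rw [coordMetric, extChartAt_prod]
    rfl
  have k₁ := congrArg (fun b : Plane × Plane →L[ℝ] Plane × Plane →L[ℝ] ℝ => b X Y) e₁
  have k₂ := congrArg (fun b : Plane × Plane →L[ℝ] Plane × Plane →L[ℝ] ℝ => b X Y) e₂
  have g₁ : (pullback (I := 𝓘(ℝ, Plane × Plane)) (J := 𝓘(ℝ, Plane)) (M := Plane × Plane)
      (N := Plane) (coordMetric B₁ z.1) Prod.fst u : Plane × Plane →L[ℝ] Plane × Plane →L[ℝ] ℝ) X Y =
      coordMetric B₁ z.1 u.1 X.1 Y.1 := by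
    have hm : (mfderiv 𝓘(ℝ, Plane × Plane) 𝓘(ℝ, Plane) (Prod.fst : Plane × Plane → Plane) u :
        Plane × Plane →L[ℝ] Plane) = ContinuousLinearMap.fst ℝ Plane Plane := by
      rw [mfderiv_eq_fderiv, fderiv_fst]
    change (coordMetric B₁ z.1 u.1 : Plane →L[ℝ] Plane →L[ℝ] ℝ)
      ((mfderiv 𝓘(ℝ, Plane × Plane) 𝓘(ℝ, Plane) (Prod.fst : Plane × Plane → Plane) u :
        Plane × Plane →L[ℝ] Plane) X) ((mfderiv 𝓘(ℝ, Plane × Plane) 𝓘(ℝ, Plane)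
        (Prod.fst : Plane × Plane → Plane) u : Plane × Plane →L[ℝ] Plane) Y) = _
    rw [hm]
    rfl
  have g₂ : (pullback (I := 𝓘(ℝ, Plane × Plane)) (J := 𝓘(ℝ, Plane)) (M := Plane × Plane)
      (N := Plane) (coordMetric B₂ z.2) Prod.snd u : Plane × Plane →L[ℝ] Plane × Plane →L[ℝ] ℝ) X Y =
      coordMetric B₂ z.2 u.2 X.2 Y.2 := by
    have hm : (mfderiv 𝓘(ℝ, Plane × Plane) 𝓘(ℝ, Plane) (Prod.snd : Plane × Plane → Plane) u :
        Plane × Plane →L[ℝ] Plane) = ContinuousLinearMap.snd ℝ Plane Plane := by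
      rw [mfderiv_eq_fderiv, fderiv_snd]
    change (coordMetric B₂ z.2 u.2 : Plane →L[ℝ] Plane →L[ℝ] ℝ)
      ((mfderiv 𝓘(ℝ, Plane × Plane) 𝓘(ℝ, Plane) (Prod.snd : Plane × Plane → Plane) u :
        Plane × Plane →L[ℝ] Plane) X) ((mfderiv 𝓘(ℝ, Plane × Plane) 𝓘(ℝ, Plane)
        (Prod.snd : Plane × Plane → Plane) u : Plane × Plane →L[ℝ] Plane) Y) = _
    rw [hm]
    rfl
  rw [h3, pullback_prod hd, ← g₁, ← g₂]
  exact congrArg₂ (fun a b : ℝ => a + ε * b) k₁ k₂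

end Product

end PseudoRiemannian

/-! ### Splitting of the connection of G⁻ in product charts. -/

section Bridge

open LocalGeometry

variable {S : Type*} [TopologicalSpace S] [ChartedSpace Plane S] [IsManifold (𝓡 2) ∞ S]
  {M₁ : Type*} [TopologicalSpace M₁] [ChartedSpace Plane M₁] [IsManifold (𝓡 2) ∞ M₁]
  {M₂ : Type*} [TopologicalSpace M₂] [ChartedSpace Plane M₂] [IsManifold (𝓡 2) ∞ M₂]
  {Φ : S → M₁ × M₂}

theorem prodMetric_eq (ε : ℝ) (A₁ : LorentzMetric M₁) (A₂ : LorentzMetric M₂) :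
    prodMetric ε A₁ A₂ = fun z => pullback A₁.metric Prod.fst z +
      ε • pullback A₂.metric Prod.snd z := rfl

theorem coordMetric_prodMetric (A₁ : LorentzMetric M₁) (A₂ : LorentzMetric M₂) (z : M₁ × M₂)
    {u : Plane × Plane} (h₁ : u.1 ∈ (extChartAt (𝓡 2) z.1).target)
    (h₂ : u.2 ∈ (extChartAt (𝓡 2) z.2).target) (X Y : Plane × Plane) :
    coordMetric (prodMetric (-1) A₁ A₂) z u X Y =
      coordMetric A₁.metric z.1 u.1 X.1 Y.1 - coordMetric A₂.metric z.2 u.2 X.2 Y.2 := by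
  have h := coordMetric_prod A₁.metric A₂.metric (-1) z h₁ h₂ X Y
  rw [neg_one_mul, ← sub_eq_add_neg] at h
  rw [← h, prodMetric_eq]

theorem contDiffOn_coordMetric_prodMetric (A₁ : LorentzMetric M₁) (A₂ : LorentzMetric M₂)
    (z : M₁ × M₂) : ContDiffOn ℝ ∞ (coordMetric (prodMetric (-1) A₁ A₂) z)
      ((extChartAt (𝓡 2) z.1).target ×ˢ (extChartAt (𝓡 2) z.2).target) := by
  rw [contDiffOn_clm_apply]
  intro X
  rw [contDiffOn_clm_apply]
  intro Y
  refine ContDiffOn.congr ?_ fun u hu => coordMetric_prodMetric A₁ A₂ z hu.1 hu.2 X Y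
  have h₁ := (A₁.contDiffOn_coordMetric z.1).comp (g := coordMetric A₁.metric z.1) (f := Prod.fst)
    (s := (extChartAt (𝓡 2) z.1).target ×ˢ (extChartAt (𝓡 2) z.2).target)
    contDiffOn_fst fun u hu => hu.1
  have h₂ := (A₂.contDiffOn_coordMetric z.2).comp (g := coordMetric A₂.metric z.2) (f := Prod.snd)
    (s := (extChartAt (𝓡 2) z.1).target ×ˢ (extChartAt (𝓡 2) z.2).target)
    contDiffOn_snd fun u hu => hu.2
  exact ((h₁.clm_apply contDiffOn_const).clm_apply contDiffOn_const).sub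
    ((h₂.clm_apply contDiffOn_const).clm_apply contDiffOn_const)

theorem LorentzMetric.fderiv_symm (A : LorentzMetric M₁) (x : M₁) {u : Plane}
    (hu : u ∈ (extChartAt (𝓡 2) x).target) (X Y Z : Plane) :
    fderiv ℝ (coordMetric A.metric x) u X Y Z = fderiv ℝ (coordMetric A.metric x) u X Z Y :=
  fderiv_symm_of_eventually
    (((A.contDiffOn_coordMetric x).contDiffAt ((isOpen_chart_target x).mem_nhds hu)).differentiableAt
      (by simp))
    (Filter.mem_of_superset ((isOpen_chart_target x).mem_nhds hu) fun _ hv =>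
      (A.isMetricForm x hv).symm) X Y Z

theorem christoffel_prodMetric (A₁ : LorentzMetric M₁) (A₂ : LorentzMetric M₂) (z : M₁ × M₂)
    {u : Plane × Plane} (h₁ : u.1 ∈ (extChartAt (𝓡 2) z.1).target)
    (h₂ : u.2 ∈ (extChartAt (𝓡 2) z.2).target) (X Y : Plane × Plane) :
    christoffel (prodMetric (-1) A₁ A₂) z u X Y =
      (christoffelSymbol (coordMetric A₁.metric z.1) u.1 X.1 Y.1,
        christoffelSymbol (coordMetric A₂.metric z.2) u.2 X.2 Y.2) := by
  have hn : (extChartAt (𝓡 2) z.1).target ×ˢ (extChartAt (𝓡 2) z.2).target ∈ 𝓝 u :=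
    ((isOpen_chart_target z.1).prod (isOpen_chart_target z.2)).mem_nhds ⟨h₁, h₂⟩
  exact christoffelSymbol_prod (g := coordMetric (prodMetric (-1) A₁ A₂) z)
    (Filter.mem_of_superset hn fun v hv => coordMetric_prodMetric A₁ A₂ z hv.1 hv.2)
    (((contDiffOn_coordMetric_prodMetric A₁ A₂ z).contDiffAt hn).differentiableAt (by simp))
    (((A₁.contDiffOn_coordMetric z.1).contDiffAt
      ((isOpen_chart_target z.1).mem_nhds h₁)).differentiableAt (by simp))
    (((A₂.contDiffOn_coordMetric z.2).contDiffAt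
      ((isOpen_chart_target z.2).mem_nhds h₂)).differentiableAt (by simp))
    (A₁.isMetricForm z.1 h₁) (A₂.isMetricForm z.2 h₂) (A₁.fderiv_symm z.1 h₁)
    (A₂.fderiv_symm z.2 h₂) X Y

/-- The connection of π₁^*g₁ - π₂^*g₂ is the product connection, as the Christoffel symbols of a
metric do not change when its sign does. -/
theorem covHess_prodMetric (A₁ : LorentzMetric M₁) (A₂ : LorentzMetric M₂)
    (hΦ : ContMDiff (𝓡 2) ((𝓡 2).prod (𝓡 2)) ∞ Φ) (p : S) (X Y : Plane) :
    (covHess (I := 𝓡 2) (prodMetric (-1) A₁ A₂) Φ p X Y : Plane × Plane) =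
      (covariantHessian (coordMetric A₁.metric (Φ p).1)
        (writtenInExtChartAt (𝓡 2) (𝓡 2) p fun q => (Φ q).1) (extChartAt (𝓡 2) p p) X Y,
      covariantHessian (coordMetric A₂.metric (Φ p).2)
        (writtenInExtChartAt (𝓡 2) (𝓡 2) p fun q => (Φ q).2) (extChartAt (𝓡 2) p p) X Y) := by
  have hf := hΦ.fst
  have hg := hΦ.snd
  have kf := (contDiffAt_writtenInExtChartAt hf p (chart_mem_coordDomain _ p)).of_le two_le_infty
  have kg := (contDiffAt_writtenInExtChartAt hg p (chart_mem_coordDomain _ p)).of_le two_le_infty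
  have h1 : writtenInExtChartAt (𝓡 2) ((𝓡 2).prod (𝓡 2)) p Φ = fun u =>
      (writtenInExtChartAt (𝓡 2) (𝓡 2) p (fun q => (Φ q).1) u,
        writtenInExtChartAt (𝓡 2) (𝓡 2) p (fun q => (Φ q).2) u) :=
    funext (writtenInExtChartAt_prod' Φ p)
  have h2 : extChartAt ((𝓡 2).prod (𝓡 2)) (Φ p) (Φ p) =
      (extChartAt (𝓡 2) (Φ p).1 (Φ p).1, extChartAt (𝓡 2) (Φ p).2 (Φ p).2) := by
    rw [extChartAt_prod]; rfl
  -- The two velocities are generalised so that their components can be substituted despite the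
  -- dependent tangent space types.
  have h3 : ∀ V W : Plane × Plane,
      (mfderiv (𝓡 2) ((𝓡 2).prod (𝓡 2)) Φ p : Plane →L[ℝ] Plane × Plane) X = V →
      (mfderiv (𝓡 2) ((𝓡 2).prod (𝓡 2)) Φ p : Plane →L[ℝ] Plane × Plane) Y = W →
      (covHess (I := 𝓡 2) (prodMetric (-1) A₁ A₂) Φ p X Y : Plane × Plane) =
      fderiv ℝ (fderiv ℝ (writtenInExtChartAt (𝓡 2) ((𝓡 2).prod (𝓡 2)) p Φ))
        (extChartAt (𝓡 2) p p) X Y + christoffel (prodMetric (-1) A₁ A₂) (Φ p)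
        (extChartAt ((𝓡 2).prod (𝓡 2)) (Φ p) (Φ p)) V W := by
    rintro _ _ rfl rfl
    rfl
  rw [h3 _ _ (mfderiv_prod_eq hΦ p X) (mfderiv_prod_eq hΦ p Y), h1, h2,
    fderiv_fderiv_prodMk kf kg, christoffel_prodMetric A₁ A₂ (Φ p)
    (u := (extChartAt (𝓡 2) (Φ p).1 (Φ p).1, extChartAt (𝓡 2) (Φ p).2 (Φ p).2))
    (mem_extChartAt_target _) (mem_extChartAt_target _), covariantHessian, covariantHessian,
    writtenInExtChartAt_self, writtenInExtChartAt_self]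
  rfl

end Bridge

/-! ### Vanishing mean curvature as a tangency condition. -/

theorem PseudoRiemannian.det_smul_sum_inv {F : Type*} [AddCommGroup F] [Module ℝ F]
    (H : Matrix (Fin 2) (Fin 2) ℝ) (b : Fin 2 → Fin 2 → F) (hs : H 1 0 = H 0 1) (hd : H.det ≠ 0) :
    H.det • ∑ i, ∑ j, H⁻¹ i j • b i j =
      H 1 1 • b 0 0 - H 0 1 • (b 0 1 + b 1 0) + H 0 0 • b 1 1 := by
  have h : ∀ i j, H.det * H⁻¹ i j = H.adjugate i j := fun i j => by
    rw [Matrix.inv_def, Matrix.smul_apply, smul_eq_mul, Ring.inverse_eq_inv', mul_inv_cancel_left₀ hd]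
  simp only [Fin.sum_univ_two, smul_add, smul_smul, h, Matrix.adjugate_fin_two]
  simp [hs]
  module

section Trace

open LocalGeometry

variable {S : Type*} [TopologicalSpace S] [ChartedSpace Plane S]
  {E' : Type*} [NormedAddCommGroup E'] [NormedSpace ℝ E']
  {H' : Type*} [TopologicalSpace H'] {J : ModelWithCorners ℝ E' H'}
  {N : Type*} [TopologicalSpace N] [ChartedSpace H' N]

/-- Multiplication by the Gram determinant clears the inverse matrix; the tangent vector on the
right is scaled by the same factor. -/
theorem exists_adjugateTrace_eq_of_sum_inv {h : Plane →L[ℝ] Plane →L[ℝ] ℝ} (hm : IsMetricForm h)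
    {H : Matrix (Fin 2) (Fin 2) ℝ}
    (hH : ∀ i j, H i j = h (EuclideanSpace.single i 1) (EuclideanSpace.single j 1))
    (b : Plane → Plane → E') (D : Plane →L[ℝ] E') (c : Fin 2 → Fin 2 → ℝ)
    (hc : ∑ i, ∑ j, H⁻¹ i j • b (EuclideanSpace.single i 1) (EuclideanSpace.single j 1) =
      ∑ i, ∑ j, c i j • D (EuclideanSpace.single j 1)) :
    ∃ v : Plane, adjugateTrace (fun X Y => h X Y) b
      (EuclideanSpace.single 0 1) (EuclideanSpace.single 1 1) = D v := by
  have hd : H.det ≠ 0 := by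
    rw [Matrix.det_fin_two, hH, hH, hH, hH, hm.symm (EuclideanSpace.single 1 1)
      (EuclideanSpace.single 0 1), ← sq]
    exact hm.det_ne_zero
  refine ⟨H.det • ∑ i, ∑ j, c i j • EuclideanSpace.single j 1, ?_⟩
  have h2 : D (H.det • ∑ i, ∑ j, c i j • EuclideanSpace.single j 1) =
      H.det • ∑ i, ∑ j, c i j • D (EuclideanSpace.single j 1) := by
    simp only [map_smul, map_sum]
  rw [h2, ← hc, PseudoRiemannian.det_smul_sum_inv H
    (fun i j => b (EuclideanSpace.single i 1) (EuclideanSpace.single j 1))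
    (by rw [hH, hH, hm.symm]) hd, hH, hH, hH]
  rfl

/-- If the mean curvature vector vanishes, the trace of the second covariant derivative is
tangent. -/
theorem PseudoRiemannian.exists_adjugateTrace_eq {G : BilinField J N} {Φ : S → N} {p : S}
    {h : Plane →L[ℝ] Plane →L[ℝ] ℝ} (hh : h = pullback (I := 𝓡 2) G Φ p) (hm : IsMetricForm h)
    (h0 : meanCurvature G Φ p = 0) :
    ∃ v : Plane, adjugateTrace (fun X Y => h X Y)
      (fun X Y : Plane => (covHess (I := 𝓡 2) G Φ p X Y : E'))
      (EuclideanSpace.single 0 1) (EuclideanSpace.single 1 1) =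
        (mfderiv (𝓡 2) J Φ p : Plane →L[ℝ] E') v := by
  have h1 : (1 / 2 : ℝ) • ((traceHess G Φ p : E') - ∑ i, ∑ j, ((inducedGram G Φ p)⁻¹ i j *
      G (Φ p) (traceHess G Φ p) (mfderiv (𝓡 2) J Φ p (coordVec p i))) •
      (mfderiv (𝓡 2) J Φ p : Plane →L[ℝ] E') (EuclideanSpace.single j 1)) = 0 := h0
  exact exists_adjugateTrace_eq_of_sum_inv (E' := E') hm (H := inducedGram G Φ p)
    (fun i j => by rw [hh]; rfl) (fun X Y : Plane => (covHess (I := 𝓡 2) G Φ p X Y : E'))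
    (mfderiv (𝓡 2) J Φ p) _ (sub_eq_zero.1 ((smul_eq_zero_iff_right (by norm_num)).1 h1))

end Trace

/-! ### From minimal Lagrangian immersions to their coordinate expressions. -/

section MinimalLagrangian

open LocalGeometry

variable {S : Type*} [TopologicalSpace S] [ChartedSpace Plane S] [IsManifold (𝓡 2) ∞ S]
  {M₁ : Type*} [TopologicalSpace M₁] [ChartedSpace Plane M₁] [IsManifold (𝓡 2) ∞ M₁]
  {M₂ : Type*} [TopologicalSpace M₂] [ChartedSpace Plane M₂] [IsManifold (𝓡 2) ∞ M₂]
  {Φ : S → M₁ × M₂}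

theorem pullback_prodMetric (A₁ : LorentzMetric M₁) (A₂ : LorentzMetric M₂)
    (hΦ : ContMDiff (𝓡 2) ((𝓡 2).prod (𝓡 2)) ∞ Φ) (p : S) (X Y : Plane) :
    pullback (I := 𝓡 2) (prodMetric (-1) A₁ A₂) Φ p X Y =
      pullback (I := 𝓡 2) A₁.metric (fun q => (Φ q).1) p X Y -
        pullback (I := 𝓡 2) A₂.metric (fun q => (Φ q).2) p X Y := by
  have h := pullback_prod ((hΦ p).mdifferentiableAt (by simp)) A₁.metric A₂.metric (-1) X Y
  rw [neg_one_mul, ← sub_eq_add_neg] at h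
  rw [← h, prodMetric_eq]

theorem pullback_prodOmega (A₁ : ParaKahlerSurface M₁) (A₂ : ParaKahlerSurface M₂)
    (hΦ : ContMDiff (𝓡 2) ((𝓡 2).prod (𝓡 2)) ∞ Φ) (p : S) (X Y : Plane) :
    pullback (I := 𝓡 2) (prodOmega (-1) A₁ A₂) Φ p X Y =
      pullback (I := 𝓡 2) A₁.omega (fun q => (Φ q).1) p X Y -
        pullback (I := 𝓡 2) A₂.omega (fun q => (Φ q).2) p X Y := by
  have h := pullback_prod ((hΦ p).mdifferentiableAt (by simp)) A₁.omega A₂.omega (-1) X Y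
  rw [neg_one_mul, ← sub_eq_add_neg] at h
  exact h

theorem IsLagrangian.pullback_omega_eq {A₁ : ParaKahlerSurface M₁} {A₂ : ParaKahlerSurface M₂}
    (hL : IsLagrangian (-1) A₁ A₂ Φ) (hΦ : ContMDiff (𝓡 2) ((𝓡 2).prod (𝓡 2)) ∞ Φ) (p : S)
    (X Y : Plane) :
    (pullback (I := 𝓡 2) A₁.omega (fun q => (Φ q).1) p : Plane →L[ℝ] Plane →L[ℝ] ℝ) X Y =
      (pullback (I := 𝓡 2) A₂.omega (fun q => (Φ q).2) p : Plane →L[ℝ] Plane →L[ℝ] ℝ) X Y :=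
  sub_eq_zero.1 ((pullback_prodOmega A₁ A₂ hΦ p X Y).symm.trans (hL p X Y))

theorem IsLagrangian.coordMetric_omega_eq {A₁ : ParaKahlerSurface M₁} {A₂ : ParaKahlerSurface M₂}
    (hL : IsLagrangian (-1) A₁ A₂ Φ) (hΦ : ContMDiff (𝓡 2) ((𝓡 2).prod (𝓡 2)) ∞ Φ) (p : S)
    (u X Y : Plane) :
    coordMetric (pullback (I := 𝓡 2) A₁.omega fun q => (Φ q).1) p u X Y =
      coordMetric (pullback (I := 𝓡 2) A₂.omega fun q => (Φ q).2) p u X Y := by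
  rw [coordMetric_apply, coordMetric_apply]
  exact hL.pullback_omega_eq hΦ _ _ _

theorem inducedForm_written (A₁ : LorentzMetric M₁) (A₂ : LorentzMetric M₂)
    (hΦ : ContMDiff (𝓡 2) ((𝓡 2).prod (𝓡 2)) ∞ Φ) (p : S) {u : Plane}
    (h₁ : u ∈ coordDomain (fun q => (Φ q).1) p) (h₂ : u ∈ coordDomain (fun q => (Φ q).2) p)
    (X Y : Plane) :
    inducedForm (coordMetric A₁.metric (Φ p).1) (coordMetric A₂.metric (Φ p).2)
      (writtenInExtChartAt (𝓡 2) (𝓡 2) p fun q => (Φ q).1)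
      (writtenInExtChartAt (𝓡 2) (𝓡 2) p fun q => (Φ q).2) u X Y =
      coordMetric (pullback (I := 𝓡 2) (prodMetric (-1) A₁ A₂) Φ) p u X Y := by
  rw [inducedForm_apply, ← coordMetric_pullback hΦ.fst A₁.metric p h₁,
    ← coordMetric_pullback hΦ.snd A₂.metric p h₂]
  exact (pullback_prodMetric A₁ A₂ hΦ ((extChartAt (𝓡 2) p).symm u)
    (mfderiv 𝓘(ℝ, Plane) (𝓡 2) (extChartAt (𝓡 2) p).symm u X)
    (mfderiv 𝓘(ℝ, Plane) (𝓡 2) (extChartAt (𝓡 2) p).symm u Y)).symm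

theorem isMetricForm_inducedForm (A₁ : LorentzMetric M₁) (A₂ : LorentzMetric M₂)
    (hΦ : ContMDiff (𝓡 2) ((𝓡 2).prod (𝓡 2)) ∞ Φ)
    (hn : ∀ p, ∀ v : TangentSpace (𝓡 2) p,
      (∀ w, pullback (I := 𝓡 2) (prodMetric (-1) A₁ A₂) Φ p v w = 0) → v = 0) (p : S) {u : Plane}
    (h₁ : u ∈ coordDomain (fun q => (Φ q).1) p) (h₂ : u ∈ coordDomain (fun q => (Φ q).2) p) :
    IsMetricForm (inducedForm (coordMetric A₁.metric (Φ p).1) (coordMetric A₂.metric (Φ p).2)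
      (writtenInExtChartAt (𝓡 2) (𝓡 2) p fun q => (Φ q).1)
      (writtenInExtChartAt (𝓡 2) (𝓡 2) p fun q => (Φ q).2) u) where
  symm X Y := by
    rw [inducedForm_apply, inducedForm_apply,
      (A₁.isMetricForm _ (mapsTo_writtenInExtChartAt _ p h₁)).symm,
      (A₂.isMetricForm _ (mapsTo_writtenInExtChartAt _ p h₂)).symm]
  nondegenerate X hX := by
    have h := isInvertible_mfderiv_chart_symm p h₁.1
    refine h.injective (Eq.trans ?_ (map_zero _).symm)
    refine hn ((extChartAt (𝓡 2) p).symm u)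
      (mfderiv 𝓘(ℝ, Plane) (𝓡 2) (extChartAt (𝓡 2) p).symm u X) fun w => ?_
    obtain ⟨Y, rfl⟩ := h.surjective w
    exact (inducedForm_written A₁ A₂ hΦ p h₁ h₂ X Y).symm.trans (hX Y)

/-- Vanishing of the mean curvature vector, in the charts at the point. -/
theorem isTraceTangent_self (A₁ : LorentzMetric M₁) (A₂ : LorentzMetric M₂)
    (hΦ : ContMDiff (𝓡 2) ((𝓡 2).prod (𝓡 2)) ∞ Φ)
    (hmin : IsMinimalSurface (prodMetric (-1) A₁ A₂) Φ) (p : S) :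
    IsTraceTangent (coordMetric A₁.metric (Φ p).1) (coordMetric A₂.metric (Φ p).2)
      (writtenInExtChartAt (𝓡 2) (𝓡 2) p fun q => (Φ q).1)
      (writtenInExtChartAt (𝓡 2) (𝓡 2) p fun q => (Φ q).2) (extChartAt (𝓡 2) p p) := by
  have m₁ := chart_mem_coordDomain (fun q => (Φ q).1) p
  have m₂ := chart_mem_coordDomain (fun q => (Φ q).2) p
  have hm := isMetricForm_inducedForm A₁ A₂ hΦ hmin.nondegenerate p m₁ m₂
  have hI := inducedForm_written A₁ A₂ hΦ p m₁ m₂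
  simp only [coordMetric_self] at hI
  obtain ⟨v, hv⟩ := exists_adjugateTrace_eq
    (ContinuousLinearMap.ext fun X => ContinuousLinearMap.ext fun Y => hI X Y) hm (hmin.minimal p)
  rw [mfderiv_prod_eq hΦ] at hv
  simp only [adjugateTrace, covHess_prodMetric A₁ A₂ hΦ] at hv
  exact ⟨v, congrArg Prod.fst hv, congrArg Prod.snd hv⟩

/-- Minimality at the point q with coordinate u is available in the charts at q. It is carried to
the charts at p by a coordinate change on the surface and by transition maps, which are isometries,
on the two factors. -/
theorem isTraceTangent_written (A₁ : ParaKahlerSurface M₁) (A₂ : ParaKahlerSurface M₂)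
    (hΦ : ContMDiff (𝓡 2) ((𝓡 2).prod (𝓡 2)) ∞ Φ)
    (hmin : IsMinimalSurface (prodMetric (-1) A₁.toLorentzMetric A₂.toLorentzMetric) Φ) (p : S)
    {u : Plane} (h₁ : u ∈ coordDomain (fun q => (Φ q).1) p)
    (h₂ : u ∈ coordDomain (fun q => (Φ q).2) p) :
    IsTraceTangent (coordMetric A₁.metric (Φ p).1) (coordMetric A₂.metric (Φ p).2)
      (writtenInExtChartAt (𝓡 2) (𝓡 2) p fun q => (Φ q).1)
      (writtenInExtChartAt (𝓡 2) (𝓡 2) p fun q => (Φ q).2) u := by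
  obtain ⟨q, hq⟩ : ∃ q, q = (extChartAt (𝓡 2) p).symm u := ⟨_, rfl⟩
  have e₁ := writtenInExtChartAt_eventuallyEq hΦ.fst.continuous p h₁ hq
  have e₂ := writtenInExtChartAt_eventuallyEq hΦ.snd.continuous p h₂ hq
  have hT : u ∈ transitionDomain p q := by subst hq; exact mem_transitionDomain_symm p h₁.1
  have hc : transition p q u = extChartAt (𝓡 2) q q := by rw [hq]; rfl
  have hσ := (contMDiffAt_transition p q hT).contDiffAt.of_le two_le_infty
  have k₁ := (contDiffAt_writtenInExtChartAt hΦ.fst q (chart_mem_coordDomain _ q)).of_le two_le_infty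
  have k₂ := (contDiffAt_writtenInExtChartAt hΦ.snd q (chart_mem_coordDomain _ q)).of_le two_le_infty
  have w₁ := writtenInExtChartAt_self (fun q => (Φ q).1) q
  have w₂ := writtenInExtChartAt_self (fun q => (Φ q).2) q
  have t₁ : extChartAt (𝓡 2) (Φ q).1 (Φ q).1 ∈ transitionDomain (Φ q).1 (Φ p).1 :=
    chart_mem_transitionDomain (by subst hq; exact h₁.2)
  have t₂ : extChartAt (𝓡 2) (Φ q).2 (Φ q).2 ∈ transitionDomain (Φ q).2 (Φ p).2 :=
    chart_mem_transitionDomain (by subst hq; exact h₂.2)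
  have h := isTraceTangent_self A₁.toLorentzMetric A₂.toLorentzMetric hΦ hmin q
  rw [← hc] at h k₁ k₂ w₁ w₂
  have m₁ := (A₁.isMetricForm (Φ q).1 (mem_extChartAt_target (I := 𝓡 2) (Φ q).1)).symm
  have m₂ := (A₂.isMetricForm (Φ q).2 (mem_extChartAt_target (I := 𝓡 2) (Φ q).2)).symm
  rw [← w₁] at m₁
  rw [← w₂] at m₂
  have h' := h.comp_right m₁ m₂ k₁ k₂ hσ (surjective_fderiv_transition p q hT)
  have d₁ := (A₁.isParaKahlerOn (Φ q).1).mono (isOpen_transitionDomain (Φ q).1 (Φ p).1)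
    inter_subset_left
  have d₂ := (A₂.isParaKahlerOn (Φ q).2).mono (isOpen_transitionDomain (Φ q).2 (Φ p).2)
    inter_subset_left
  have c₁ := ContDiffAt.comp u k₁ hσ
  have c₂ := ContDiffAt.comp u k₂ hσ
  rw [← w₁] at t₁
  rw [← w₂] at t₂
  have h3 := IsTraceTangent.comp_left h' (A₁.isParaKahlerMapOn_transition (Φ q).1 (Φ p).1)
    (A₂.isParaKahlerMapOn_transition (Φ q).2 (Φ p).2) d₁ d₂ (A₁.isParaKahlerOn (Φ p).1)
    (A₂.isParaKahlerOn (Φ p).2) c₁ c₂ t₁ t₂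
  exact h3.congr e₁ e₂

theorem isMinimalLagrangianOn_written (A₁ : ParaKahlerSurface M₁) (A₂ : ParaKahlerSurface M₂)
    (hΦ : ContMDiff (𝓡 2) ((𝓡 2).prod (𝓡 2)) ∞ Φ) (hL : IsLagrangian (-1) A₁ A₂ Φ)
    (hmin : IsMinimalSurface (prodMetric (-1) A₁.toLorentzMetric A₂.toLorentzMetric) Φ) (p : S) :
    IsMinimalLagrangianOn (coordMetric A₁.metric (Φ p).1) (coordMetric A₂.metric (Φ p).2)
      (A₁.coordJ (Φ p).1) (A₂.coordJ (Φ p).2)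
      (writtenInExtChartAt (𝓡 2) (𝓡 2) p fun q => (Φ q).1)
      (writtenInExtChartAt (𝓡 2) (𝓡 2) p fun q => (Φ q).2)
      (coordDomain (fun q => (Φ q).1) p ∩ coordDomain (fun q => (Φ q).2) p)
      (extChartAt (𝓡 2) (Φ p).1).target (extChartAt (𝓡 2) (Φ p).2).target := by
  have hLag : ∀ u ∈ coordDomain (fun q => (Φ q).1) p ∩ coordDomain (fun q => (Φ q).2) p,
      ∀ X Y, coordMetric A₁.metric (Φ p).1 (writtenInExtChartAt (𝓡 2) (𝓡 2) p (fun q => (Φ q).1) u)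
        (A₁.coordJ (Φ p).1 (writtenInExtChartAt (𝓡 2) (𝓡 2) p (fun q => (Φ q).1) u)
        (fderiv ℝ (writtenInExtChartAt (𝓡 2) (𝓡 2) p fun q => (Φ q).1) u X))
        (fderiv ℝ (writtenInExtChartAt (𝓡 2) (𝓡 2) p fun q => (Φ q).1) u Y) =
      coordMetric A₂.metric (Φ p).2 (writtenInExtChartAt (𝓡 2) (𝓡 2) p (fun q => (Φ q).2) u)
        (A₂.coordJ (Φ p).2 (writtenInExtChartAt (𝓡 2) (𝓡 2) p (fun q => (Φ q).2) u)
        (fderiv ℝ (writtenInExtChartAt (𝓡 2) (𝓡 2) p fun q => (Φ q).2) u X))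
        (fderiv ℝ (writtenInExtChartAt (𝓡 2) (𝓡 2) p fun q => (Φ q).2) u Y) := by
    intro u hu X Y
    rw [A₁.coordMetric_coordJ _ (mapsTo_writtenInExtChartAt _ p hu.1),
      A₂.coordMetric_coordJ _ (mapsTo_writtenInExtChartAt _ p hu.2),
      ← coordMetric_pullback hΦ.fst A₁.omega p hu.1,
      ← coordMetric_pullback hΦ.snd A₂.omega p hu.2]
    exact hL.coordMetric_omega_eq hΦ p u X Y
  exact
    { isOpen := (isOpen_coordDomain hΦ.fst.continuous p).inter
        (isOpen_coordDomain hΦ.snd.continuous p)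
      smooth_fst := fun u hu => (contDiffAt_writtenInExtChartAt hΦ.fst p hu.1).contDiffWithinAt
      smooth_snd := fun u hu => (contDiffAt_writtenInExtChartAt hΦ.snd p hu.2).contDiffWithinAt
      mapsTo_fst := fun u hu => mapsTo_writtenInExtChartAt _ p hu.1
      mapsTo_snd := fun u hu => mapsTo_writtenInExtChartAt _ p hu.2
      lagrangian := hLag
      nondegenerate := fun u hu =>
        isMetricForm_inducedForm _ _ hΦ hmin.nondegenerate p hu.1 hu.2
      minimal := fun u hu Z =>
        (isTraceTangent_written A₁ A₂ hΦ hmin p hu.1 hu.2).adjugateTrace_cubicForm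
          ((A₁.isParaKahlerOn _).form _ (mapsTo_writtenInExtChartAt _ p hu.1))
          ((A₂.isParaKahlerOn _).form _ (mapsTo_writtenInExtChartAt _ p hu.2)) (hLag u hu) Z }

/-- The Ricci form of `G⁻` vanishes on a minimal Lagrangian surface. -/
theorem gaussCurvature_add_mul_pullback_omega_eq_zero (A₁ : ParaKahlerSurface M₁)
    (A₂ : ParaKahlerSurface M₂)
    (hΦ : ContMDiff (𝓡 2) ((𝓡 2).prod (𝓡 2)) ∞ Φ) (hL : IsLagrangian (-1) A₁ A₂ Φ)
    (hmin : IsMinimalSurface (prodMetric (-1) A₁.toLorentzMetric A₂.toLorentzMetric) Φ) (p : S)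
    (X Y : Plane) :
    (gaussCurvature A₁.metric (Φ p).1 + gaussCurvature A₂.metric (Φ p).2) *
      pullback (I := 𝓡 2) A₁.omega (fun q => (Φ q).1) p X Y = 0 := by
  have m₁ := chart_mem_coordDomain (fun q => (Φ q).1) p
  have m₂ := chart_mem_coordDomain (fun q => (Φ q).2) p
  have h := (isMinimalLagrangianOn_written A₁ A₂ hΦ hL hmin p).ricci_form_eq_zero
    (A₁.isParaKahlerOn _) (A₂.isParaKahlerOn _) (u := extChartAt (𝓡 2) p p) ⟨m₁, m₂⟩ X Y
  rw [A₁.coordMetric_coordJ _ (mapsTo_writtenInExtChartAt _ p m₁),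
    ← coordMetric_pullback hΦ.fst A₁.omega p m₁, coordMetric_self, writtenInExtChartAt_self,
    writtenInExtChartAt_self, ← A₁.gaussCurvature_eq, ← A₂.gaussCurvature_eq] at h
  exact h

end MinimalLagrangian

/-! ### Ranks of endomorphisms of the plane. -/

namespace LocalGeometry

/-- Pulling back an alternating form by L multiplies it by det L. -/
theorem surjective_of_alternating_ne_zero {B : Plane →L[ℝ] Plane →L[ℝ] ℝ}
    (hB : ∀ X Y, B X Y = -B Y X) {L : Plane →L[ℝ] Plane} {X Y : Plane} (h : B (L X) (L Y) ≠ 0) :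
    Function.Surjective L := by
  refine (LinearMap.injective_iff_surjective (f := L.toLinearMap)).1 ?_
  have key : ∀ V W, 2 * B (L V) (L W) = (V 0 * W 1 - V 1 * W 0) *
      (2 * B (L (EuclideanSpace.single 0 1)) (L (EuclideanSpace.single 1 1))) := by
    intro V W
    have h1 := alternating_plane (B.bilinearComp L L) V W
    simp only [ContinuousLinearMap.bilinearComp_apply] at h1
    rw [hB (L W), hB (L (EuclideanSpace.single 1 1))] at h1
    linarith
  have h0 : B (L (EuclideanSpace.single 0 1)) (L (EuclideanSpace.single 1 1)) ≠ 0 := by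
    intro h0
    have := key X Y
    rw [h0] at this
    exact h (by linarith)
  refine (injective_iff_map_eq_zero L).2 fun V hV => ?_
  have h1 := key V (EuclideanSpace.single 0 1)
  have h2 := key V (EuclideanSpace.single 1 1)
  rw [hV] at h1 h2
  simp [h0] at h1 h2
  ext i
  fin_cases i
  · simpa using h2
  · simpa using h1

theorem IsParaKahlerForm.not_surjective {b : Plane →L[ℝ] Plane →L[ℝ] ℝ} {j : Plane →L[ℝ] Plane}
    (h : IsParaKahlerForm b j) {L : Plane →L[ℝ] Plane} (h0 : ∀ X Y, b (j (L X)) (L Y) = 0) :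
    ¬ Function.Surjective L := by
  intro hs
  obtain ⟨X, hX⟩ := hs (EuclideanSpace.single 0 1)
  obtain ⟨Y, hY⟩ := hs (EuclideanSpace.single 1 1)
  have := h0 X Y
  rw [hX, hY] at this
  exact h.omega_ne_zero this

/-- Both kernels have dimension at least one, and they are disjoint in a plane, so both are lines.
-/
theorem finrank_range_eq_one {L K : Plane →L[ℝ] Plane} (hL : ¬ Function.Surjective L)
    (hK : ¬ Function.Surjective K) (h : ∀ X, L X = 0 → K X = 0 → X = 0) :
    Module.finrank ℝ (LinearMap.range L.toLinearMap) = 1 ∧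
      Module.finrank ℝ (LinearMap.range K.toLinearMap) = 1 := by
  have h2 : Module.finrank ℝ Plane = 2 := finrank_euclideanSpace_fin
  have key : ∀ N : Plane →L[ℝ] Plane, ¬ Function.Surjective N →
      Module.finrank ℝ (LinearMap.range N.toLinearMap) < 2 := by
    intro N hN
    by_contra! hlt
    apply hN
    have : LinearMap.range N.toLinearMap = ⊤ := Submodule.eq_top_of_finrank_eq
      (le_antisymm (Submodule.finrank_le _) (by rw [h2]; exact hlt))
    exact LinearMap.range_eq_top.1 this
  have r₁ := LinearMap.finrank_range_add_finrank_ker L.toLinearMap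
  have r₂ := LinearMap.finrank_range_add_finrank_ker K.toLinearMap
  have hd : Disjoint (LinearMap.ker L.toLinearMap) (LinearMap.ker K.toLinearMap) := by
    rw [Submodule.disjoint_def]
    exact fun X h1 h2 => h X h1 h2
  have r₃ := Submodule.finrank_add_finrank_le_of_disjoint hd
  have k₁ := key L hL
  have k₂ := key K hK
  omega

end LocalGeometry

/-! ### Consequences of non-flatness: both projections have rank one. -/

section NonFlat

open LocalGeometry

variable {M : Type*} [TopologicalSpace M] [ChartedSpace Plane M] [IsManifold (𝓡 2) ∞ M]
  {S : Type*} [TopologicalSpace S] [ChartedSpace Plane S] [IsManifold (𝓡 2) ∞ S]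

theorem ParaKahlerSurface.isParaKahlerForm (A : ParaKahlerSurface M) (x : M) :
    IsParaKahlerForm (A.metric x : Plane →L[ℝ] Plane →L[ℝ] ℝ) (A.j x : Plane →L[ℝ] Plane) where
  symm := A.symm x
  nondegenerate := A.nondegenerate x
  j_sq := A.j_sq x
  j_metric := A.j_metric x

theorem LorentzMetric.IsNonFlat.dense [ConnectedSpace M] {A : ParaKahlerSurface M}
    (h : A.IsNonFlat) : Dense {x | gaussCurvature A.metric x ≠ 0} := by
  rcases h with h | h
  · rw [show {x | gaussCurvature A.metric x ≠ 0} = univ from eq_univ_of_forall h]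
    exact dense_univ
  · exact h.1

/-- If κ vanishes nowhere, continuity on a connected surface forbids a change of sign. In the other
case the inequality is assumed off the zeros of κ and trivial on them. -/
theorem LorentzMetric.IsNonFlat.mul_nonneg [ConnectedSpace M] {A : ParaKahlerSurface M}
    (h : A.IsNonFlat) (x y : M) : 0 ≤ gaussCurvature A.metric x * gaussCurvature A.metric y := by
  rcases h with h | h
  · by_contra! hlt
    have key : ∀ a b, gaussCurvature A.metric a ≤ 0 → 0 ≤ gaussCurvature A.metric b → False := by
      intro a b ha hb
      obtain ⟨c, hc⟩ := mem_range_of_exists_le_of_exists_ge A.continuous_gaussCurvature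
        ⟨a, ha⟩ ⟨b, hb⟩
      exact h c hc
    rcases mul_neg_iff.1 hlt with ⟨h1, h2⟩ | ⟨h1, h2⟩
    · exact key y x h2.le h1.le
    · exact key x y h1.le h2.le
  · by_cases hx : gaussCurvature A.metric x = 0
    · simp [hx]
    by_cases hy : gaussCurvature A.metric y = 0
    · simp [hy]
    exact (h.2 x y hx hy).le

/-- The product of the two curvatures is nonnegative, and equal to minus a square. -/
theorem LorentzMetric.IsNonFlat.eq_zero_of_add_eq_zero [ConnectedSpace M]
    {A : ParaKahlerSurface M} (h : A.IsNonFlat) {x y : M}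
    (h0 : gaussCurvature A.metric x + gaussCurvature A.metric y = 0) :
    gaussCurvature A.metric x = 0 := by
  have h1 := h.mul_nonneg x y
  nlinarith [sq_nonneg (gaussCurvature A.metric x)]

/-- Near a point where the pullback of the symplectic form by `f` is nonzero, `f` takes values in
every dense set. -/
theorem ParaKahlerSurface.frequently_of_pullback_omega_ne_zero (A : ParaKahlerSurface M) {f : S → M}
    (hf : ContMDiff (𝓡 2) (𝓡 2) ∞ f) {p : S} {X Y : Plane}
    (h0 : (pullback (I := 𝓡 2) A.omega f p : Plane →L[ℝ] Plane →L[ℝ] ℝ) X Y ≠ 0) {s : Set M}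
    (hs : Dense s) :
    ∃ q, f q ∈ s ∧ ∃ X Y : Plane,
      (pullback (I := 𝓡 2) A.omega f q : Plane →L[ℝ] Plane →L[ℝ] ℝ) X Y ≠ 0 := by
  set F := writtenInExtChartAt (𝓡 2) (𝓡 2) p f with hF
  set u₀ := extChartAt (𝓡 2) p p with hu₀
  have hu : u₀ ∈ coordDomain f p := chart_mem_coordDomain f p
  have hsm : ContDiffAt ℝ ∞ F u₀ := contDiffAt_writtenInExtChartAt hf p hu
  have hne : coordMetric A.omega (f p) (F u₀) (fderiv ℝ F u₀ X) (fderiv ℝ F u₀ Y) ≠ 0 := by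
    rw [hF, ← coordMetric_pullback hf A.omega p hu, coordMetric_self]
    exact h0
  have hω := (A.contDiffOn_coordOmega (f p)).contDiffAt
    ((isOpen_chart_target _).mem_nhds (mapsTo_writtenInExtChartAt f p hu))
  have hd : ContinuousAt (fderiv ℝ F) u₀ := (hsm.fderiv_right (m := 0) (by simp)).continuousAt
  have hc : ContinuousAt (fun u => coordMetric A.omega (f p) (F u) (fderiv ℝ F u X)
      (fderiv ℝ F u Y)) u₀ :=
    ((ContinuousAt.comp (g := coordMetric A.omega (f p)) (f := F) hω.continuousAt
      hsm.continuousAt).clm_apply (hd.clm_apply continuousAt_const)).clm_apply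
      (hd.clm_apply continuousAt_const)
  -- A pulled back area form can only be nonzero where the derivative is invertible.
  have hsurj : Function.Surjective (fderiv ℝ F u₀) := by
    refine surjective_of_alternating_ne_zero (fun V W => ?_) hne
    rw [← A.coordMetric_coordJ _ (mapsTo_writtenInExtChartAt f p hu),
      ← A.coordMetric_coordJ _ (mapsTo_writtenInExtChartAt f p hu)]
    exact ((A.isParaKahlerOn _).form _ (mapsTo_writtenInExtChartAt f p hu)).omega_antisymm V W
  -- By openness, avoiding s near p in the source means avoiding s on a full neighbourhood of f(p),
  -- which density excludes.
  have hmap : Filter.map F (𝓝 u₀) = 𝓝 (F u₀) :=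
    (hsm.hasStrictFDerivAt (by simp)).map_nhds_eq_of_surj (LinearMap.range_eq_top.2 hsurj)
  have hev : ∀ᶠ u in 𝓝 u₀, u ∈ coordDomain f p ∧ coordMetric A.omega (f p) (F u) (fderiv ℝ F u X)
      (fderiv ℝ F u Y) ≠ 0 :=
    Filter.Eventually.and ((isOpen_coordDomain hf.continuous p).mem_nhds hu) (hc.eventually_ne hne)
  by_contra! hcon
  have h1 : ∀ᶠ u in 𝓝 u₀, (extChartAt (𝓡 2) (f p)).symm (F u) ∉ s := by
    filter_upwards [hev] with u hu'
    rw [hF, chart_symm_writtenInExtChartAt f p hu'.1]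
    intro hmem
    apply hu'.2
    rw [hF, ← coordMetric_pullback hf A.omega p hu'.1]
    rw [coordMetric_apply]
    exact hcon ((extChartAt (𝓡 2) p).symm u) hmem
      (mfderiv 𝓘(ℝ, Plane) (𝓡 2) (extChartAt (𝓡 2) p).symm u X)
      (mfderiv 𝓘(ℝ, Plane) (𝓡 2) (extChartAt (𝓡 2) p).symm u Y)
  have h2 : ∀ᶠ v in 𝓝 (F u₀), (extChartAt (𝓡 2) (f p)).symm v ∉ s := by
    rw [← hmap]
    exact h1
  have h3 : ∀ᶠ y in 𝓝 (f p), y ∉ s := by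
    rw [hF, hu₀, writtenInExtChartAt_self] at h2
    filter_upwards [(continuousAt_extChartAt (I := 𝓡 2) (f p)).eventually h2,
      extChartAt_source_mem_nhds (I := 𝓡 2) (f p)] with y hy hy'
    rwa [(extChartAt (𝓡 2) (f p)).left_inv hy'] at hy
  exact (mem_closure_iff_frequently.1 (hs (f p))) h3

variable {Φ : S → M × M}

/-- A point with φ^*ω ≠ 0 can be moved to one where also κ∘φ ≠ 0. There the Ricci identity forces
κ∘φ = -κ∘ψ, which is impossible for curvature of constant sign. -/
theorem pullback_omega_eq_zero [ConnectedSpace M] {A : ParaKahlerSurface M} (hA : A.IsNonFlat)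
    (hΦ : ContMDiff (𝓡 2) ((𝓡 2).prod (𝓡 2)) ∞ Φ) (hL : IsLagrangian (-1) A A Φ)
    (hmin : IsMinimalSurface (prodMetric (-1) A.toLorentzMetric A.toLorentzMetric) Φ) (p : S)
    (X Y : Plane) :
    (pullback (I := 𝓡 2) A.omega (fun q => (Φ q).1) p : Plane →L[ℝ] Plane →L[ℝ] ℝ) X Y = 0 ∧
      (pullback (I := 𝓡 2) A.omega (fun q => (Φ q).2) p : Plane →L[ℝ] Plane →L[ℝ] ℝ) X Y = 0 := by
  have h1 : (pullback (I := 𝓡 2) A.omega (fun q => (Φ q).1) p :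
      Plane →L[ℝ] Plane →L[ℝ] ℝ) X Y = 0 := by
    by_contra hne
    obtain ⟨q, hq, V, W, hVW⟩ := A.frequently_of_pullback_omega_ne_zero hΦ.fst hne hA.dense
    have h2 := gaussCurvature_add_mul_pullback_omega_eq_zero A A hΦ hL hmin q V W
    exact hq (hA.eq_zero_of_add_eq_zero ((mul_eq_zero.1 h2).resolve_right hVW))
  refine ⟨h1, ?_⟩
  rw [← hL.pullback_omega_eq hΦ p X Y]
  exact h1

/-- With φ^*ω = ψ^*ω = 0 neither differential is onto, and the immersion property makes their
kernels disjoint. -/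
theorem rankAt_eq_one [ConnectedSpace M] {A : ParaKahlerSurface M} (hA : A.IsNonFlat)
    (hΦ : IsSmoothImmersion (𝓡 2) ((𝓡 2).prod (𝓡 2)) Φ) (hL : IsLagrangian (-1) A A Φ)
    (hmin : IsMinimalSurface (prodMetric (-1) A.toLorentzMetric A.toLorentzMetric) Φ) (p : S) :
    rankAt (fun q => (Φ q).1) p = 1 ∧ rankAt (fun q => (Φ q).2) p = 1 := by
  refine finrank_range_eq_one (L := mfderiv (𝓡 2) (𝓡 2) (fun q => (Φ q).1) p)
    (K := mfderiv (𝓡 2) (𝓡 2) (fun q => (Φ q).2) p)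
    ((A.isParaKahlerForm (Φ p).1).not_surjective fun X Y =>
      (pullback_omega_eq_zero hA hΦ.smooth hL hmin p X Y).1)
    ((A.isParaKahlerForm (Φ p).2).not_surjective fun X Y =>
      (pullback_omega_eq_zero hA hΦ.smooth hL hmin p X Y).2) fun X h1 h2 => ?_
  have h3 := mfderiv_prod_eq hΦ.smooth p X
  rw [← mfderiv_eq_fderiv_writtenInExtChartAt hΦ.smooth.fst,
    ← mfderiv_eq_fderiv_writtenInExtChartAt hΦ.smooth.snd, h1, h2] at h3
  exact hΦ.injective p (h3.trans (map_zero _).symm)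

end NonFlat

namespace LocalGeometry

/-! ### Product charts from two independent functions. -/

section ProductChart

/-- `Θ` is a local parametrisation on the square of side `2 δ`, with inverse `(a, b)` and image
in `W`. -/
structure IsProductChart (a b : Plane → ℝ) (W : Set Plane) (δ : ℝ)
    (Θ : OpenPartialHomeomorph (ℝ × ℝ) Plane) : Prop where
  pos : 0 < δ
  source_eq : Θ.source = Ioo (-δ) δ ×ˢ Ioo (-δ) δ
  target_subset : Θ.target ⊆ W
  smooth : ContDiffOn ℝ ∞ Θ Θ.source
  symm_apply : ∀ u ∈ Θ.target, Θ.symm u = (a u, b u)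

/-- The inverse function theorem for (a, b), followed by a restriction to a small square. -/
theorem exists_isProductChart {a b : Plane → ℝ} {W : Set Plane} {u₀ : Plane} (hW : IsOpen W)
    (hu₀ : u₀ ∈ W) (ha : ContDiffOn ℝ ∞ a W) (hb : ContDiffOn ℝ ∞ b W) (ha₀ : a u₀ = 0)
    (hb₀ : b u₀ = 0) (hi : ∀ X, fderiv ℝ a u₀ X = 0 → fderiv ℝ b u₀ X = 0 → X = 0) :
    ∃ δ Θ, IsProductChart a b W δ Θ ∧ Θ (0, 0) = u₀ := by
  set G : Plane → ℝ × ℝ := fun u => (a u, b u) with hG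
  have hGs : ContDiffOn ℝ ∞ G W := ha.prodMk hb
  have hat : ∀ {u}, u ∈ W → ContDiffAt ℝ ∞ G u := fun hu => hGs.contDiffAt (hW.mem_nhds hu)
  have hGd : ∀ {u}, u ∈ W → HasFDerivAt G (fderiv ℝ G u) u := fun hu =>
    ((hat hu).differentiableAt (by simp)).hasFDerivAt
  have hinj : Function.Injective (fderiv ℝ G u₀) := by
    refine (injective_iff_map_eq_zero _).2 fun X hX => ?_
    have h1 : fderiv ℝ G u₀ = (fderiv ℝ a u₀).prod (fderiv ℝ b u₀) :=
      DifferentiableAt.fderiv_prodMk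
        ((ha.contDiffAt (hW.mem_nhds hu₀)).differentiableAt (by simp))
        ((hb.contDiffAt (hW.mem_nhds hu₀)).differentiableAt (by simp))
    rw [h1] at hX
    exact hi X (congrArg Prod.fst hX) (congrArg Prod.snd hX)
  have hdim : Module.finrank ℝ Plane = Module.finrank ℝ (ℝ × ℝ) := by simp
  obtain ⟨f', hf'⟩ : ∃ f' : Plane ≃L[ℝ] ℝ × ℝ, (f' : Plane →L[ℝ] ℝ × ℝ) = fderiv ℝ G u₀ :=
    ⟨(LinearEquiv.ofInjectiveOfFinrankEq (fderiv ℝ G u₀).toLinearMap hinj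
      hdim).toContinuousLinearEquiv, by ext1 v; rfl⟩
  have hG₀ : HasFDerivAt G (f' : Plane →L[ℝ] ℝ × ℝ) u₀ := hf' ▸ hGd hu₀
  set e := (hat hu₀).toOpenPartialHomeomorph G hG₀ (by simp) with he
  have hec : ∀ u, e u = G u := fun u => rfl
  have hu₀e : u₀ ∈ e.source := (hat hu₀).mem_toOpenPartialHomeomorph_source hG₀ (by simp)
  have hd : ContinuousOn (fderiv ℝ G) W := hGs.continuousOn_fderiv_of_isOpen hW (by simp)
  -- The open locus where the derivative is invertible: the inverse has to be smooth on the whole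
  -- square, and not merely at its centre.
  set V := W ∩ fderiv ℝ G ⁻¹' range ((↑) : (Plane ≃L[ℝ] ℝ × ℝ) → Plane →L[ℝ] ℝ × ℝ) with hV
  have hVo : IsOpen V := hd.isOpen_inter_preimage hW ContinuousLinearEquiv.isOpen
  have hu₀V : u₀ ∈ V := ⟨hu₀, f', hf'⟩
  have hn : e.target ∩ e.symm ⁻¹' V ∈ 𝓝 ((0 : ℝ), (0 : ℝ)) := by
    have h0 : e u₀ = (0, 0) := Prod.ext ha₀ hb₀
    rw [← h0]
    refine (e.isOpen_inter_preimage_symm hVo).mem_nhds ⟨e.map_source hu₀e, ?_⟩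
    rw [mem_preimage, e.left_inv hu₀e]
    exact hu₀V
  obtain ⟨δ, hδ, hball⟩ := Metric.mem_nhds_iff.1 hn
  have hbox : Ioo (-δ) δ ×ˢ Ioo (-δ) δ ⊆ e.target ∩ e.symm ⁻¹' V := by
    refine Subset.trans (fun x hx => ?_) hball
    -- Balls of the sup norm on ℝ × ℝ are squares.
    rw [← ball_prod_same]
    simpa [Real.ball_eq_Ioo] using hx
  have hbo : IsOpen (Ioo (-δ) δ ×ˢ Ioo (-δ) δ : Set (ℝ × ℝ)) := isOpen_Ioo.prod isOpen_Ioo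
  set Θ := e.symm.restrOpen _ hbo with hΘ
  have hsrc : Θ.source = Ioo (-δ) δ ×ˢ Ioo (-δ) δ := by
    rw [hΘ, OpenPartialHomeomorph.restrOpen_source]
    exact inter_eq_right.2 fun x hx => (hbox hx).1
  have hΘV : ∀ z ∈ Θ.source, Θ z ∈ V := fun z hz => (hbox (hsrc ▸ hz)).2
  have h00 : ((0 : ℝ), (0 : ℝ)) ∈ Θ.source := by rw [hsrc]; simp [hδ]
  refine ⟨δ, Θ, ⟨hδ, hsrc, fun u hu => ?_, fun z hz => ?_, fun u hu => rfl⟩, ?_⟩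
  · have := hΘV _ (Θ.map_target hu)
    rw [Θ.right_inv hu] at this
    exact this.1
  · obtain ⟨hzW, f, hf⟩ := hΘV z hz
    have h1 : HasFDerivAt G (f : Plane →L[ℝ] ℝ × ℝ) (e.symm z) := hf ▸ hGd hzW
    exact (e.contDiffAt_symm (hbox (hsrc ▸ hz)).1 h1 (hat hzW)).contDiffWithinAt
  · have h1 : e.symm (e u₀) = u₀ := e.left_inv hu₀e
    rw [hec, hG] at h1
    simp only [ha₀, hb₀] at h1
    exact h1

variable {a b : Plane → ℝ} {W : Set Plane} {δ : ℝ} {Θ : OpenPartialHomeomorph (ℝ × ℝ) Plane}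

theorem IsProductChart.mem_source (h : IsProductChart a b W δ Θ) {s t : ℝ} (hs : s ∈ Ioo (-δ) δ)
    (ht : t ∈ Ioo (-δ) δ) : (s, t) ∈ Θ.source := by rw [h.source_eq]; exact ⟨hs, ht⟩

theorem IsProductChart.zero_mem (h : IsProductChart a b W δ Θ) : (0 : ℝ) ∈ Ioo (-δ) δ := by
  simp [h.pos]

theorem IsProductChart.apply (h : IsProductChart a b W δ Θ) {s t : ℝ} (hs : s ∈ Ioo (-δ) δ)
    (ht : t ∈ Ioo (-δ) δ) : a (Θ (s, t)) = s ∧ b (Θ (s, t)) = t := by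
  have hm := h.mem_source hs ht
  have h1 := h.symm_apply _ (Θ.map_source hm)
  rw [Θ.left_inv hm] at h1
  exact ⟨(congrArg Prod.fst h1).symm, (congrArg Prod.snd h1).symm⟩

theorem IsProductChart.mem_Ioo (h : IsProductChart a b W δ Θ) {u : Plane} (hu : u ∈ Θ.target) :
    a u ∈ Ioo (-δ) δ ∧ b u ∈ Ioo (-δ) δ := by
  have h1 := Θ.map_target hu
  rw [h.symm_apply u hu, h.source_eq] at h1
  exact h1

theorem IsProductChart.apply_symm (h : IsProductChart a b W δ Θ) {u : Plane} (hu : u ∈ Θ.target) :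
    Θ (a u, b u) = u := by
  rw [← h.symm_apply u hu, Θ.right_inv hu]

/-- A map whose derivative vanishes on the kernel of `da` is constant along curves on which `a` is
constant. -/
theorem eq_of_fderiv_ker_le {F : Type*} [NormedAddCommGroup F] [NormedSpace ℝ F] {f : Plane → F}
    {V : Set Plane} {c : ℝ → Plane} {k : ℝ}
    (hf : ∀ u ∈ V, DifferentiableAt ℝ f u) (ha : ∀ u ∈ V, DifferentiableAt ℝ a u)
    (hk : ∀ u ∈ V, ∀ X, fderiv ℝ a u X = 0 → fderiv ℝ f u X = 0)
    (hc : ∀ t ∈ Ioo (-δ) δ, DifferentiableAt ℝ c t) (hcV : ∀ t ∈ Ioo (-δ) δ, c t ∈ V)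
    (hac : ∀ t ∈ Ioo (-δ) δ, a (c t) = k) {s t : ℝ} (hs : s ∈ Ioo (-δ) δ) (ht : t ∈ Ioo (-δ) δ) :
    f (c s) = f (c t) := by
  have hd : ∀ r ∈ Ioo (-δ) δ, HasDerivAt (fun r => f (c r)) (fderiv ℝ f (c r) (deriv c r)) r :=
    fun r hr => (hf _ (hcV r hr)).hasFDerivAt.comp_hasDerivAt r (hc r hr).hasDerivAt
  have hz : ∀ r ∈ Ioo (-δ) δ, fderiv ℝ f (c r) (deriv c r) = 0 := by
    intro r hr
    refine hk _ (hcV r hr) _ ?_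
    have h1 : HasDerivAt (fun r => a (c r)) (fderiv ℝ a (c r) (deriv c r)) r :=
      (ha _ (hcV r hr)).hasFDerivAt.comp_hasDerivAt r (hc r hr).hasDerivAt
    exact h1.unique ((hasDerivAt_const r k).congr_of_eventuallyEq
      (Filter.mem_of_superset (isOpen_Ioo.mem_nhds hr) hac))
  exact isOpen_Ioo.is_const_of_deriv_eq_zero isPreconnected_Ioo
    (fun r hr => (hd r hr).differentiableAt.differentiableWithinAt)
    (fun r hr => by rw [(hd r hr).deriv, hz r hr]; rfl) hs ht

theorem IsProductChart.differentiableAt (h : IsProductChart a b W δ Θ) {s t : ℝ}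
    (hs : s ∈ Ioo (-δ) δ) (ht : t ∈ Ioo (-δ) δ) : DifferentiableAt ℝ Θ (s, t) :=
  (h.smooth.contDiffAt (Θ.open_source.mem_nhds (h.mem_source hs ht))).differentiableAt (by simp)

theorem IsProductChart.eq_fst {F : Type*} [NormedAddCommGroup F] [NormedSpace ℝ F]
    (h : IsProductChart a b W δ Θ) {f : Plane → F} (hf : ∀ u ∈ W, DifferentiableAt ℝ f u)
    (ha : ∀ u ∈ W, DifferentiableAt ℝ a u)
    (hk : ∀ u ∈ W, ∀ X, fderiv ℝ a u X = 0 → fderiv ℝ f u X = 0) {s t : ℝ}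
    (hs : s ∈ Ioo (-δ) δ) (ht : t ∈ Ioo (-δ) δ) : f (Θ (s, t)) = f (Θ (s, 0)) :=
  eq_of_fderiv_ker_le (c := fun t => Θ (s, t)) (k := s) (V := W) (δ := δ) hf ha hk
    (fun r hr => (h.differentiableAt hs hr).comp r
      ((differentiableAt_const s).prodMk differentiableAt_id))
    (fun _ hr => h.target_subset (Θ.map_source (h.mem_source hs hr)))
    (fun _ hr => (h.apply hs hr).1) ht h.zero_mem

theorem IsProductChart.eq_snd {F : Type*} [NormedAddCommGroup F] [NormedSpace ℝ F]
    (h : IsProductChart a b W δ Θ) {f : Plane → F} (hf : ∀ u ∈ W, DifferentiableAt ℝ f u)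
    (hb : ∀ u ∈ W, DifferentiableAt ℝ b u)
    (hk : ∀ u ∈ W, ∀ X, fderiv ℝ b u X = 0 → fderiv ℝ f u X = 0) {s t : ℝ}
    (hs : s ∈ Ioo (-δ) δ) (ht : t ∈ Ioo (-δ) δ) : f (Θ (s, t)) = f (Θ (0, t)) :=
  eq_of_fderiv_ker_le (c := fun s => Θ (s, t)) (k := t) (V := W) (δ := δ) hf hb hk
    (fun r hr => (h.differentiableAt hr ht).comp r
      (differentiableAt_id.prodMk (differentiableAt_const t)))
    (fun _ hr => h.target_subset (Θ.map_source (h.mem_source hr ht)))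
    (fun _ hr => (h.apply hr ht).2) hs h.zero_mem

end ProductChart

/-! ### Arclength functions of non-null curves. -/

section Arclength

/-- A smooth primitive of a smooth function on an interval around the origin. -/
theorem exists_smooth_primitive {v : ℝ → ℝ} {δ : ℝ} (hδ : 0 < δ)
    (hv : ContDiffOn ℝ ∞ v (Ioo (-δ) δ)) :
    ∃ ℓ : ℝ → ℝ, ContDiffOn ℝ ∞ ℓ (Ioo (-δ) δ) ∧ ℓ 0 = 0 ∧
      ∀ s ∈ Ioo (-δ) δ, HasDerivAt ℓ (v s) s := by
  have hd : ∀ s ∈ Ioo (-δ) δ, HasDerivAt (fun s => ∫ t in (0 : ℝ)..s, v t) (v s) s := by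
    intro s hs
    have h0 : (0 : ℝ) ∈ Ioo (-δ) δ := by simp [hδ]
    have hsub : uIcc 0 s ⊆ Ioo (-δ) δ := ordConnected_Ioo.uIcc_subset h0 hs
    have hca : ContinuousAt v s := hv.continuousOn.continuousAt (isOpen_Ioo.mem_nhds hs)
    exact intervalIntegral.integral_hasDerivAt_right
      ((hv.continuousOn.mono hsub).intervalIntegrable)
      (hv.continuousOn.stronglyMeasurableAtFilter isOpen_Ioo s hs) hca
  refine ⟨_, ?_, by simp, hd⟩
  rw [contDiffOn_infty_iff_deriv_of_isOpen isOpen_Ioo]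
  exact ⟨fun s hs => (hd s hs).differentiableAt.differentiableWithinAt,
    hv.congr fun s hs => (hd s hs).deriv⟩

/-- An arclength function. -/
theorem exists_arclength {v : ℝ → ℝ} {δ : ℝ} (hδ : 0 < δ)
    (hv : ContDiffOn ℝ ∞ v (Ioo (-δ) δ)) (h0 : ∀ s ∈ Ioo (-δ) δ, v s ≠ 0) :
    ∃ ℓ : ℝ → ℝ, ContDiffOn ℝ ∞ ℓ (Ioo (-δ) δ) ∧ ℓ 0 = 0 ∧
      ∀ s ∈ Ioo (-δ) δ, HasDerivAt ℓ (Real.sqrt |v s|) s := by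
  refine exists_smooth_primitive hδ fun s hs => ?_
  -- The absolute value and the square root are smooth here because v has no zero.
  have h1 : ContDiffAt ℝ ∞ v s := hv.contDiffAt (isOpen_Ioo.mem_nhds hs)
  have h2 : ContDiffAt ℝ ∞ (fun s => |v s|) s :=
    ContDiffAt.comp (g := fun x : ℝ => |x|) s (contDiffAt_abs (h0 s hs)) h1
  exact (h2.sqrt (abs_ne_zero.2 (h0 s hs))).contDiffWithinAt

end Arclength

end LocalGeometry

namespace LocalGeometry

/-! ### Pairs of linear functionals on the plane. -/

section Functional

theorem functional_plane_eq (η : Plane →L[ℝ] ℝ) (X : Plane) :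
    η X = X 0 * η (EuclideanSpace.single 0 1) + X 1 * η (EuclideanSpace.single 1 1) := by
  conv_lhs => rw [plane_eq X]
  simp

theorem functional_det_ne_zero {η μ : Plane →L[ℝ] ℝ} (h : ∀ X, η X = 0 → μ X = 0 → X = 0) :
    η (EuclideanSpace.single 0 1) * μ (EuclideanSpace.single 1 1) -
      η (EuclideanSpace.single 1 1) * μ (EuclideanSpace.single 0 1) ≠ 0 := by
  intro h0
  have key : ∀ p q : ℝ, p * η (EuclideanSpace.single 0 1) + q * η (EuclideanSpace.single 1 1) = 0 →
      p * μ (EuclideanSpace.single 0 1) + q * μ (EuclideanSpace.single 1 1) = 0 → p = 0 ∧ q = 0 := by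
    intro p q h1 h2
    have h3 := h (p • EuclideanSpace.single 0 1 + q • EuclideanSpace.single 1 1)
      (by simpa using h1) (by simpa using h2)
    exact ⟨by simpa using congrArg (fun x : Plane => x 0) h3,
      by simpa using congrArg (fun x : Plane => x 1) h3⟩
  -- The vector (-η(e₁), η(e₀)) lies in the kernel of η identically, and in that of μ because the
  -- determinant is zero; likewise with the roles of η and μ exchanged.
  obtain ⟨h1, h2⟩ := key (-η (EuclideanSpace.single 1 1)) (η (EuclideanSpace.single 0 1)) (by ring)
    (by linear_combination h0)
  obtain ⟨h3, h4⟩ := key (-μ (EuclideanSpace.single 1 1)) (μ (EuclideanSpace.single 0 1))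
    (by linear_combination -h0) (by ring)
  obtain ⟨h5, -⟩ := key 1 0 (by rw [h2]; ring) (by rw [h4]; ring)
  exact one_ne_zero h5

theorem functional_ne_zero {η μ : Plane →L[ℝ] ℝ} (h : ∀ X, η X = 0 → μ X = 0 → X = 0) :
    ∃ X, η X ≠ 0 := by
  by_contra! hn
  exact functional_det_ne_zero h (by rw [hn, hn]; ring)

theorem functional_exists_ker {η μ : Plane →L[ℝ] ℝ} (h : ∀ X, η X = 0 → μ X = 0 → X = 0) :
    ∃ X, μ X = 0 ∧ X ≠ 0 := by
  refine ⟨-μ (EuclideanSpace.single 1 1) • EuclideanSpace.single 0 1 +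
    μ (EuclideanSpace.single 0 1) • EuclideanSpace.single 1 1, by simp; ring, fun h0 => ?_⟩
  have h1 := functional_det_ne_zero h
  have h2 : μ (EuclideanSpace.single 1 1) = 0 := by simpa using congrArg (fun x : Plane => x 0) h0
  have h3 : μ (EuclideanSpace.single 0 1) = 0 := by simpa using congrArg (fun x : Plane => x 1) h0
  rw [h2, h3] at h1
  simp at h1

/-- If `L` is not surjective and `η ∘ L ≠ 0`, the kernel of `η ∘ L` is that of `L`. -/
theorem eq_zero_of_functional_apply {L : Plane →L[ℝ] Plane} (hL : ¬ Function.Surjective L)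
    {η : Plane →L[ℝ] ℝ} {Z : Plane} (hZ : η (L Z) ≠ 0) {X : Plane} (hX : η (L X) = 0) :
    L X = 0 := by
  by_contra hne
  apply hL
  refine (LinearMap.injective_iff_surjective (f := L.toLinearMap)).1
    ((injective_iff_map_eq_zero L).2 fun Y hY => ?_)
  by_contra hY0
  have hYη : η (L Y) = 0 := by rw [hY, map_zero]
  have e1 := functional_plane_eq (η ∘L L) X
  have e2 := functional_plane_eq (η ∘L L) Y
  have e3 := functional_plane_eq (η ∘L L) Z
  simp only [ContinuousLinearMap.comp_apply, hX, hYη] at e1 e2 e3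
  set p := η (L (EuclideanSpace.single 0 1))
  set q := η (L (EuclideanSpace.single 1 1))
  -- X and Y both lie in the kernel of η ∘ L, which is a line as η(L Z) ≠ 0. So X is a multiple of
  -- Y, a nonzero vector killed by L.
  have hdet : X 0 * Y 1 - X 1 * Y 0 = 0 := by
    by_contra hd
    have hp : p = 0 := by
      have : (X 0 * Y 1 - X 1 * Y 0) * p = 0 := by linear_combination X 1 * e2 - Y 1 * e1
      exact (mul_eq_zero.1 this).resolve_left hd
    have hq : q = 0 := by
      have : (X 0 * Y 1 - X 1 * Y 0) * q = 0 := by linear_combination Y 0 * e1 - X 0 * e2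
      exact (mul_eq_zero.1 this).resolve_left hd
    rw [hp, hq] at e3
    exact hZ (by rw [e3]; ring)
  have h0 : Y 0 • X = X 0 • Y := by
    ext i
    fin_cases i
    · simp; ring
    · simp; linear_combination -hdet
  have h1 : Y 1 • X = X 1 • Y := by
    ext i
    fin_cases i
    · simp; linear_combination hdet
    · simp; ring
  have k0 := congrArg L h0
  have k1 := congrArg L h1
  simp only [map_smul, hY, smul_zero, smul_eq_zero, hne, or_false] at k0 k1
  apply hY0
  ext i
  fin_cases i
  · simpa using k0
  · simpa using k1

end Functional

/-! ### Maps factoring through a curve, and their geodesic equation. -/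

section CurveFactor

/-- On the open set `V`, the map `φ` is the composition of the curve `α` with the function `a`. -/
structure IsCurveFactor (φ : Plane → Plane) (α : ℝ → Plane) (a : Plane → ℝ) (V : Set Plane)
    (δ : ℝ) : Prop where
  isOpen : IsOpen V
  smooth_curve : ContDiffOn ℝ ∞ α (Ioo (-δ) δ)
  smooth_fun : ContDiffOn ℝ ∞ a V
  mapsTo : MapsTo a V (Ioo (-δ) δ)
  eq : ∀ u ∈ V, φ u = α (a u)

variable {φ ψ : Plane → Plane} {α : ℝ → Plane} {a b : Plane → ℝ} {V W : Set Plane} {δ : ℝ}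
  {u : Plane} {g : Plane → Plane →L[ℝ] Plane →L[ℝ] ℝ} {Θ : OpenPartialHomeomorph (ℝ × ℝ) Plane}

theorem IsCurveFactor.eventuallyEq (h : IsCurveFactor φ α a V δ) (hu : u ∈ V) :
    φ =ᶠ[𝓝 u] α ∘ a := Filter.mem_of_superset (h.isOpen.mem_nhds hu) h.eq

theorem IsCurveFactor.contDiffAt_curve (h : IsCurveFactor φ α a V δ) (hu : u ∈ V) :
    ContDiffAt ℝ ∞ α (a u) := h.smooth_curve.contDiffAt (isOpen_Ioo.mem_nhds (h.mapsTo hu))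

theorem IsCurveFactor.contDiffAt_fun (h : IsCurveFactor φ α a V δ) (hu : u ∈ V) :
    ContDiffAt ℝ ∞ a u := h.smooth_fun.contDiffAt (h.isOpen.mem_nhds hu)

theorem IsCurveFactor.fderiv_apply (h : IsCurveFactor φ α a V δ) (hu : u ∈ V) (X : Plane) :
    fderiv ℝ φ u X = fderiv ℝ a u X • fderiv ℝ α (a u) 1 := by
  rw [(h.eventuallyEq hu).fderiv_eq, fderiv_comp u
    ((h.contDiffAt_curve hu).differentiableAt (by simp))
    ((h.contDiffAt_fun hu).differentiableAt (by simp)), ← map_smul]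
  simp

/-- The chain rule: an acceleration term weighted by da ⊗ da, and a term along the velocity, which
is harmless in tangency arguments. -/
theorem IsCurveFactor.covariantHessian_eq (h : IsCurveFactor φ α a V δ) (hu : u ∈ V)
    (X Y : Plane) : covariantHessian g φ u X Y =
      (fderiv ℝ a u X * fderiv ℝ a u Y) • covariantHessian g α (a u) 1 1 +
        fderiv ℝ (fderiv ℝ a) u X Y • fderiv ℝ α (a u) 1 := by
  have h1 : covariantHessian g φ u X Y = covariantHessian g (α ∘ a) u X Y := by
    have e := h.eventuallyEq hu
    simp only [covariantHessian, e.fderiv_eq, e.fderiv.fderiv_eq, e.eq_of_nhds]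
  have h2 : ∀ x : ℝ, fderiv ℝ α (a u) x = x • fderiv ℝ α (a u) 1 := fun x => by
    rw [← map_smul]; simp
  have h3 : ∀ x y : ℝ, fderiv ℝ (fderiv ℝ α) (a u) x y =
      (x * y) • fderiv ℝ (fderiv ℝ α) (a u) 1 1 := fun x y => by
    have e1 : fderiv ℝ (fderiv ℝ α) (a u) x = x • fderiv ℝ (fderiv ℝ α) (a u) 1 := by
      rw [← map_smul]; simp
    have e2 : fderiv ℝ (fderiv ℝ α) (a u) 1 y = y • fderiv ℝ (fderiv ℝ α) (a u) 1 1 := by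
      rw [← map_smul]; simp
    rw [e1, smul_apply, e2, smul_smul]
  rw [h1, covariantHessian_comp_right ((h.contDiffAt_curve hu).of_le two_le_infty)
    ((h.contDiffAt_fun hu).of_le two_le_infty)]
  rw [h2 (fderiv ℝ (fderiv ℝ a) u X Y)]
  simp only [covariantHessian]
  rw [h3, h2 (fderiv ℝ a u X), h2 (fderiv ℝ a u Y)]
  simp only [map_smul, LinearMap.smul_apply]
  module

theorem IsProductChart.isCurveFactor_fst (h : IsProductChart a b W δ Θ) (hW : IsOpen W)
    (hφ : ContDiffOn ℝ ∞ φ W) (ha : ContDiffOn ℝ ∞ a W)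
    (hk : ∀ u ∈ W, ∀ X, fderiv ℝ a u X = 0 → fderiv ℝ φ u X = 0) :
    IsCurveFactor φ (fun s => φ (Θ (s, 0))) a Θ.target δ where
  isOpen := Θ.open_target
  smooth_curve := by
    have h1 : ContDiffOn ℝ ∞ (fun s : ℝ => Θ (s, 0)) (Ioo (-δ) δ) :=
      h.smooth.comp (contDiffOn_id.prodMk contDiffOn_const) fun s hs => h.mem_source hs h.zero_mem
    exact hφ.comp h1 fun s hs => h.target_subset (Θ.map_source (h.mem_source hs h.zero_mem))
  smooth_fun := ha.mono h.target_subset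
  mapsTo u hu := (h.mem_Ioo hu).1
  eq u hu := by
    have h1 := h.eq_fst
      (fun v hv => (hφ.contDiffAt (hW.mem_nhds hv)).differentiableAt (by simp))
      (fun v hv => (ha.contDiffAt (hW.mem_nhds hv)).differentiableAt (by simp)) hk
      (h.mem_Ioo hu).1 (h.mem_Ioo hu).2
    rw [h.apply_symm hu] at h1
    exact h1

theorem IsProductChart.isCurveFactor_snd (h : IsProductChart a b W δ Θ) (hW : IsOpen W)
    (hφ : ContDiffOn ℝ ∞ φ W) (hb : ContDiffOn ℝ ∞ b W)
    (hk : ∀ u ∈ W, ∀ X, fderiv ℝ b u X = 0 → fderiv ℝ φ u X = 0) :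
    IsCurveFactor φ (fun s => φ (Θ (0, s))) b Θ.target δ where
  isOpen := Θ.open_target
  smooth_curve := by
    have h1 : ContDiffOn ℝ ∞ (fun s : ℝ => Θ (0, s)) (Ioo (-δ) δ) :=
      h.smooth.comp (contDiffOn_const.prodMk contDiffOn_id) fun s hs => h.mem_source h.zero_mem hs
    exact hφ.comp h1 fun s hs => h.target_subset (Θ.map_source (h.mem_source h.zero_mem hs))
  smooth_fun := hb.mono h.target_subset
  mapsTo u hu := (h.mem_Ioo hu).2
  eq u hu := by
    have h1 := h.eq_snd
      (fun v hv => (hφ.contDiffAt (hW.mem_nhds hv)).differentiableAt (by simp))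
      (fun v hv => (hb.contDiffAt (hW.mem_nhds hv)).differentiableAt (by simp)) hk
      (h.mem_Ioo hu).1 (h.mem_Ioo hu).2
    rw [h.apply_symm hu] at h1
    exact h1

/-- The squared speed of a curve. -/
def speedSq (g : Plane → Plane →L[ℝ] Plane →L[ℝ] ℝ) (α : ℝ → Plane) (s : ℝ) : ℝ :=
  g (α s) (fderiv ℝ α s 1) (fderiv ℝ α s 1)

theorem contDiffOn_speedSq {U : Set Plane} (hg : ContDiffOn ℝ ∞ g U)
    (hα : ContDiffOn ℝ ∞ α (Ioo (-δ) δ)) (hm : MapsTo α (Ioo (-δ) δ) U) :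
    ContDiffOn ℝ ∞ (speedSq g α) (Ioo (-δ) δ) := by
  have h1 : ContDiffOn ℝ ∞ (fun s => fderiv ℝ α s 1) (Ioo (-δ) δ) :=
    (hα.fderiv_of_isOpen isOpen_Ioo (by simp)).clm_apply contDiffOn_const
  exact ((hg.comp hα hm).clm_apply h1).clm_apply h1

/-- A reparametrisation by arclength has unit speed. -/
theorem IsCurveFactor.abs_speedSq_eq_one {α' : ℝ → Plane} {a' : Plane → ℝ} {V' : Set Plane}
    {δ' : ℝ} {ℓ : ℝ → ℝ} (h : IsCurveFactor φ α a V δ) (h' : IsCurveFactor φ α' a' V' δ')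
    (hu : u ∈ V) (hu' : u ∈ V') (ha : a' =ᶠ[𝓝 u] ℓ ∘ a)
    (hℓ : HasDerivAt ℓ (Real.sqrt |speedSq g α (a u)|) (a u)) (h0 : speedSq g α (a u) ≠ 0)
    {X : Plane} (hX : fderiv ℝ a u X ≠ 0) : |speedSq g α' (a' u)| = 1 := by
  have h1 : fderiv ℝ a' u X = Real.sqrt |speedSq g α (a u)| * fderiv ℝ a u X := by
    have h2 := hℓ.comp_hasFDerivAt u ((h.contDiffAt_fun hu).differentiableAt (by simp)).hasFDerivAt
    rw [ha.fderiv_eq, h2.fderiv]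
    simp
  have h2 := (h.fderiv_apply hu X).symm.trans (h'.fderiv_apply hu' X)
  rw [h1, mul_comm, mul_smul] at h2
  -- Both factorisations have the same differential. Cancelling da(X) compares the velocities of the
  -- two parametrisations.
  have h3 : fderiv ℝ α (a u) 1 =
      Real.sqrt |speedSq g α (a u)| • fderiv ℝ α' (a' u) 1 := smul_right_injective _ hX h2
  have h4 : speedSq g α (a u) = |speedSq g α (a u)| * speedSq g α' (a' u) := by
    conv_lhs => rw [speedSq, h3, ← h.eq u hu, h'.eq u hu']
    simp only [map_smul, smul_apply, smul_eq_mul]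
    rw [← mul_assoc, Real.mul_self_sqrt (abs_nonneg _)]
    rfl
  have h5 : |speedSq g α (a u)| = |speedSq g α (a u)| * |speedSq g α' (a' u)| := by
    conv_lhs => rw [h4]
    rw [abs_mul, abs_abs]
  have h6 : |speedSq g α (a u)| ≠ 0 := abs_ne_zero.2 h0
  exact mul_left_cancel₀ h6 (by rw [← h5, mul_one])

/-- A curve of unit speed whose acceleration is tangent to it is a geodesic. -/
theorem covariantHessian_eq_zero_of_unit {j : Plane → Plane →L[ℝ] Plane} {U : Set Plane}
    (hg : IsParaKahlerOn g j U) {s : ℝ} (hα : ContDiffAt ℝ ∞ α s) (hU : α s ∈ U)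
    (h1 : ∀ᶠ r in 𝓝 s, |speedSq g α r| = 1) {c d : ℝ} (hc : c ≠ 0)
    (h : c • covariantHessian g α s 1 1 = d • fderiv ℝ α s 1) : covariantHessian g α s 1 1 = 0 := by
  have hα2 := hα.of_le two_le_infty
  have hm := (hg.form _ hU).toIsMetricForm
  obtain ⟨L, hL, hLX⟩ := hasFDerivAt_pullback_metric hα2 (hg.differentiableAt hU) hm
    (hg.fderiv_symm hU) (1 : ℝ) (1 : ℝ)
  -- Squaring removes the absolute value, so the unit speed condition can be differentiated without
  -- knowing the causal character.
  have hsq : (fun r => speedSq g α r * speedSq g α r) =ᶠ[𝓝 s] fun _ => 1 := by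
    filter_upwards [h1] with r hr
    rw [← abs_mul_abs_self, hr, mul_one]
  have hL2 := ((hL.mul hL).unique ((hasFDerivAt_const (1 : ℝ) s).congr_of_eventuallyEq hsq))
  have h2 := congrArg (fun l : ℝ →L[ℝ] ℝ => l 1) hL2
  simp only [add_apply, smul_apply, smul_eq_mul, zero_apply, hLX] at h2
  rw [hm.symm (fderiv ℝ α s 1) (covariantHessian g α s 1 1)] at h2
  set q := g (α s) (covariantHessian g α s 1 1) (fderiv ℝ α s 1)
  have hs : speedSq g α s ≠ 0 := fun h0 => by
    have := h1.self_of_nhds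
    rw [h0] at this
    simp at this
  have hq : q = 0 := by
    have h3 : speedSq g α s * (4 * q) = 0 := by
      rw [speedSq]
      linear_combination h2
    linarith [(mul_eq_zero.1 h3).resolve_left hs]
  have h3 := congrArg (fun x => g (α s) x (fderiv ℝ α s 1)) h
  simp only [map_smul, smul_apply, smul_eq_mul] at h3
  -- The acceleration is orthogonal to the non-null velocity, so pairing the tangency relation with
  -- the velocity kills its right-hand side.
  have hd : d = 0 := by
    have h4 : d * speedSq g α s = 0 := by
      rw [speedSq, ← h3]
      change c * q = 0
      rw [hq, mul_zero]
    exact (mul_eq_zero.1 h4).resolve_right hs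
  rw [hd, zero_smul] at h
  exact (smul_eq_zero.1 h).resolve_left hc

/-- If the trace of the second covariant derivative of `φ = α ∘ a` is tangent, then the acceleration
of `α` is tangent to `α`. -/
theorem IsCurveFactor.exists_smul_covariantHessian_eq (hf : IsCurveFactor φ α a V δ) (hu : u ∈ V)
    {h : Plane → Plane → ℝ} {x y : ℝ} {μ : Plane →L[ℝ] ℝ}
    (hh : ∀ X Y, h X Y = x * (fderiv ℝ a u X * fderiv ℝ a u Y) + y * (μ X * μ Y)) (hy : y ≠ 0)
    (hi : ∀ X, fderiv ℝ a u X = 0 → μ X = 0 → X = 0) {v : Plane}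
    (hv : adjugateTrace h (covariantHessian g φ u) (EuclideanSpace.single 0 1)
      (EuclideanSpace.single 1 1) = fderiv ℝ φ u v) :
    ∃ c d : ℝ, c ≠ 0 ∧ c • covariantHessian g α (a u) 1 1 = d • fderiv ℝ α (a u) 1 := by
  have hdet := functional_det_ne_zero hi
  set e₀ : Plane := EuclideanSpace.single 0 1
  set e₁ : Plane := EuclideanSpace.single 1 1
  -- For h = x da² + y μ², the scaled trace of da ⊗ da is y times the square of the minor of (da,
  -- μ): the coefficient x cancels. Everything along the velocity is collected in d.
  refine ⟨y * (fderiv ℝ a u e₀ * μ e₁ - fderiv ℝ a u e₁ * μ e₀) ^ 2,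
    fderiv ℝ a u v - adjugateTrace h (fun X Y => fderiv ℝ (fderiv ℝ a) u X Y) e₀ e₁,
    mul_ne_zero hy (pow_ne_zero 2 hdet), ?_⟩
  rw [hf.fderiv_apply hu v] at hv
  rw [sub_smul, ← hv]
  simp only [adjugateTrace, hf.covariantHessian_eq hu, hh, smul_eq_mul]
  module

end CurveFactor

end LocalGeometry

namespace LocalGeometry

/-! ### Rank one components: the local product of geodesics in coordinates. -/

section Product

variable {g₁ g₂ : Plane → Plane →L[ℝ] Plane →L[ℝ] ℝ} {j₁ j₂ : Plane → Plane →L[ℝ] Plane}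
  {U₁ U₂ W : Set Plane} {φ ψ : Plane → Plane} {u₀ : Plane} {α β : ℝ → Plane}
  {a b : Plane → ℝ} {V : Set Plane} {δ : ℝ}

/-- A map of rank one has a coordinate near each point, whose derivative has the same kernel. -/
theorem exists_coordinate (hW : IsOpen W) (hφ : ContDiffOn ℝ ∞ φ W) (hu₀ : u₀ ∈ W)
    (hr : ∀ u ∈ W, ¬ Function.Surjective (fderiv ℝ φ u)) {Z : Plane} (hZ : fderiv ℝ φ u₀ Z ≠ 0) :
    ∃ (a : Plane → ℝ) (V : Set Plane), IsOpen V ∧ u₀ ∈ V ∧ V ⊆ W ∧ ContDiffOn ℝ ∞ a V ∧ a u₀ = 0 ∧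
      ∀ u ∈ V, ∀ X, fderiv ℝ a u X = 0 → fderiv ℝ φ u X = 0 := by
  -- A component of φ that varies at u₀ serves as coordinate, on the open set where its derivative
  -- along the fixed vector Z stays nonzero.
  obtain ⟨i, hi⟩ : ∃ i, fderiv ℝ φ u₀ Z i ≠ 0 := by
    by_contra! hn
    exact hZ (by ext i; simpa using hn i)
  set η : Plane →L[ℝ] ℝ := EuclideanSpace.proj i with hη
  have hd : ∀ u ∈ W, fderiv ℝ (fun u => η (φ u) - η (φ u₀)) u = η ∘L fderiv ℝ φ u := fun u hu => by
    have h1 := ((hφ.contDiffAt (hW.mem_nhds hu)).differentiableAt (by simp)).hasFDerivAt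
    exact ((η.hasFDerivAt.comp u h1).sub_const _).fderiv
  have hc : ContinuousOn (fun u => η (fderiv ℝ φ u Z)) W :=
    η.continuous.comp_continuousOn
      ((hφ.continuousOn_fderiv_of_isOpen hW (by simp)).clm_apply continuousOn_const)
  refine ⟨fun u => η (φ u) - η (φ u₀), W ∩ (fun u => η (fderiv ℝ φ u Z)) ⁻¹' {0}ᶜ,
    hc.isOpen_inter_preimage hW isOpen_compl_singleton, ⟨hu₀, hi⟩, inter_subset_left,
    ((η.contDiff.comp_contDiffOn hφ).sub contDiffOn_const).mono inter_subset_left, by simp,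
    fun u hu X hX => ?_⟩
  rw [hd u hu.1] at hX
  exact eq_zero_of_functional_apply (hr u hu.1) hu.2 hX

theorem inducedForm_curveFactor {u : Plane} (hφ : IsCurveFactor φ α a V δ)
    (hψ : IsCurveFactor ψ β b V δ) (hu : u ∈ V) (X Y : Plane) :
    inducedForm g₁ g₂ φ ψ u X Y =
      speedSq g₁ α (a u) * (fderiv ℝ a u X * fderiv ℝ a u Y) +
        (-speedSq g₂ β (b u)) * (fderiv ℝ b u X * fderiv ℝ b u Y) := by
  rw [inducedForm_apply, hφ.fderiv_apply hu, hφ.fderiv_apply hu, hψ.fderiv_apply hu,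
    hψ.fderiv_apply hu, hφ.eq u hu, hψ.eq u hu]
  simp only [map_smul, smul_apply, smul_eq_mul, speedSq]
  ring

/-- If x were zero, h = y μ² would have the kernel of μ as a null direction for everything. So
nondegeneracy of the induced metric excludes null curves. -/
theorem speedSq_ne_zero {h : Plane →L[ℝ] Plane →L[ℝ] ℝ} (hm : IsMetricForm h)
    {x y : ℝ} {η μ : Plane →L[ℝ] ℝ} (hh : ∀ X Y, h X Y = x * (η X * η Y) + y * (μ X * μ Y))
    (hi : ∀ X, η X = 0 → μ X = 0 → X = 0) : x ≠ 0 := by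
  rintro rfl
  obtain ⟨X, hX, hX0⟩ := functional_exists_ker hi
  exact hX0 (hm.nondegenerate X fun Y => by rw [hh, hX]; ring)

theorem ker_inter_eq_zero {u : Plane} (hm : IsMetricForm (inducedForm g₁ g₂ φ ψ u)) {X : Plane}
    (h₁ : fderiv ℝ φ u X = 0) (h₂ : fderiv ℝ ψ u X = 0) : X = 0 :=
  hm.nondegenerate X fun Y => by rw [inducedForm_apply, h₁, h₂]; simp

/-- A curve of unit speed and vanishing acceleration. -/
structure IsGeodesicOn (g : Plane → Plane →L[ℝ] Plane →L[ℝ] ℝ) (α : ℝ → Plane) (δ : ℝ) : Prop where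
  smooth : ContDiffOn ℝ ∞ α (Ioo (-δ) δ)
  unit : ∀ s ∈ Ioo (-δ) δ, |speedSq g α s| = 1
  geodesic : ∀ s ∈ Ioo (-δ) δ, covariantHessian g α s 1 1 = 0

theorem isGeodesicOn_of_unit {j : Plane → Plane →L[ℝ] Plane}
    {g : Plane → Plane →L[ℝ] Plane →L[ℝ] ℝ} {U : Set Plane} (hg : IsParaKahlerOn g j U)
    (hα : ContDiffOn ℝ ∞ α (Ioo (-δ) δ)) (hU : MapsTo α (Ioo (-δ) δ) U)
    (h1 : ∀ s ∈ Ioo (-δ) δ, |speedSq g α s| = 1)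
    (h : ∀ s ∈ Ioo (-δ) δ, ∃ c d : ℝ, c ≠ 0 ∧
      c • covariantHessian g α s 1 1 = d • fderiv ℝ α s 1) : IsGeodesicOn g α δ where
  smooth := hα
  unit := h1
  geodesic s hs := by
    obtain ⟨c, d, hc, hcd⟩ := h s hs
    exact covariantHessian_eq_zero_of_unit hg (hα.contDiffAt (isOpen_Ioo.mem_nhds hs)) (hU hs)
      (Filter.mem_of_superset (isOpen_Ioo.mem_nhds hs) h1) hc hcd

/-- A minimal surface in `g₁ - g₂` both of whose components have rank one is locally a product of
two geodesics. -/
theorem IsMinimalLagrangianOn.exists_product_of_geodesics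
    (h : IsMinimalLagrangianOn g₁ g₂ j₁ j₂ φ ψ W U₁ U₂) (h₁ : IsParaKahlerOn g₁ j₁ U₁)
    (h₂ : IsParaKahlerOn g₂ j₂ U₂) (hT : ∀ u ∈ W, IsTraceTangent g₁ g₂ φ ψ u)
    (r₁ : ∀ u ∈ W, ¬ Function.Surjective (fderiv ℝ φ u))
    (r₂ : ∀ u ∈ W, ¬ Function.Surjective (fderiv ℝ ψ u)) (hu₀ : u₀ ∈ W) :
    ∃ (δ : ℝ) (Θ : OpenPartialHomeomorph (ℝ × ℝ) Plane) (α β : ℝ → Plane), 0 < δ ∧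
      Θ.source = Ioo (-δ) δ ×ˢ Ioo (-δ) δ ∧ Θ (0, 0) = u₀ ∧ Θ.target ⊆ W ∧
      ContDiffOn ℝ ∞ Θ Θ.source ∧ ContDiffOn ℝ ∞ Θ.symm Θ.target ∧
      IsGeodesicOn g₁ α δ ∧ IsGeodesicOn g₂ β δ ∧
      ∀ s ∈ Ioo (-δ) δ, ∀ t ∈ Ioo (-δ) δ, φ (Θ (s, t)) = α s ∧ ψ (Θ (s, t)) = β t := by
  have hk : ∀ u ∈ W, ∀ X, fderiv ℝ φ u X = 0 → fderiv ℝ ψ u X = 0 → X = 0 := fun u hu X =>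
    ker_inter_eq_zero (h.nondegenerate u hu)
  -- If one differential vanished at u₀, the other would be injective, hence onto.
  obtain ⟨Z₁, hZ₁⟩ : ∃ Z, fderiv ℝ φ u₀ Z ≠ 0 := by
    by_contra! hn
    exact r₂ u₀ hu₀ ((LinearMap.injective_iff_surjective (f := (fderiv ℝ ψ u₀).toLinearMap)).1
      ((injective_iff_map_eq_zero _).2 fun X hX => hk u₀ hu₀ X (hn X) hX))
  obtain ⟨Z₂, hZ₂⟩ : ∃ Z, fderiv ℝ ψ u₀ Z ≠ 0 := by
    by_contra! hn
    exact r₁ u₀ hu₀ ((LinearMap.injective_iff_surjective (f := (fderiv ℝ φ u₀).toLinearMap)).1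
      ((injective_iff_map_eq_zero _).2 fun X hX => hk u₀ hu₀ X hX (hn X)))
  obtain ⟨a, V₁, hV₁, hu₁, hVW₁, ha, ha₀, hka⟩ :=
    exists_coordinate h.isOpen h.smooth_fst hu₀ r₁ hZ₁
  obtain ⟨b, V₂, hV₂, hu₂, hVW₂, hb, hb₀, hkb⟩ :=
    exists_coordinate h.isOpen h.smooth_snd hu₀ r₂ hZ₂
  set V := V₁ ∩ V₂ with hV
  have hVo : IsOpen V := hV₁.inter hV₂
  have hVW : V ⊆ W := fun u hu => hVW₁ hu.1
  have hi : ∀ u ∈ V, ∀ X, fderiv ℝ a u X = 0 → fderiv ℝ b u X = 0 → X = 0 := fun u hu X h1 h2 =>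
    hk u (hVW hu) X (hka u hu.1 X h1) (hkb u hu.2 X h2)
  obtain ⟨δ, Θ, hΘ, hΘ₀⟩ := exists_isProductChart hVo ⟨hu₁, hu₂⟩ (ha.mono inter_subset_left)
    (hb.mono inter_subset_right) ha₀ hb₀ (hi u₀ ⟨hu₁, hu₂⟩)
  have hf₁ := hΘ.isCurveFactor_fst hVo (h.smooth_fst.mono hVW) (ha.mono inter_subset_left)
    fun u hu => hka u hu.1
  have hf₂ := hΘ.isCurveFactor_snd hVo (h.smooth_snd.mono hVW) (hb.mono inter_subset_right)
    fun u hu => hkb u hu.2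
  set α := fun s => φ (Θ (s, 0)) with hα
  set β := fun s => ψ (Θ (0, s)) with hβ
  have hΘW : Θ.target ⊆ W := hΘ.target_subset.trans hVW
  have hv : ∀ u ∈ Θ.target, speedSq g₁ α (a u) ≠ 0 ∧ speedSq g₂ β (b u) ≠ 0 := by
    intro u hu
    have hm := h.nondegenerate u (hΘW hu)
    have hI := inducedForm_curveFactor (g₁ := g₁) (g₂ := g₂) hf₁ hf₂ hu
    have hiu := hi u (hΘ.target_subset hu)
    refine ⟨speedSq_ne_zero hm hI hiu, neg_ne_zero.1 (speedSq_ne_zero hm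
      (fun X Y => (hI X Y).trans (add_comm _ _)) fun X h1 h2 => hiu X h2 h1)⟩
  have hαU : MapsTo α (Ioo (-δ) δ) U₁ := fun s hs =>
    h.mapsTo_fst (hΘW (Θ.map_source (hΘ.mem_source hs hΘ.zero_mem)))
  have hβU : MapsTo β (Ioo (-δ) δ) U₂ := fun s hs =>
    h.mapsTo_snd (hΘW (Θ.map_source (hΘ.mem_source hΘ.zero_mem hs)))
  obtain ⟨ℓ, hℓ, hℓ₀, hℓd⟩ := exists_arclength hΘ.pos
    (contDiffOn_speedSq h₁.smooth_metric hf₁.smooth_curve hαU) fun s hs => by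
      have h1 := (hv _ (Θ.map_source (hΘ.mem_source hs hΘ.zero_mem))).1
      rwa [(hΘ.apply hs hΘ.zero_mem).1] at h1
  obtain ⟨m, hm, hm₀, hmd⟩ := exists_arclength hΘ.pos
    (contDiffOn_speedSq h₂.smooth_metric hf₂.smooth_curve hβU) fun s hs => by
      have h1 := (hv _ (Θ.map_source (hΘ.mem_source hΘ.zero_mem hs))).2
      rwa [(hΘ.apply hΘ.zero_mem hs).2] at h1
  have hda : ∀ u ∈ Θ.target, ∀ X, fderiv ℝ (ℓ ∘ a) u X =
      Real.sqrt |speedSq g₁ α (a u)| * fderiv ℝ a u X := fun u hu X => by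
    rw [((hℓd _ (hΘ.mem_Ioo hu).1).comp_hasFDerivAt u
      ((hf₁.contDiffAt_fun hu).differentiableAt (by simp)).hasFDerivAt).fderiv]
    simp
  have hdb : ∀ u ∈ Θ.target, ∀ X, fderiv ℝ (m ∘ b) u X =
      Real.sqrt |speedSq g₂ β (b u)| * fderiv ℝ b u X := fun u hu X => by
    rw [((hmd _ (hΘ.mem_Ioo hu).2).comp_hasFDerivAt u
      ((hf₂.contDiffAt_fun hu).differentiableAt (by simp)).hasFDerivAt).fderiv]
    simp
  -- The arclength function has nonzero derivative along the curve, so passing from a to ℓ ∘ a keeps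
  -- the kernel of the differential.
  have hka' : ∀ u ∈ Θ.target, ∀ X, fderiv ℝ (ℓ ∘ a) u X = 0 → fderiv ℝ a u X = 0 := by
    intro u hu X hX
    rw [hda u hu] at hX
    exact (mul_eq_zero.1 hX).resolve_left
      (Real.sqrt_ne_zero'.2 (abs_pos.2 (hv u hu).1))
  have hkb' : ∀ u ∈ Θ.target, ∀ X, fderiv ℝ (m ∘ b) u X = 0 → fderiv ℝ b u X = 0 := by
    intro u hu X hX
    rw [hdb u hu] at hX
    exact (mul_eq_zero.1 hX).resolve_left
      (Real.sqrt_ne_zero'.2 (abs_pos.2 (hv u hu).2))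
  have hi' : ∀ u ∈ Θ.target, ∀ X, fderiv ℝ (ℓ ∘ a) u X = 0 → fderiv ℝ (m ∘ b) u X = 0 → X = 0 :=
    fun u hu X h1 h2 => hi u (hΘ.target_subset hu) X (hka' u hu X h1) (hkb' u hu X h2)
  have hu₀Θ : u₀ ∈ Θ.target := by
    rw [← hΘ₀]; exact Θ.map_source (hΘ.mem_source hΘ.zero_mem hΘ.zero_mem)
  have hsa : ContDiffOn ℝ ∞ (ℓ ∘ a) Θ.target := hℓ.comp hf₁.smooth_fun hf₁.mapsTo
  have hsb : ContDiffOn ℝ ∞ (m ∘ b) Θ.target := hm.comp hf₂.smooth_fun hf₂.mapsTo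
  -- A second product chart, now with the two arclengths as coordinates: its curves have unit speed.
  obtain ⟨ε, Ξ, hΞ, hΞ₀⟩ := exists_isProductChart Θ.open_target hu₀Θ hsa hsb
    (by rw [Function.comp_apply, ha₀, hℓ₀]) (by rw [Function.comp_apply, hb₀, hm₀])
    (hi' u₀ hu₀Θ)
  have hF₁ := hΞ.isCurveFactor_fst Θ.open_target (h.smooth_fst.mono hΘW) hsa fun u hu X hX =>
    hka u (hΘ.target_subset hu).1 X (hka' u hu X hX)
  have hF₂ := hΞ.isCurveFactor_snd Θ.open_target (h.smooth_snd.mono hΘW) hsb fun u hu X hX =>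
    hkb u (hΘ.target_subset hu).2 X (hkb' u hu X hX)
  have hΞW : Ξ.target ⊆ W := hΞ.target_subset.trans hΘW
  have hmem : ∀ s ∈ Ioo (-ε) ε, ∀ t ∈ Ioo (-ε) ε, Ξ (s, t) ∈ Ξ.target := fun s hs t ht =>
    Ξ.map_source (hΞ.mem_source hs ht)
  have hunit₁ : ∀ s ∈ Ioo (-ε) ε, |speedSq g₁ (fun s => φ (Ξ (s, 0))) s| = 1 := by
    intro s hs
    have hu := hmem s hs 0 hΞ.zero_mem
    have huΘ := hΞ.target_subset hu
    obtain ⟨X, hX⟩ := functional_ne_zero (hi _ (hΘ.target_subset huΘ))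
    have h1 := hf₁.abs_speedSq_eq_one hF₁ huΘ hu (Filter.EventuallyEq.refl _ _)
      (hℓd _ (hf₁.mapsTo huΘ)) (hv _ huΘ).1 hX
    rwa [(hΞ.apply hs hΞ.zero_mem).1] at h1
  have hunit₂ : ∀ s ∈ Ioo (-ε) ε, |speedSq g₂ (fun s => ψ (Ξ (0, s))) s| = 1 := by
    intro s hs
    have hu := hmem 0 hΞ.zero_mem s hs
    have huΘ := hΞ.target_subset hu
    obtain ⟨X, hX⟩ := functional_ne_zero fun X h1 h2 => hi _ (hΘ.target_subset huΘ) X h2 h1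
    have h1 := hf₂.abs_speedSq_eq_one hF₂ huΘ hu (Filter.EventuallyEq.refl _ _)
      (hmd _ (hf₂.mapsTo huΘ)) (hv _ huΘ).2 hX
    rwa [(hΞ.apply hΞ.zero_mem hs).2] at h1
  have hne : ∀ x : ℝ, |x| = 1 → x ≠ 0 := by rintro x hx rfl; simp at hx
  have hgeo₁ : IsGeodesicOn g₁ (fun s => φ (Ξ (s, 0))) ε := by
    refine isGeodesicOn_of_unit h₁ hF₁.smooth_curve
      (fun s hs => h.mapsTo_fst (hΞW (hmem s hs 0 hΞ.zero_mem))) hunit₁ fun s hs => ?_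
    have hu := hmem s hs 0 hΞ.zero_mem
    obtain ⟨v, hv₁, -⟩ := hT _ (hΞW hu)
    -- The coefficient that must be nonzero is the one of the other curve, which is ±1 by unit
    -- speed.
    have h1 := hF₁.exists_smul_covariantHessian_eq hu
      (inducedForm_curveFactor (g₁ := g₁) (g₂ := g₂) hF₁ hF₂ hu)
      (neg_ne_zero.2 (hne _ (hunit₂ _ (hF₂.mapsTo hu)))) (hi' _ (hΞ.target_subset hu)) hv₁
    rwa [(hΞ.apply hs hΞ.zero_mem).1] at h1
  have hgeo₂ : IsGeodesicOn g₂ (fun s => ψ (Ξ (0, s))) ε := by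
    refine isGeodesicOn_of_unit h₂ hF₂.smooth_curve
      (fun s hs => h.mapsTo_snd (hΞW (hmem 0 hΞ.zero_mem s hs))) hunit₂ fun s hs => ?_
    have hu := hmem 0 hΞ.zero_mem s hs
    obtain ⟨v, -, hv₂⟩ := hT _ (hΞW hu)
    have h1 := hF₂.exists_smul_covariantHessian_eq hu
      (fun X Y => (inducedForm_curveFactor (g₁ := g₁) (g₂ := g₂) hF₁ hF₂ hu X Y).trans
        (add_comm _ _)) (hne _ (hunit₁ _ (hF₁.mapsTo hu)))
      (fun X h1 h2 => hi' _ (hΞ.target_subset hu) X h2 h1) hv₂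
    rwa [(hΞ.apply hΞ.zero_mem hs).2] at h1
  refine ⟨ε, Ξ, _, _, hΞ.pos, hΞ.source_eq, hΞ₀, hΞW, hΞ.smooth, ?_, hgeo₁, hgeo₂,
    fun s hs t ht => ?_⟩
  · exact ((hsa.mono hΞ.target_subset).prodMk (hsb.mono hΞ.target_subset)).congr hΞ.symm_apply
  · have hu := hmem s hs t ht
    have h1 := hF₁.eq _ hu
    have h2 := hF₂.eq _ hu
    rw [(hΞ.apply hs ht).1] at h1
    rw [(hΞ.apply hs ht).2] at h2
    exact ⟨h1, h2⟩

end Product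

end LocalGeometry

/-! ### Return to the manifolds. -/

section ProductOfGeodesics

open LocalGeometry

variable {M : Type*} [TopologicalSpace M] [ChartedSpace Plane M] [IsManifold (𝓡 2) ∞ M]
  {S : Type*} [TopologicalSpace S] [ChartedSpace Plane S] [IsManifold (𝓡 2) ∞ S]
  {Φ : S → M × M}

/-- The acceleration of a curve in M is computed in the chart at the current point, whereas α lives
in the chart at x. The transition map between them is an isometry and carries one acceleration to
the other. -/
theorem covHess_chart_symm_comp (A : ParaKahlerSurface M) (x : M) {α : ℝ → Plane} {t : ℝ}
    (hα : ContDiffAt ℝ ∞ α t) (ht : α t ∈ (extChartAt (𝓡 2) x).target) {y : M}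
    (hy : y = (extChartAt (𝓡 2) x).symm (α t)) :
    (covHess (I := 𝓘(ℝ, ℝ)) A.metric ((extChartAt (𝓡 2) x).symm ∘ α) t (1 : ℝ) (1 : ℝ) : Plane) =
      fderiv ℝ (transition x y) (α t) (covariantHessian (coordMetric A.metric x) α t 1 1) := by
  subst hy
  have hT := mem_transitionDomain_symm x ht
  have hs : ContMDiffAt 𝓘(ℝ, ℝ) (𝓡 2) ∞ ((extChartAt (𝓡 2) x).symm ∘ α) t :=
    (contMDiffAt_chart_symm x ht).comp t hα.contMDiffAt
  have hw : writtenInExtChartAt 𝓘(ℝ, ℝ) (𝓡 2) t ((extChartAt (𝓡 2) x).symm ∘ α) =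
      transition x ((extChartAt (𝓡 2) x).symm (α t)) ∘ α := rfl
  have hd : (mfderiv 𝓘(ℝ, ℝ) (𝓡 2) ((extChartAt (𝓡 2) x).symm ∘ α) t : ℝ →L[ℝ] Plane) =
      fderiv ℝ (transition x ((extChartAt (𝓡 2) x).symm (α t)) ∘ α) t := by
    rw [(hs.mdifferentiableAt (by simp)).mfderiv, ModelWithCorners.range_eq_univ,
      fderivWithin_univ, hw]
    rfl
  have h1 : ∀ D : ℝ →L[ℝ] Plane,
      (mfderiv 𝓘(ℝ, ℝ) (𝓡 2) ((extChartAt (𝓡 2) x).symm ∘ α) t : ℝ →L[ℝ] Plane) = D →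
      (covHess (I := 𝓘(ℝ, ℝ)) A.metric ((extChartAt (𝓡 2) x).symm ∘ α) t (1 : ℝ) (1 : ℝ) : Plane) =
      fderiv ℝ (fderiv ℝ (transition x ((extChartAt (𝓡 2) x).symm (α t)) ∘ α)) t 1 1 +
        christoffelSymbol (coordMetric A.metric ((extChartAt (𝓡 2) x).symm (α t)))
          (transition x ((extChartAt (𝓡 2) x).symm (α t)) (α t)) (D 1) (D 1) := by
    rintro _ rfl
    rfl
  rw [h1 _ hd]
  have hm := A.isParaKahlerMapOn_transition x ((extChartAt (𝓡 2) x).symm (α t))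
  exact covariantHessian_comp_left (hα.of_le two_le_infty)
    ((contMDiffAt_transition _ _ hT).contDiffAt.of_le two_le_infty)
    (surjective_fderiv_transition _ _ hT)
    ((A.isParaKahlerOn _).differentiableAt (mapsTo_transition _ _ hT))
    (A.isMetricForm _ (mapsTo_transition _ _ hT)) (A.fderiv_symm _ (mapsTo_transition _ _ hT))
    (Filter.mem_of_superset ((isOpen_transitionDomain _ _).mem_nhds hT) hm.metric)
    ((A.isParaKahlerOn _).differentiableAt ht) 1 1

theorem isUnitGeodesicOn_chart_symm_comp (A : ParaKahlerSurface M) (x : M) {α : ℝ → Plane} {δ : ℝ}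
    (hα : IsGeodesicOn (coordMetric A.metric x) α δ)
    (hm : MapsTo α (Ioo (-δ) δ) (extChartAt (𝓡 2) x).target) :
    IsUnitGeodesicOn A.metric ((extChartAt (𝓡 2) x).symm ∘ α) (Ioo (-δ) δ) where
  smooth t ht := ((contMDiffAt_chart_symm x (hm ht)).comp t
    (hα.smooth.contDiffAt (isOpen_Ioo.mem_nhds ht)).contMDiffAt).contMDiffWithinAt
  unit t ht := by
    have hd : MDifferentiableAt 𝓘(ℝ, ℝ) 𝓘(ℝ, Plane) α t :=
      ((hα.smooth.contDiffAt (isOpen_Ioo.mem_nhds ht)).differentiableAt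
        (by simp)).mdifferentiableAt
    have h1 := pullback_comp (I := 𝓘(ℝ, ℝ)) (J := 𝓘(ℝ, Plane)) (K := 𝓡 2) (N := Plane)
      A.metric hd ((contMDiffAt_chart_symm x (hm ht)).mdifferentiableAt (by simp))
    have h2 := congrArg (fun b : ℝ →L[ℝ] ℝ →L[ℝ] ℝ => b 1 1) h1
    have h3 : (mfderiv 𝓘(ℝ, ℝ) 𝓘(ℝ, Plane) α t : ℝ →L[ℝ] Plane) = fderiv ℝ α t :=
      mfderiv_eq_fderiv
    have h4 : ∀ D : ℝ →L[ℝ] Plane, (mfderiv 𝓘(ℝ, ℝ) 𝓘(ℝ, Plane) α t : ℝ →L[ℝ] Plane) = D →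
        (pullback (I := 𝓘(ℝ, ℝ)) (J := 𝓘(ℝ, Plane)) (M := ℝ) (N := Plane)
          (coordMetric A.metric x) α t : ℝ →L[ℝ] ℝ →L[ℝ] ℝ) 1 1 =
          coordMetric A.metric x (α t) (D 1) (D 1) := by
      rintro _ rfl
      rfl
    exact (congrArg abs (h2.trans (h4 _ h3))).trans (hα.unit t ht)
  geodesic t ht := by
    refine (covHess_chart_symm_comp A x (hα.smooth.contDiffAt (isOpen_Ioo.mem_nhds ht)) (hm ht)
      rfl).trans ?_
    rw [hα.geodesic t ht, map_zero]
    rfl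

theorem not_surjective_fderiv_written (A : ParaKahlerSurface M) {f : S → M}
    (hf : ContMDiff (𝓡 2) (𝓡 2) ∞ f)
    (h0 : ∀ (q : S) (X Y : Plane),
      (pullback (I := 𝓡 2) A.omega f q : Plane →L[ℝ] Plane →L[ℝ] ℝ) X Y = 0) (p : S) {u : Plane}
    (hu : u ∈ coordDomain f p) :
    ¬ Function.Surjective (fderiv ℝ (writtenInExtChartAt (𝓡 2) (𝓡 2) p f) u) := by
  refine ((A.isParaKahlerOn _).form _ (mapsTo_writtenInExtChartAt f p hu)).not_surjective
    fun X Y => ?_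
  rw [A.coordMetric_coordJ _ (mapsTo_writtenInExtChartAt f p hu),
    ← coordMetric_pullback hf A.omega p hu]
  exact h0 ((extChartAt (𝓡 2) p).symm u)
    (mfderiv 𝓘(ℝ, Plane) (𝓡 2) (extChartAt (𝓡 2) p).symm u X)
    (mfderiv 𝓘(ℝ, Plane) (𝓡 2) (extChartAt (𝓡 2) p).symm u Y)

theorem isProductOfGeodesicsNear [ConnectedSpace M] {A : ParaKahlerSurface M} (hA : A.IsNonFlat)
    (hΦ : ContMDiff (𝓡 2) ((𝓡 2).prod (𝓡 2)) ∞ Φ) (hL : IsLagrangian (-1) A A Φ)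
    (hmin : IsMinimalSurface (prodMetric (-1) A.toLorentzMetric A.toLorentzMetric) Φ) (p : S) :
    IsProductOfGeodesicsNear A.toLorentzMetric A.toLorentzMetric Φ p := by
  have hω := pullback_omega_eq_zero hA hΦ hL hmin
  obtain ⟨δ, Θ, α, β, hδ, hsrc, hΘ₀, hΘW, hΘs, hΘs', hα, hβ, hprod⟩ :=
    (isMinimalLagrangianOn_written A A hΦ hL hmin p).exists_product_of_geodesics
      (A.isParaKahlerOn _) (A.isParaKahlerOn _)
      (fun u hu => isTraceTangent_written A A hΦ hmin p hu.1 hu.2)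
      (fun u hu => not_surjective_fderiv_written A hΦ.fst (fun q X Y => (hω q X Y).1) p hu.1)
      (fun u hu => not_surjective_fderiv_written A hΦ.snd (fun q X Y => (hω q X Y).2) p hu.2)
      (u₀ := extChartAt (𝓡 2) p p) ⟨chart_mem_coordDomain _ p, chart_mem_coordDomain _ p⟩
  have h0 : (0 : ℝ) ∈ Ioo (-δ) δ := by simp [hδ]
  have hmem : ∀ {s t}, s ∈ Ioo (-δ) δ → t ∈ Ioo (-δ) δ → Θ (s, t) ∈ Θ.target := fun hs ht =>
    Θ.map_source (by rw [hsrc]; exact ⟨hs, ht⟩)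
  have hT : Θ.target ⊆ (extChartAt (𝓡 2) p).target := fun u hu => (hΘW hu).1.1
  -- The planar product chart followed by the inverse of the chart of S at p; nothing is lost from
  -- the square, since the image of Θ lies in the chart's target.
  set F : OpenPartialHomeomorph (ℝ × ℝ) S := Θ.trans (chartAt Plane p).symm with hF
  have hFe : ∀ z, F z = (extChartAt (𝓡 2) p).symm (Θ z) := fun z => by simp [hF]
  have hFs : F.source = Θ.source := by
    rw [hF, OpenPartialHomeomorph.trans_source]
    refine inter_eq_left.2 fun z hz => ?_
    have := hT (Θ.map_source hz)
    simpa using this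
  refine ⟨δ, F, (extChartAt (𝓡 2) (Φ p).1).symm ∘ α, (extChartAt (𝓡 2) (Φ p).2).symm ∘ β, hδ,
    hFs.trans hsrc, ?_, ?_, ?_, ?_, ?_, fun s hs t ht => ?_⟩
  · rw [hFe, hΘ₀]
    exact (extChartAt (𝓡 2) p).left_inv (mem_extChartAt_source p)
  · intro z hz
    rw [hFs] at hz
    exact ((contMDiffAt_chart_symm p (hT (Θ.map_source hz))).comp z
      (hΘs.contDiffAt (Θ.open_source.mem_nhds hz)).contMDiffAt).contMDiffWithinAt
  · intro q hq
    have hq' : q ∈ (chartAt Plane p).source ∧ chartAt Plane p q ∈ Θ.target := by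
      simpa [hF] using hq
    have h1 : ContMDiffAt (𝓡 2) 𝓘(ℝ, Plane) ∞ (extChartAt (𝓡 2) p) q :=
      contMDiffAt_chart p (by simpa using hq'.1)
    exact (ContMDiffAt.comp q ((hΘs'.contDiffAt (Θ.open_target.mem_nhds hq'.2)).contMDiffAt)
      h1).contMDiffWithinAt
  · refine isUnitGeodesicOn_chart_symm_comp A _ hα fun s hs => ?_
    rw [← (hprod s hs 0 h0).1]
    exact mapsTo_writtenInExtChartAt (fun q => (Φ q).1) p (hΘW (hmem hs h0)).1
  · refine isUnitGeodesicOn_chart_symm_comp A _ hβ fun s hs => ?_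
    rw [← (hprod 0 h0 s hs).2]
    exact mapsTo_writtenInExtChartAt (fun q => (Φ q).2) p (hΘW (hmem h0 hs)).2
  · have h1 := hΘW (hmem hs ht)
    refine Prod.ext ?_ ?_
    · simp only [hFe, Function.comp_apply, ← (hprod s hs t ht).1]
      exact (chart_symm_writtenInExtChartAt (fun q => (Φ q).1) p h1.1).symm
    · simp only [hFe, Function.comp_apply, ← (hprod s hs t ht).2]
      exact (chart_symm_writtenInExtChartAt (fun q => (Φ q).2) p h1.2).symm

end ProductOfGeodesics

end

theorem corollary2
    {M : Type*} [TopologicalSpace M] [T2Space M] [SecondCountableTopology M] [ConnectedSpace M]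
    [ChartedSpace Plane M] [IsManifold (𝓡 2) ∞ M]
    (A : ParaKahlerSurface M) (hA : A.IsNonFlat)
    {S : Type*} [TopologicalSpace S] [ChartedSpace Plane S] [IsManifold (𝓡 2) ∞ S]
    (Φ : S → M × M) (hΦ : PseudoRiemannian.IsSmoothImmersion (𝓡 2) ((𝓡 2).prod (𝓡 2)) Φ)
    (hLag : IsLagrangian (-1) A A Φ)
    (hMin : PseudoRiemannian.IsMinimalSurface (prodMetric (-1) A.toLorentzMetric A.toLorentzMetric) Φ) :
    (∀ p, IsProjectedRankOneAt Φ p) ∧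
      ∀ p, IsProductOfGeodesicsNear A.toLorentzMetric A.toLorentzMetric Φ p :=
  -- Both projections have rank one; the disjunction only asks for the first.
  ⟨fun p => Or.inl (rankAt_eq_one hA hΦ hLag hMin p).1,
    fun p => isProductOfGeodesicsNear hA hΦ.smooth hLag hMin p⟩
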